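/- Let $\Bbbk$ be an algebraically closed field of characteristic $0$, let $m\ge 6$ be an integer, and let $X_m\subseteq\mathbb P^4$ be the image (that is, the Zariski closure of the set of values) of the rational map $\mathbb P^2\dashrightarrow\mathbb P^4$ given by $$[y_1^{m-1}y_2 : y_0^{m-1}y_1 : y_1^m+y_1^{m-3}y_2^3 : y_0^m : y_2^{m-1}y_0].$$ Then $X_m$ is a surface (an irreducible closed subset of dimension $2$) of degree $m^2-m+3$. Suppose in addition that $m=6k$ for some integer $k\ge 1$. Put $b_1=6k^2-k-1$, $b_2=18k^2-9k$, $b_3=18k^2-10k+1$, $b_4=12k^2-7k$, and $(c_1,\varepsilon_1)=(6k^2-k,\,0)$, $(c_2,\varepsilon_2)=(18k^2-9k+1,\,2)$, $(c_3,\varepsilon_3)=(18k^2-7k+1,\,0)$, $(c_4,\varepsilon_4)=(30k^2-13k+2,\,0)$. For $1\le i\le 4$ let $N_i$ be the $(b_i+1)\times(54k^2-27k+3)$ matrix whose row $u$ ($0\le u\le b_i$) has the entries $\binom{3u+\varepsilon_i}{0},\binom{3u+\varepsilon_i}{1},\dots,\binom{3u+\varepsilon_i}{3u+\varepsilon_i}$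 in the columns $c_i-u,\,c_i-u+1,\dots,c_i+2u+\varepsilon_i$ (columns are numbered from $1$) and $0$ in all other columns. Let $L(k)$ be the square matrix obtained by stacking $N_1,N_2,N_3,N_4$ from top to bottom and deleting the first row of the result. Let $W(k)$ be the square matrix obtained by stacking $W_1,W_2,W_3,W_4$, where $W_i$ is $N_i$ without its last row, its first column and its last two columns. If $L(k)$ and $W(k)$ are both invertible (over $\Bbbk$), then the largest degree of a minimal homogeneous generator of the homogeneous ideal $I_{X_m}$ satisfies $$\operatorname{maxdeg} I_{X_m}\ \ge\ \tfrac32m^2-\tfrac72m+1,$$ and $X_m$ is a counterexample to the Eisenbud–Goto conjecture: it is a nondegenerate projective variety (it lies in no hyperplane) and $$\operatorname{reg}X_m>\deg X_m-\operatorname{codim}X_m+1,$$ where $\operatorname{reg}X_m$ is the least integer $q$ such that $H^i(\mathbb P^4,\mathcal I_{X_m}(q-i))=0$ for all $i\ge1$, with $\mathcal I_{X_m}$ the ideal sheaf of $X_m$. -/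

import Mathlib

namespace EG

open MvPolynomial Filter

section ProjectiveSpace

/-- The set of closed points of projective `n`-space over `K`. -/
def ProjSpace (K : Type*) [Field K] (n : ℕ) : Type _ :=
  Projectivization K (Fin (n + 1) → K)

/-- A representative of homogeneous coordinates of a point. -/
noncomputable def ProjSpace.coords {K : Type*} [Field K] {n : ℕ} (p : ProjSpace K n) :
    Fin (n + 1) → K :=
  Projectivization.rep p

/-- The common zeros in projective space of a set of polynomials
(used only for sets of homogeneous polynomials). -/
def projZeros {K : Type*} [Field K] {n : ℕ} (T : Set (MvPolynomial (Fin (n + 1)) K)) :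
    Set (ProjSpace K n) :=
  {p | ∀ F ∈ T, eval p.coords F = 0}

/-- `Z` is an algebraic subset: the zero locus of a set of homogeneous polynomials. -/
def IsAlgebraicSet {K : Type*} [Field K] {n : ℕ} (Z : Set (ProjSpace K n)) : Prop :=
  ∃ T : Set (MvPolynomial (Fin (n + 1)) K),
    (∀ F ∈ T, ∃ d : ℕ, F.IsHomogeneous d) ∧ Z = projZeros T

theorem isAlgebraicSet_empty {K : Type*} [Field K] {n : ℕ} :
    IsAlgebraicSet (∅ : Set (ProjSpace K n)) := by
  refine ⟨{1}, ?_, ?_⟩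
  · rintro F rfl
    exact ⟨0, isHomogeneous_one _ _⟩
  · ext p
    simp [projZeros]

theorem isAlgebraicSet_sInter {K : Type*} [Field K] {n : ℕ}
    (A : Set (Set (ProjSpace K n))) (hA : ∀ Z ∈ A, IsAlgebraicSet Z) :
    IsAlgebraicSet (⋂₀ A) := by
  refine ⟨{F | (∃ d : ℕ, F.IsHomogeneous d) ∧ ∃ Z ∈ A, ∀ p ∈ Z, eval p.coords F = 0},
    fun F hF => hF.1, ?_⟩
  ext p
  constructor
  · rintro hp F ⟨-, Z, hZ, hF⟩
    exact hF p (hp Z hZ)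
  · intro hp Z hZ
    obtain ⟨T, hT, rfl⟩ := hA Z hZ
    intro F hF
    exact hp F ⟨hT F hF, projZeros T, hZ, fun q hq => hq F hF⟩

theorem isAlgebraicSet_union {K : Type*} [Field K] {n : ℕ}
    (Y : Set (ProjSpace K n)) (hY : IsAlgebraicSet Y)
    (Z : Set (ProjSpace K n)) (hZ : IsAlgebraicSet Z) :
    IsAlgebraicSet (Y ∪ Z) := by
  obtain ⟨T, hT, rfl⟩ := hY
  obtain ⟨U, hU, rfl⟩ := hZ
  refine ⟨{H | ∃ F ∈ T, ∃ G ∈ U, H = F * G}, ?_, ?_⟩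
  · rintro H ⟨F, hF, G, hG, rfl⟩
    obtain ⟨d, hd⟩ := hT F hF
    obtain ⟨e, he⟩ := hU G hG
    exact ⟨d + e, hd.mul he⟩
  · ext p
    constructor
    · rintro (hp | hp) H ⟨F, hF, G, hG, rfl⟩
      · simp [hp F hF]
      · simp [hp G hG]
    · intro hp
      by_contra hc
      simp only [Set.mem_union, not_or, projZeros, Set.mem_ofPred_eq, not_forall] at hc
      obtain ⟨⟨F, hF, hF0⟩, G, hG, hG0⟩ := hc
      have := hp (F * G) ⟨F, hF, G, hG, rfl⟩
      rw [map_mul] at this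
      exact (mul_ne_zero hF0 hG0) this

/-- The Zariski topology: the closed sets are the algebraic sets. -/
instance ProjSpace.zariskiTopology (K : Type*) [Field K] (n : ℕ) :
    TopologicalSpace (ProjSpace K n) :=
  TopologicalSpace.ofClosed {Z | IsAlgebraicSet Z} isAlgebraicSet_empty
    isAlgebraicSet_sInter isAlgebraicSet_union

/-- The homogeneous ideal `I_X` of a subset `X` of projective space: the ideal generated by the
homogeneous polynomials that vanish at every point of `X`. -/
noncomputable def homogIdeal {K : Type*} [Field K] {n : ℕ} (X : Set (ProjSpace K n)) :
    Ideal (MvPolynomial (Fin (n + 1)) K) :=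
  Ideal.span {F | (∃ d : ℕ, F.IsHomogeneous d) ∧ ∀ p ∈ X, eval p.coords F = 0}

/-- The (closed) image of the rational map from projective `a`-space to projective `b`-space given
by the forms `s 0, …, s b` of the same degree: the Zariski closure of the set of the points
`[s 0 (y) : … : s b (y)]`, where `y` runs over the points at which not all `s i` vanish. -/
noncomputable def rationalImage {K : Type*} [Field K] {a b : ℕ}
    (s : Fin (b + 1) → MvPolynomial (Fin (a + 1)) K) : Set (ProjSpace K b) :=
  closure {q | ∃ (y : ProjSpace K a) (h : (fun i => eval y.coords (s i)) ≠ 0),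
    q = Projectivization.mk K (fun i => eval y.coords (s i)) h}

/-- A projective variety: an irreducible (in particular nonempty) Zariski closed subset. -/
def IsProjVariety {K : Type*} [Field K] {n : ℕ} (X : Set (ProjSpace K n)) : Prop :=
  IsClosed X ∧ IsIrreducible X

/-- `X` is a projective variety of dimension two. -/
def IsProjSurface {K : Type*} [Field K] {n : ℕ} (X : Set (ProjSpace K n)) : Prop :=
  IsProjVariety X ∧ topologicalKrullDim X = 2

/-- `X` lies in no hyperplane. -/
def IsNondegenerate {K : Type*} [Field K] {n : ℕ} (X : Set (ProjSpace K n)) : Prop :=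
  ∀ F : MvPolynomial (Fin (n + 1)) K, F.IsHomogeneous 1 →
    (∀ p ∈ X, eval p.coords F = 0) → F = 0

end ProjectiveSpace

section Invariants

/-- The Hilbert function of `S / I`: the `K`-dimension of its degree `t` part. -/
noncomputable def hilbertFun {K : Type*} [Field K] {n : ℕ}
    (I : Ideal (MvPolynomial (Fin (n + 1)) K)) (t : ℕ) : ℕ :=
  Module.finrank K
    ((homogeneousSubmodule (Fin (n + 1)) K t).map (Ideal.Quotient.mkₐ K I).toLinearMap)

/-- `P` is the Hilbert polynomial of `X`. -/
def IsHilbertPolynomial {K : Type*} [Field K] {n : ℕ} (X : Set (ProjSpace K n))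
    (P : Polynomial ℚ) : Prop :=
  ∀ᶠ t : ℕ in atTop, (hilbertFun (homogIdeal X) t : ℚ) = P.eval (t : ℚ)

/-- `X` has degree `δ`: with `r` the dimension of `X`, the number `δ` is `r!` times the leading
coefficient of the Hilbert polynomial of `X`. -/
def HasDegree {K : Type*} [Field K] {n : ℕ} (X : Set (ProjSpace K n)) (δ : ℕ) : Prop :=
  ∃ (r : ℕ) (P : Polynomial ℚ), topologicalKrullDim X = r ∧ IsHilbertPolynomial X P ∧
    (Nat.factorial r : ℚ) * P.leadingCoeff = δ

/-- `G` is a minimal set of homogeneous generators of the ideal `I`. -/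
def IsMinimalGenSet {K : Type*} [Field K] {n : ℕ} (I : Ideal (MvPolynomial (Fin (n + 1)) K))
    (G : Set (MvPolynomial (Fin (n + 1)) K)) : Prop :=
  (∀ g ∈ G, ∃ d : ℕ, g.IsHomogeneous d) ∧ Ideal.span G = I ∧
    ∀ g ∈ G, g ∉ Ideal.span (G \ {g})

/-- `maxdeg I`: the largest degree of a minimal generator of `I`. -/
noncomputable def maxdeg {K : Type*} [Field K] {n : ℕ}
    (I : Ideal (MvPolynomial (Fin (n + 1)) K)) : EReal :=
  sSup {x | ∃ G, IsMinimalGenSet I G ∧ ∃ g ∈ G, x = (g.totalDegree : EReal)}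

/-- For a homogeneous ideal `I` with ideal sheaf `J`, the sections of `J(d)` over the open set
`x_{σ 0} ⋯ x_{σ (p-1)} ≠ 0`, i.e. the degree `d` part of the localization of `I` at this product of
variables, inside the field of rational functions. -/
def cechSections {K : Type*} [Field K] {n : ℕ} (I : Ideal (MvPolynomial (Fin (n + 1)) K))
    (d : ℤ) {p : ℕ} (σ : Fin p → Fin (n + 1)) :
    Set (FractionRing (MvPolynomial (Fin (n + 1)) K)) :=
  {z | ∃ (N e : ℕ) (g : MvPolynomial (Fin (n + 1)) K), g ∈ I ∧ g.IsHomogeneous e ∧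
    (e : ℤ) = d + N * p ∧
    z = algebraMap (MvPolynomial (Fin (n + 1)) K) (FractionRing (MvPolynomial (Fin (n + 1)) K)) g /
      algebraMap (MvPolynomial (Fin (n + 1)) K) (FractionRing (MvPolynomial (Fin (n + 1)) K))
        (∏ j, X (σ j)) ^ N}

/-- The Čech differential, on families indexed by all tuples of indices. -/
def cechDiff {ι A : Type*} [AddCommGroup A] {p : ℕ} (c : (Fin p → ι) → A) :
    (Fin (p + 1) → ι) → A :=
  fun σ => ∑ j : Fin (p + 1), (-1 : ℤ) ^ (j : ℕ) • c (fun l => σ (j.succAbove l))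

/-- Vanishing, for `i ≥ 1`, of the `i`-th cohomology of the sheaf `J(d)`, where `J` is the ideal
sheaf of the homogeneous ideal `I`: every Čech `i`-cocycle for the standard affine covering
`x_0 ≠ 0, …, x_n ≠ 0` of projective `n`-space is a coboundary. -/
def CohomologyVanishes {K : Type*} [Field K] {n : ℕ} (I : Ideal (MvPolynomial (Fin (n + 1)) K))
    (d : ℤ) (i : ℕ) : Prop :=
  ∀ c : (Fin (i + 1) → Fin (n + 1)) → FractionRing (MvPolynomial (Fin (n + 1)) K),
    (∀ σ, c σ ∈ cechSections I d σ) → cechDiff c = 0 →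
    ∃ b : (Fin i → Fin (n + 1)) → FractionRing (MvPolynomial (Fin (n + 1)) K),
      (∀ τ, b τ ∈ cechSections I d τ) ∧ cechDiff b = c

/-- The ideal sheaf `J` of the homogeneous ideal `I` is `q`-regular: `H^i(J(q - i)) = 0` for all
`i ≥ 1`. -/
def IsCMRegular {K : Type*} [Field K] {n : ℕ} (I : Ideal (MvPolynomial (Fin (n + 1)) K))
    (q : ℤ) : Prop :=
  ∀ i : ℕ, 1 ≤ i → CohomologyVanishes I (q - i) i

/-- The regularity of `X`: the least integer `q` such that the ideal sheaf of `X` is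
`q`-regular. -/
noncomputable def regularity {K : Type*} [Field K] {n : ℕ} (X : Set (ProjSpace K n)) : EReal :=
  sInf {x | ∃ q : ℤ, IsCMRegular (homogIdeal X) q ∧ x = ((q : ℝ) : EReal)}

/-- `X` is a counterexample to the Eisenbud–Goto conjecture: a nondegenerate projective variety
with `reg X > deg X - codim X + 1`. -/
def IsEisenbudGotoCounterexample {K : Type*} [Field K] {n : ℕ} (X : Set (ProjSpace K n)) : Prop :=
  IsProjVariety X ∧ IsNondegenerate X ∧
    ∃ r δ : ℕ, topologicalKrullDim X = r ∧ HasDegree X δ ∧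
      (((δ : ℝ) - ((n : ℝ) - (r : ℝ)) + 1 : ℝ) : EReal) < regularity X

end Invariants

section Surfaces

/-- The five forms of degree `m` on the projective plane. -/
noncomputable def forms (K : Type*) [Field K] (m : ℕ) : Fin 5 → MvPolynomial (Fin 3) K :=
  ![X 1 ^ (m - 1) * X 2,
    X 0 ^ (m - 1) * X 1,
    X 1 ^ m + X 1 ^ (m - 3) * X 2 ^ 3,
    X 0 ^ m,
    X 2 ^ (m - 1) * X 0]

/-- The image `X_m` in projective 4-space of the rational map given by these forms. -/
def surf (K : Type*) [Field K] (m : ℕ) : Set (ProjSpace K 4) :=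
  rationalImage (a := 2) (b := 4) (forms K m)

end Surfaces

section Matrices

/-- The number `b_1(k)`. Here and below no subtraction is truncated as long as `k ≥ 1`. -/
def bOne (k : ℕ) : ℕ := 6 * k ^ 2 - k - 1

/-- The number `b_2(k)`. -/
def bTwo (k : ℕ) : ℕ := 18 * k ^ 2 - 9 * k

/-- The number `b_3(k)`. -/
def bThree (k : ℕ) : ℕ := 18 * k ^ 2 - 10 * k + 1

/-- The number `b_4(k)`. -/
def bFour (k : ℕ) : ℕ := 12 * k ^ 2 - 7 * k

/-- The entry, in row `u` and column `v` (both counted from `0`), of the matrix whose row `u`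
consists of the binomial coefficients `binom (3u+ε) 0, …, binom (3u+ε) (3u+ε)` in consecutive
columns, the first of them in column `c - u`, and of zeros in all other columns. -/
def binomEntry (ε c u v : ℕ) : ℕ :=
  if c ≤ v + u then Nat.choose (3 * u + ε) (v + u - c) else 0

/-- The entries of `N_1(k)`, a matrix with rows `0, …, b_1(k)`. In this and in the next three
definitions, rows and columns are counted from `0`, and the columns are `0, …, 54k²-27k+2`. -/
def entryOne (k u v : ℕ) : ℕ := binomEntry 0 (6 * k ^ 2 - k - 1) u v

/-- The entries of `N_2(k)`, a matrix with rows `0, …, b_2(k)`. -/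
def entryTwo (k u v : ℕ) : ℕ := binomEntry 2 (18 * k ^ 2 - 9 * k) u v

/-- The entries of `N_3(k)`, a matrix with rows `0, …, b_3(k)`. -/
def entryThree (k u v : ℕ) : ℕ := binomEntry 0 (18 * k ^ 2 - 7 * k) u v

/-- The entries of `N_4(k)`, a matrix with rows `0, …, b_4(k)`. -/
def entryFour (k u v : ℕ) : ℕ := binomEntry 0 (30 * k ^ 2 - 13 * k + 1) u v

/-- Row `p`, column `v`, of the matrix obtained by stacking, from top to bottom, a matrix with `r₁`
rows and entries `f₁`, one with `r₂` rows and entries `f₂`, one with `r₃` rows and entries `f₃`,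
and one with entries `f₄`. -/
def stackEntry (r₁ r₂ r₃ : ℕ) (f₁ f₂ f₃ f₄ : ℕ → ℕ → ℕ) (p v : ℕ) : ℕ :=
  if p < r₁ then f₁ p v
  else if p < r₁ + r₂ then f₂ (p - r₁) v
  else if p < r₁ + r₂ + r₃ then f₃ (p - (r₁ + r₂)) v
  else f₄ (p - (r₁ + r₂ + r₃)) v

/-- The matrix `N(k)`: `N_1(k), …, N_4(k)` on top of each other. -/
def matN (R : Type*) [CommRing R] (k : ℕ) :
    Matrix (Fin (54 * k ^ 2 - 27 * k + 4)) (Fin (54 * k ^ 2 - 27 * k + 3)) R :=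
  Matrix.of fun p v =>
    (stackEntry (bOne k + 1) (bTwo k + 1) (bThree k + 1)
      (entryOne k) (entryTwo k) (entryThree k) (entryFour k) (p : ℕ) (v : ℕ) : R)

/-- The square matrix `L(k)`: `N(k)` without its first row. -/
def matL (R : Type*) [CommRing R] (k : ℕ) :
    Matrix (Fin (54 * k ^ 2 - 27 * k + 3)) (Fin (54 * k ^ 2 - 27 * k + 3)) R :=
  (matN R k).submatrix Fin.succ id

/-- The square matrix `W(k)`: `W_1(k), …, W_4(k)` on top of each other, where `W_i(k)` is `N_i(k)`
without its last row, its first column and its last two columns. -/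
def matW (R : Type*) [CommRing R] (k : ℕ) :
    Matrix (Fin (54 * k ^ 2 - 27 * k)) (Fin (54 * k ^ 2 - 27 * k)) R :=
  Matrix.of fun p v =>
    (stackEntry (bOne k) (bTwo k) (bThree k)
      (entryOne k) (entryTwo k) (entryThree k) (entryFour k) (p : ℕ) ((v : ℕ) + 1) : R)

end Matrices

end EG

/-!
Write `φ : K[x₀, …, x₄] → K[y₀, y₁, y₂]` for the map sending `xᵢ` to the `i`-th form. Since `K` is
infinite, the ideal `I` of the surface is the kernel of `φ` (`homogIdeal_surf_eq_ker`), so it is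
prime, the surface is irreducible, and its Hilbert function is `dim φ(S_t)`.

*Degree and dimension.* The base locus of the rational map is the point `[0 : 0 : 1]` with ideal
`(y₀, y₁ ^ (m - 3))`, so `φ(S_t)` lies in the span of the monomials of degree `m t` in the `t`-th
power of this ideal. Conversely a fixed monomial multiplies this span into `φ(S_{t + c})` for a
constant `c` (`monomial_mem_imagePart`). Counting monomials gives the leading term
`(m² - m + 3) / 2 * t²` of the Hilbert polynomial. The degree of the Hilbert polynomial bounds the
dimension from above, because it drops strictly for smaller irreducible closed sets
(`natDegree_hilbertPolynomial_lt`); a chain of a point and a curve bounds it from below.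

*A generator of large degree.* Let `m = 6 k` and `d = 54 k² - 21 k + 1`. The grading of `I` can be
refined by the degree in `y₀` and by the degree in `y₂` modulo `3`. In the multidegree
`(d, 2 m - 2, 2)` there are four families of monomials, and with `y₀ = y₁ = 1` the map `φ` sends
them to powers of `y₂` times powers of `1 + y₂³`, so that the elements of `I` in this multidegree
are the solutions of a linear system with binomial coefficients. The monomials that do not
correspond to rows of the matrix `N` drop out, as they meet columns which no other monomial
meets (`IsRelation.eq_zero_of_lt`). Because `N` has one more row than columns there is a solution
`F ≠ 0`. If `F = ∑ xⱼ Gⱼ` with `Gⱼ ∈ I`, then every `xⱼ Gⱼ` is a solution as well, in which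
`x₀ ^ (d - 2) x₁²` is missing if `j ≥ 2`, and the last monomial of the second family, which involves
neither `x₀` nor `x₁`, is missing if `j ≤ 1`. Invertibility of `L`, respectively `W`, shows that such
a solution is zero, a contradiction (`exists_equation_not_mem`).

*Regularity.* By Mumford's theorem (`mem_span_X_mul_of_isCMRegular`), if the ideal sheaf is
`q`-regular then `I` is generated in degrees at most `q`. It is proved for Čech cohomology by a
diagram chase in the double complex of the Koszul complex of the variables and the Čech complex
(`exists_cocycle_of_double_complex`). Hence the regularity is at least
`d > (m² - m + 3) - 2 + 1`.
-/

namespace EG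

open MvPolynomial Filter

/-! ### The Koszul complex -/

section Koszul

variable {ι F : Type*} [LinearOrder ι] [Field F]

/-- The sign with which `e_j` enters `e_j ∧ e_S`, for `j ∉ S`. -/
def koszulSign (F : Type*) [Field F] (j : ι) (S : Finset ι) : F :=
  (-1) ^ (S.filter (· < j)).card

theorem koszulSign_mul_self (j : ι) (S : Finset ι) :
    koszulSign F j S * koszulSign F j S = 1 := by
  rw [koszulSign, ← mul_pow]; simp

theorem koszulSign_insert {j l : ι} {S : Finset ι} (hl : l ∉ S) :
    koszulSign F j (insert l S) = (if l < j then -1 else 1) * koszulSign F j S := by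
  unfold koszulSign
  rw [Finset.filter_insert]
  split_ifs with h
  · rw [Finset.card_insert_of_notMem (by simp [hl]), pow_succ]; ring
  · simp

theorem koszulSign_swap {j l : ι} {S : Finset ι} (hj : j ∉ S) (hl : l ∉ S) (h : j ≠ l) :
    koszulSign F j S * koszulSign F l (insert j S) =
      -(koszulSign F l S * koszulSign F j (insert l S)) := by
  rw [koszulSign_insert hj, koszulSign_insert hl]
  rcases lt_or_gt_of_ne h with h | h
  · simp [h, h.not_gt]; ring
  · simp [h, h.not_gt]; ring

variable [Fintype ι]

/-- The Koszul differential of a family `x` of scalars: a function `z` on subsets stands for the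
element `∑ z_S e_S` of the exterior algebra. -/
def koszul (x : ι → F) (z : Finset ι → F) (S : Finset ι) : F :=
  ∑ j, if j ∈ S then 0 else koszulSign F j S * x j * z (insert j S)

theorem koszul_koszul (x : ι → F) (z : Finset ι → F) (S : Finset ι) :
    koszul x (koszul x z) S = 0 := by
  have h : koszul x (koszul x z) S = ∑ a : ι × ι, if a.1 ∈ S then 0 else
      koszulSign F a.1 S * x a.1 * (if a.2 ∈ insert a.1 S then 0 else
        koszulSign F a.2 (insert a.1 S) * x a.2 * z (insert a.2 (insert a.1 S))) := by
    rw [Fintype.sum_prod_type]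
    refine Finset.sum_congr rfl fun j _ => ?_
    split_ifs with hj
    · simp
    · rw [koszul, Finset.mul_sum]
  rw [h]
  refine Finset.sum_involution (fun a _ => a.swap) ?_ ?_ (by simp) (by simp)
  · rintro ⟨j, k⟩ -
    by_cases hj : j ∈ S
    · simp [hj]
    by_cases hk : k ∈ S
    · simp [hk]
    by_cases hjk : j = k
    · simp [hjk]
    have := koszulSign_swap (F := F) hj hk hjk
    simp only [Prod.fst_swap, Prod.snd_swap, hj, hk, Finset.mem_insert, hjk, Ne.symm hjk,
      if_false, or_self]
    rw [Finset.insert_comm k j S]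
    linear_combination (x j * x k * z (insert j (insert k S))) * this
  · rintro ⟨j, k⟩ - hne h
    simp only [Prod.swap_prod_mk, Prod.mk.injEq] at h
    simp [h.1] at hne

/-- The contracting homotopy of the Koszul complex given by an invertible scalar `x l`: exterior
multiplication by `e_l / x l`. -/
def koszulHomotopy (x : ι → F) (l : ι) (z : Finset ι → F) (S : Finset ι) : F :=
  if l ∈ S then koszulSign F l (S.erase l) * (x l)⁻¹ * z (S.erase l) else 0

theorem koszul_koszulHomotopy (x : ι → F) (l : ι) (hl : x l ≠ 0) (z : Finset ι → F)
    (hz : ∀ S, koszul x z S = 0) (S : Finset ι) :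
    koszul x (koszulHomotopy x l z) S = z S := by
  by_cases hS : l ∈ S
  · obtain ⟨T, hT, rfl⟩ : ∃ T, l ∉ T ∧ insert l T = S :=
      ⟨S.erase l, by simp, Finset.insert_erase hS⟩
    have h1 : koszul x (koszulHomotopy x l z) (insert l T) =
        ∑ j, if j ∈ insert l T then 0 else
          - (koszulSign F l T * (x l)⁻¹ * (koszulSign F j T * x j * z (insert j T))) := by
      refine Finset.sum_congr rfl fun j _ => ?_
      split_ifs with hj
      · rfl
      rw [Finset.mem_insert, not_or] at hj
      have he : (insert j (insert l T)).erase l = insert j T := by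
        rw [Finset.insert_comm, Finset.erase_insert]
        simp [hT, Ne.symm hj.1]
      rw [koszulHomotopy, if_pos (by simp), he]
      rw [koszulSign_insert hj.2, koszulSign_insert hT]
      rcases lt_or_gt_of_ne hj.1 with h | h
      · simp [h, h.not_gt]; ring
      · simp [h, h.not_gt]; ring
    have h2 : koszul x z T = ∑ j, ((if j ∈ insert l T then 0 else
          (koszulSign F j T * x j * z (insert j T))) +
          if j = l then koszulSign F l T * x l * z (insert l T) else 0) := by
      refine Finset.sum_congr rfl fun j _ => ?_
      by_cases hjl : j = l
      · subst hjl; simp [hT]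
      · simp [hjl]
    rw [hz, Finset.sum_add_distrib, Finset.sum_ite_eq' Finset.univ l] at h2
    have h3 : koszul x (koszulHomotopy x l z) (insert l T) = - (koszulSign F l T * (x l)⁻¹ *
        ∑ j, if j ∈ insert l T then 0 else (koszulSign F j T * x j * z (insert j T))) := by
      rw [h1, Finset.mul_sum, ← Finset.sum_neg_distrib]
      refine Finset.sum_congr rfl fun j _ => ?_
      split_ifs <;> simp
    have h4 := koszulSign_mul_self (F := F) l T
    rw [if_pos (Finset.mem_univ _)] at h2
    rw [h3, eq_neg_of_add_eq_zero_left h2.symm]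
    field_simp
    linear_combination (z (insert l T)) * h4
  · rw [koszul, Finset.sum_eq_single l]
    · rw [if_neg hS, koszulHomotopy, if_pos (by simp), Finset.erase_insert hS]
      have h4 := koszulSign_mul_self (F := F) l S
      field_simp
      linear_combination (z S) * h4
    · intro j _ hj
      split_ifs with h
      · rfl
      · rw [koszulHomotopy, if_neg (by simp [hS, Ne.symm hj]), mul_zero]
    · simp

end Koszul

/-- The diagram chase in a double complex with exact rows. The group `P p i` consists of the
elements of bidegree `(p, i)`; the differentials `κ` and `δ` lower `p` and raise `i`. If
the columns have no cohomology along the antidiagonal through `(2, i₀ + 1)`, then a `δ`-cocycle of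
bidegree `(0, i₀)` is the image under `κ` of a `δ`-cocycle. -/
theorem exists_cocycle_of_double_complex {A : ℕ → Type*} [∀ i, AddCommGroup (A i)]
    (δ : ∀ i, A i →+ A (i + 1)) (κ : ∀ i, A i →+ A i) (P : ℕ → ∀ i, AddSubgroup (A i))
    (hδδ : ∀ i x, δ (i + 1) (δ i x) = 0) (hκκ : ∀ i x, κ i (κ i x) = 0)
    (hcomm : ∀ i x, κ (i + 1) (δ i x) = δ i (κ i x))
    (hδP : ∀ p i, ∀ x ∈ P p i, δ i x ∈ P p (i + 1))
    (hκP : ∀ p i, ∀ x ∈ P (p + 1) i, κ i x ∈ P p i)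
    (hex : ∀ p i, ∀ x ∈ P p i, κ i x = 0 → ∃ y ∈ P (p + 1) i, κ i y = x)
    (h0 : ∀ i, ∀ x ∈ P 0 i, κ i x = 0)
    (N : ℕ) (hN : ∀ i, ∀ x ∈ P (N + 1) i, x = 0) (i₀ : ℕ)
    (hvan : ∀ s, ∀ y ∈ P (s + 2) (i₀ + s + 1), δ _ y = 0 → ∃ b ∈ P (s + 2) (i₀ + s), δ _ b = y)
    (c : A i₀) (hc : c ∈ P 0 i₀) (hδc : δ _ c = 0) :
    ∃ x ∈ P 1 i₀, δ _ x = 0 ∧ κ _ x = c := by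
  have key : ∀ k s, s + k = N → ∀ x ∈ P (s + 1) (i₀ + s), κ _ (δ _ x) = 0 →
      ∃ x' ∈ P (s + 1) (i₀ + s), δ _ x' = 0 ∧ κ _ x' = κ _ x := by
    intro k
    induction k with
    | zero =>
      intro s hs x hx _
      obtain rfl : s = N := by omega
      exact ⟨x, hx, by rw [hN _ x hx, map_zero], rfl⟩
    | succ k ih =>
      intro s hs x hx hκδ
      obtain ⟨y, hy, hyx⟩ := hex _ _ _ (hδP _ _ _ hx) hκδ
      obtain ⟨y', hy', hδy', hκy'⟩ := ih (s + 1) (by omega) y hy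
        (by rw [hcomm]; erw [hyx]; exact hδδ _ x)
      obtain ⟨b, hb, hby⟩ := hvan s y' hy' hδy'
      refine ⟨x - κ _ b, sub_mem hx (hκP _ _ _ hb), ?_, ?_⟩
      · rw [map_sub, ← hcomm, hby, sub_eq_zero]
        exact (hκy'.trans hyx).symm
      · rw [map_sub, hκκ, sub_zero]
  obtain ⟨x, hx, hxc⟩ := hex 0 i₀ c hc (h0 _ _ hc)
  obtain ⟨x', hx', h1, h2⟩ := key N 0 (by omega) x hx
    ((hcomm i₀ x).trans (by rw [hxc]; exact hδc))
  exact ⟨x', hx', h1, h2.trans hxc⟩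

/-! ### Čech cochains of an ideal sheaf -/

section Cech

theorem cechDiff_cechDiff {ι A : Type*} [AddCommGroup A] {p : ℕ} (c : (Fin p → ι) → A) :
    cechDiff (cechDiff c) = 0 := by
  funext σ
  simp only [cechDiff, Finset.smul_sum, smul_smul, ← pow_add]
  rw [← Fintype.sum_prod_type' (f := fun (i : Fin (p + 2)) (j : Fin (p + 1)) =>
    (-1 : ℤ) ^ ((i : ℕ) + (j : ℕ)) • c fun l => σ (i.succAbove (j.succAbove l)))]
  refine Finset.sum_involution (fun a _ => (a.1.succAbove a.2, a.2.predAbove a.1)) ?_ ?_ ?_ ?_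
  · rintro ⟨i, j⟩ -
    simp only [Fin.succAbove_succAbove_succAbove_predAbove,
      Fin.neg_one_pow_succAbove_add_predAbove]
    simp
  · rintro ⟨i, j⟩ - - h
    exact Fin.succAbove_ne i j (congrArg Prod.fst h)
  · simp
  · rintro ⟨i, j⟩ -
    simp [Fin.succAbove_succAbove_predAbove, Fin.predAbove_predAbove_succAbove]

theorem cechDiff_eq_zero {ι A : Type*} [AddCommGroup A] {p : ℕ} {c : (Fin p → ι) → A}
    (hc : ∀ τ, c τ = 0) (σ : Fin (p + 1) → ι) : cechDiff c σ = 0 := by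
  simp [cechDiff, hc]

variable {K : Type*} [Field K] {n : ℕ} (I : Ideal (MvPolynomial (Fin (n + 1)) K))

/-- The image of the variable `X j` in the field of rational functions. -/
noncomputable def varFrac (K : Type*) [Field K] {n : ℕ} (j : Fin (n + 1)) :
    FractionRing (MvPolynomial (Fin (n + 1)) K) :=
  algebraMap (MvPolynomial (Fin (n + 1)) K) _ (X j)

theorem varFrac_ne_zero (j : Fin (n + 1)) : varFrac K j ≠ 0 := by
  rw [varFrac, Ne, IsFractionRing.to_map_eq_zero_iff]
  exact X_ne_zero j

theorem mem_cechSections {d : ℤ} {p : ℕ} {σ : Fin p → Fin (n + 1)}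
    {z : FractionRing (MvPolynomial (Fin (n + 1)) K)} :
    z ∈ cechSections I d σ ↔ ∃ (N e : ℕ) (g : MvPolynomial (Fin (n + 1)) K), g ∈ I ∧
      g.IsHomogeneous e ∧ (e : ℤ) = d + N * p ∧
      z * (∏ j, varFrac K (σ j)) ^ N = algebraMap _ _ g := by
  unfold cechSections
  have h : (∏ j, varFrac K (σ j)) ≠ 0 := Finset.prod_ne_zero_iff.2 fun j _ => varFrac_ne_zero _
  simp only [Set.mem_ofPred_eq, map_prod]
  refine exists_congr fun N => exists_congr fun e => exists_congr fun g => ?_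
  rw [eq_div_iff (pow_ne_zero _ (by exact h))]
  rfl

theorem isHomogeneous_prod_X {p : ℕ} (σ : Fin p → Fin (n + 1)) :
    (∏ j, X (σ j) : MvPolynomial (Fin (n + 1)) K).IsHomogeneous p := by
  have := IsHomogeneous.prod Finset.univ (fun j => (X (σ j) : MvPolynomial (Fin (n + 1)) K))
    (fun _ => 1) (fun j _ => isHomogeneous_X K _)
  simpa using this

/-- The denominator of a section may be replaced by a higher power. -/
theorem cechSections_raise {d : ℤ} {p : ℕ} {σ : Fin p → Fin (n + 1)}
    {z : FractionRing (MvPolynomial (Fin (n + 1)) K)} {N e : ℕ}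
    {g : MvPolynomial (Fin (n + 1)) K} (hg : g ∈ I) (he : g.IsHomogeneous e)
    (hd : (e : ℤ) = d + N * p) (hz : z * (∏ j, varFrac K (σ j)) ^ N = algebraMap _ _ g) (M : ℕ) :
    ∃ (e' : ℕ) (g' : MvPolynomial (Fin (n + 1)) K), g' ∈ I ∧ g'.IsHomogeneous e' ∧
      (e' : ℤ) = d + (N + M : ℕ) * p ∧
      z * (∏ j, varFrac K (σ j)) ^ (N + M) = algebraMap _ _ g' := by
  refine ⟨e + p * M, g * (∏ j, X (σ j)) ^ M, I.mul_mem_right _ hg,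
    he.mul ((isHomogeneous_prod_X σ).pow M), ?_, ?_⟩
  · push_cast; rw [hd]; ring
  · rw [map_mul, map_pow, map_prod, ← hz, pow_add]; simp only [varFrac]; ring

/-- For a nonempty tuple `σ`, the sections form an additive group. -/
noncomputable def cechSubgroup (d : ℤ) {p : ℕ} (σ : Fin (p + 1) → Fin (n + 1)) :
    AddSubgroup (FractionRing (MvPolynomial (Fin (n + 1)) K)) where
  carrier := cechSections I d σ
  zero_mem' := by
    rw [mem_cechSections]
    obtain ⟨e, he⟩ : ∃ e : ℕ, (e : ℤ) = d + d.natAbs * (p + 1 : ℕ) := by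
      refine ⟨(d + d.natAbs * (p + 1 : ℕ)).toNat, Int.toNat_of_nonneg ?_⟩
      push_cast
      have h1 : 0 ≤ |d| * p := by positivity
      have h2 := neg_abs_le d
      linarith
    exact ⟨d.natAbs, e, 0, I.zero_mem, isHomogeneous_zero _ _ _, he, by simp⟩
  add_mem' := by
    intro a b ha hb
    rw [mem_cechSections] at *
    obtain ⟨N, e, g, hg, he, hd, hz⟩ := ha
    obtain ⟨N', e', g', hg', he', hd', hz'⟩ := hb
    obtain ⟨f, h, hh, hf, hdf, hzf⟩ := cechSections_raise I hg he hd hz N'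
    obtain ⟨f', h', hh', hf', hdf', hzf'⟩ := cechSections_raise I hg' he' hd' hz' N
    obtain rfl : f = f' := by
      have : (f : ℤ) = f' := by rw [hdf, hdf', add_comm N]
      exact_mod_cast this
    refine ⟨N + N', f, h + h', I.add_mem hh hh', hf.add hf', hdf, ?_⟩
    rw [map_add, ← hzf, ← hzf', add_comm N', add_mul]
  neg_mem' := by
    intro a ha
    rw [mem_cechSections] at *
    obtain ⟨N, e, g, hg, he, hd, hz⟩ := ha
    exact ⟨N, e, -g, I.neg_mem hg, he.neg, hd, by rw [map_neg, ← hz, neg_mul]⟩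

variable {I}

theorem mem_cechSubgroup {d : ℤ} {p : ℕ} {σ : Fin (p + 1) → Fin (n + 1)}
    {z : FractionRing (MvPolynomial (Fin (n + 1)) K)} :
    z ∈ cechSubgroup I d σ ↔ z ∈ cechSections I d σ := Iff.rfl

theorem varFrac_mul_mem {d : ℤ} {p : ℕ} {σ : Fin (p + 1) → Fin (n + 1)}
    {z : FractionRing (MvPolynomial (Fin (n + 1)) K)} (hz : z ∈ cechSubgroup I d σ)
    (j : Fin (n + 1)) : varFrac K j * z ∈ cechSubgroup I (d + 1) σ := by
  rw [mem_cechSubgroup, mem_cechSections] at *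
  obtain ⟨N, e, g, hg, he, hd, hz⟩ := hz
  refine ⟨N, 1 + e, X j * g, I.mul_mem_left _ hg, (isHomogeneous_X K j).mul he, ?_, ?_⟩
  · push_cast at *; rw [hd]; ring
  · rw [map_mul, mul_assoc, hz, varFrac]

theorem varFrac_inv_mul_mem {d : ℤ} {p : ℕ} {σ : Fin (p + 1) → Fin (n + 1)}
    {z : FractionRing (MvPolynomial (Fin (n + 1)) K)} (hz : z ∈ cechSubgroup I d σ)
    (l : Fin (p + 1)) : (varFrac K (σ l))⁻¹ * z ∈ cechSubgroup I (d - 1) σ := by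
  rw [mem_cechSubgroup, mem_cechSections] at *
  obtain ⟨N, e, g, hg, he, hd, hz⟩ := hz
  refine ⟨N + 1, p + e, (∏ j, X (σ (l.succAbove j))) * g, I.mul_mem_left _ hg,
    (isHomogeneous_prod_X _).mul he, ?_, ?_⟩
  · push_cast at *; rw [hd]; ring
  · rw [map_mul, map_prod, ← hz, pow_succ, Fin.prod_univ_succAbove _ l]
    have := varFrac_ne_zero (K := K) (σ l)
    simp only [varFrac] at *
    field_simp

theorem restrict_mem {d : ℤ} {p : ℕ} {σ : Fin (p + 2) → Fin (n + 1)} (l : Fin (p + 2))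
    {z : FractionRing (MvPolynomial (Fin (n + 1)) K)}
    (hz : z ∈ cechSubgroup I d (fun j => σ (l.succAbove j))) : z ∈ cechSubgroup I d σ := by
  rw [mem_cechSubgroup, mem_cechSections] at *
  obtain ⟨N, e, g, hg, he, hd, hz⟩ := hz
  refine ⟨N, e + 1 * N, g * X (σ l) ^ N, I.mul_mem_right _ hg,
    he.mul ((isHomogeneous_X K _).pow N), ?_, ?_⟩
  · push_cast at *; rw [hd]; ring
  · rw [map_mul, map_pow, ← hz, Fin.prod_univ_succAbove _ l]
    simp only [varFrac]; ring

theorem cechDiff_mem {d : ℤ} {p : ℕ}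
    {c : (Fin (p + 1) → Fin (n + 1)) → FractionRing (MvPolynomial (Fin (n + 1)) K)}
    (hc : ∀ σ, c σ ∈ cechSubgroup I d σ) (σ : Fin (p + 2) → Fin (n + 1)) :
    cechDiff c σ ∈ cechSubgroup I d σ :=
  sum_mem fun l _ => zsmul_mem (restrict_mem l (hc _)) _

theorem koszulSign_mul_mem {d : ℤ} {p : ℕ} {σ : Fin (p + 1) → Fin (n + 1)}
    {z : FractionRing (MvPolynomial (Fin (n + 1)) K)} (hz : z ∈ cechSubgroup I d σ)
    (j : Fin (n + 1)) (S : Finset (Fin (n + 1))) :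
    koszulSign _ j S * z ∈ cechSubgroup I d σ := by
  rcases neg_one_pow_eq_or (FractionRing (MvPolynomial (Fin (n + 1)) K))
    (S.filter (· < j)).card with h | h
  · rw [koszulSign, h, one_mul]; exact hz
  · rw [koszulSign, h, neg_one_mul]; exact neg_mem hz

/-- The cochains of the double complex of the Koszul and Čech complexes: families of rational
functions indexed by a set `S` of variables (standing for `e_S` in the exterior algebra) and a
tuple of indices. -/
abbrev KoszulCech (K : Type*) [Field K] (n i : ℕ) : Type _ :=
  Finset (Fin (n + 1)) → (Fin (i + 1) → Fin (n + 1)) →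
    FractionRing (MvPolynomial (Fin (n + 1)) K)

/-- The Čech differential of the double complex. -/
noncomputable def KoszulCech.cech (K : Type*) [Field K] (n i : ℕ) :
    KoszulCech K n i →+ KoszulCech K n (i + 1) where
  toFun z S := cechDiff (z S)
  map_zero' := by funext S σ; simp [cechDiff]
  map_add' a b := by funext S σ; simp [cechDiff, Finset.sum_add_distrib]

/-- The Koszul differential of the double complex. -/
noncomputable def KoszulCech.kos (K : Type*) [Field K] (n i : ℕ) :
    KoszulCech K n i →+ KoszulCech K n i where
  toFun z S σ := koszul (varFrac K) (fun T => z T σ) S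
  map_zero' := by funext S σ; simp [koszul]
  map_add' a b := by
    funext S σ
    simp only [koszul, Pi.add_apply, ← Finset.sum_add_distrib]
    refine Finset.sum_congr rfl fun j _ => ?_
    split_ifs <;> ring

theorem KoszulCech.cech_apply {K : Type*} [Field K] {n i : ℕ} (z : KoszulCech K n i)
    (S : Finset (Fin (n + 1))) : KoszulCech.cech K n i z S = cechDiff (z S) := rfl

theorem KoszulCech.kos_apply {K : Type*} [Field K] {n i : ℕ} (z : KoszulCech K n i)
    (S : Finset (Fin (n + 1))) (σ : Fin (i + 1) → Fin (n + 1)) :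
    KoszulCech.kos K n i z S σ = koszul (varFrac K) (fun T => z T σ) S := rfl

/-- The cochains of Koszul degree `p` whose coefficients are sections of `J(d - p)`. -/
noncomputable def KoszulCech.bideg {K : Type*} [Field K] {n : ℕ}
    (I : Ideal (MvPolynomial (Fin (n + 1)) K)) (d : ℤ) (p i : ℕ) :
    AddSubgroup (KoszulCech K n i) where
  carrier := {z | ∀ S σ, (S.card = p → z S σ ∈ cechSubgroup I (d - p) σ) ∧
    (S.card ≠ p → z S σ = 0)}
  zero_mem' S σ := ⟨fun _ => zero_mem _, fun _ => rfl⟩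
  add_mem' := by
    intro a b ha hb S σ
    exact ⟨fun h => add_mem ((ha S σ).1 h) ((hb S σ).1 h),
      fun h => by rw [Pi.add_apply, Pi.add_apply, (ha S σ).2 h, (hb S σ).2 h, add_zero]⟩
  neg_mem' := by
    intro a ha S σ
    exact ⟨fun h => neg_mem ((ha S σ).1 h),
      fun h => by rw [Pi.neg_apply, Pi.neg_apply, (ha S σ).2 h, neg_zero]⟩

end Cech

/-! ### Castelnuovo–Mumford regularity and generators -/

section Regularity

variable {K : Type*} [Field K] {n : ℕ} {I : Ideal (MvPolynomial (Fin (n + 1)) K)}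

/-- If the ideal sheaf `J` is `q`-regular, then every Čech `i`-cocycle of `J(q + 1 - i)` is a
combination of the variables with `i`-cocycles of `J(q - i)` as coefficients: this is the diagram
chase in the tensor product of the Koszul complex of the variables and the Čech complex. -/
theorem exists_cocycles_of_isCMRegular {q : ℤ} (hq : IsCMRegular I q) (i : ℕ)
    (c : (Fin (i + 1) → Fin (n + 1)) → FractionRing (MvPolynomial (Fin (n + 1)) K))
    (hc : ∀ σ, c σ ∈ cechSections I (q + 1 - i) σ) (hδ : cechDiff c = 0) :
    ∃ x : Fin (n + 1) → (Fin (i + 1) → Fin (n + 1)) →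
        FractionRing (MvPolynomial (Fin (n + 1)) K),
      (∀ j σ, x j σ ∈ cechSections I (q - i) σ) ∧ (∀ j, cechDiff (x j) = 0) ∧
      ∀ σ, c σ = ∑ j, varFrac K j * x j σ := by
  let δ := KoszulCech.cech K n
  let κ := KoszulCech.kos K n
  let P := KoszulCech.bideg I (q + 1 - i)
  have hδδ : ∀ i x, δ (i + 1) (δ i x) = 0 := fun i x => by
    funext S; exact cechDiff_cechDiff (x S)
  have hκκ : ∀ i x, κ i (κ i x) = 0 := fun i x => by
    funext S σ; exact koszul_koszul (varFrac K) (fun T => x T σ) S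
  have hcomm : ∀ i x, κ (i + 1) (δ i x) = δ i (κ i x) := fun i x => by
    funext S σ
    change koszul (varFrac K) (fun T => cechDiff (x T) σ) S =
      cechDiff (fun τ => koszul (varFrac K) (fun T => x T τ) S) σ
    simp only [koszul, cechDiff, Finset.smul_sum]
    rw [Finset.sum_comm]
    refine Finset.sum_congr rfl fun j _ => ?_
    split_ifs
    · simp
    · rw [Finset.mul_sum]
      exact Finset.sum_congr rfl fun l _ => mul_smul_comm _ _ _
  have hδP : ∀ p i', ∀ x ∈ P p i', δ i' x ∈ P p (i' + 1) := by
    intro p i' x hx S σ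
    refine ⟨fun h => cechDiff_mem (fun τ => (hx S τ).1 h) σ, fun h => ?_⟩
    exact cechDiff_eq_zero (fun τ => (hx S τ).2 h) σ
  have hκP : ∀ p i', ∀ x ∈ P (p + 1) i', κ i' x ∈ P p i' := by
    intro p i' x hx S σ
    constructor
    · intro h
      rw [KoszulCech.kos_apply]
      refine sum_mem fun j _ => ?_
      split_ifs with hj
      · exact zero_mem _
      · rw [mul_assoc]
        refine koszulSign_mul_mem ?_ _ _
        have := varFrac_mul_mem ((hx (insert j S) σ).1
          (by rw [Finset.card_insert_of_notMem hj, h])) j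
        convert this using 2
        push_cast; ring
    · intro h
      rw [KoszulCech.kos_apply]
      refine Finset.sum_eq_zero fun j _ => ?_
      split_ifs with hj
      · rfl
      · refine mul_eq_zero_of_right _ ((hx _ σ).2 ?_)
        rw [Finset.card_insert_of_notMem hj]
        omega
  have hex : ∀ p i', ∀ x ∈ P p i', κ i' x = 0 → ∃ y ∈ P (p + 1) i', κ i' y = x := by
    intro p i' x hx hκ
    refine ⟨fun S σ => koszulHomotopy (varFrac K) (σ 0) (fun T => x T σ) S, ?_, ?_⟩
    · intro S σ
      constructor
      · intro h
        simp only [koszulHomotopy]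
        split_ifs with hS
        · rw [mul_assoc]
          refine koszulSign_mul_mem ?_ _ _
          have := varFrac_inv_mul_mem ((hx (S.erase (σ 0)) σ).1
            (by rw [Finset.card_erase_of_mem hS, h]; rfl)) 0
          convert this using 2
          push_cast; ring
        · exact zero_mem _
      · intro h
        simp only [koszulHomotopy]
        split_ifs with hS
        · rw [(hx _ _).2, mul_zero]
          rw [Finset.card_erase_of_mem hS]
          have := Finset.card_pos.2 ⟨_, hS⟩
          omega
        · rfl
    · funext S σ
      exact koszul_koszulHomotopy (varFrac K) _ (varFrac_ne_zero _) (fun T => x T σ)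
        (fun T => congrFun (congrFun hκ T) σ) S
  have h0 : ∀ i', ∀ x ∈ P 0 i', κ i' x = 0 := by
    intro i' x hx
    funext S σ
    rw [KoszulCech.kos_apply]
    refine Finset.sum_eq_zero fun j _ => ?_
    split_ifs with hj
    · rfl
    · refine mul_eq_zero_of_right _ ((hx _ σ).2 ?_)
      rw [Finset.card_insert_of_notMem hj]
      omega
  have hN : ∀ i', ∀ x ∈ P (n + 1 + 1) i', x = 0 := by
    intro i' x hx
    funext S σ
    refine (hx S σ).2 ?_
    have := Finset.card_le_univ S
    rw [Fintype.card_fin] at this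
    omega
  have hvan : ∀ s, ∀ y ∈ P (s + 2) (i + s + 1), δ _ y = 0 →
      ∃ b ∈ P (s + 2) (i + s), δ _ b = y := by
    intro s y hy hδy
    have h := fun S : Finset (Fin (n + 1)) => hq (i + s + 1) (by omega) (y S)
    have h' : ∀ S : Finset (Fin (n + 1)), ∃ b : (Fin (i + s + 1) → Fin (n + 1)) →
          FractionRing (MvPolynomial (Fin (n + 1)) K),
        (S.card = s + 2 → (∀ τ, b τ ∈ cechSubgroup I (q + 1 - i - (s + 2 : ℕ)) τ) ∧
          cechDiff b = y S) ∧ (S.card ≠ s + 2 → b = 0) := by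
      intro S
      by_cases hS : S.card = s + 2
      · obtain ⟨b, hb, hby⟩ := h S (fun σ => by
          have := (hy S σ).1 hS
          rw [mem_cechSubgroup] at this
          convert this using 2
          push_cast; ring) (congrFun hδy S)
        refine ⟨b, fun _ => ⟨fun τ => ?_, hby⟩, fun h => absurd hS h⟩
        have := hb τ
        rw [mem_cechSubgroup]
        convert this using 2
        push_cast; ring
      · exact ⟨0, fun h => absurd h hS, fun _ => rfl⟩
    choose b hb1 hb2 using h'
    refine ⟨b, fun S σ => ⟨fun hS => (hb1 S hS).1 σ, fun hS => by rw [hb2 S hS]; rfl⟩, ?_⟩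
    funext S σ
    by_cases hS : S.card = s + 2
    · exact congrFun (hb1 S hS).2 σ
    · rw [(hy S σ).2 hS, KoszulCech.cech_apply]
      exact cechDiff_eq_zero (fun τ => by rw [hb2 S hS]; rfl) σ
  obtain ⟨x, hx, hδx, hκx⟩ := exists_cocycle_of_double_complex δ κ P hδδ hκκ hcomm hδP hκP hex h0
    (n + 1) hN i hvan (fun S => if S = ∅ then c else 0)
    (fun S σ => ⟨fun h => by
        simp only [Finset.card_eq_zero.1 h, if_true]
        simpa [mem_cechSubgroup] using hc σ,
      fun h => by simp only [if_neg (fun h' : S = ∅ => h (by simp [h']))]; rfl⟩)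
    (by
      funext S
      change cechDiff (if S = ∅ then c else 0) = 0
      split_ifs
      · exact hδ
      · funext σ; simp [cechDiff])
  refine ⟨fun j => x {j}, fun j σ => ?_, fun j => congrFun hδx {j}, fun σ => ?_⟩
  · have := (hx {j} σ).1 (by simp)
    rw [mem_cechSubgroup] at this
    convert this using 2
    push_cast; ring
  · have := congrFun (congrFun hκx ∅) σ
    rw [if_pos rfl] at this
    rw [← this]
    rw [KoszulCech.kos_apply]
    simp [koszul, koszulSign]

theorem IsCMRegular.succ {q : ℤ} (hq : IsCMRegular I q) : IsCMRegular I (q + 1) := by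
  intro i hi c hc hδ
  obtain ⟨i, rfl⟩ : ∃ k, i = k + 1 := ⟨i - 1, by omega⟩
  obtain ⟨x, hx, hδx, hxc⟩ := exists_cocycles_of_isCMRegular hq (i + 1) c hc hδ
  choose b hb hbx using fun j => hq (i + 1) hi (x j) (hx j) (hδx j)
  refine ⟨fun τ => ∑ j, varFrac K j * b j τ, fun τ => ?_, ?_⟩
  · rw [← mem_cechSubgroup]
    refine sum_mem fun j _ => ?_
    have := varFrac_mul_mem (mem_cechSubgroup.2 (hb j τ)) j
    convert this using 2
    ring
  · funext σ
    rw [hxc σ]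
    simp only [cechDiff, Finset.smul_sum]
    rw [Finset.sum_comm]
    refine Finset.sum_congr rfl fun j _ => ?_
    rw [← hbx j, cechDiff, Finset.mul_sum]
    exact Finset.sum_congr rfl fun l _ => (mul_smul_comm _ _ _).symm

theorem IsCMRegular.mono {q q' : ℤ} (hq : IsCMRegular I q) (h : q ≤ q') : IsCMRegular I q' :=
  Int.leInduction hq (fun _ _ h => IsCMRegular.succ h) q' h

theorem cechDiff_one {ι A : Type*} [AddCommGroup A] (c : (Fin 1 → ι) → A) (σ : Fin 2 → ι) :
    cechDiff c σ = c (fun _ => σ 1) - c (fun _ => σ 0) := by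
  have h0 : (fun l : Fin 1 => σ (Fin.succAbove 0 l)) = fun _ => σ 1 := by
    funext l; rw [Subsingleton.elim l 0]; rfl
  have h1 : (fun l : Fin 1 => σ (Fin.succAbove 1 l)) = fun _ => σ 0 := by
    funext l; rw [Subsingleton.elim l 0]; rfl
  rw [cechDiff, Fin.sum_univ_two, h0, h1]
  simp [sub_eq_add_neg]

/-- A global section of `J(d)` comes from an element of `I` if no variable is a zero divisor
modulo `I`. -/
theorem exists_mem_of_forall_mem_cechSections (hn : 1 ≤ n)
    (hsat : ∀ (j : Fin (n + 1)) (f : MvPolynomial (Fin (n + 1)) K), X j * f ∈ I → f ∈ I)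
    {d : ℤ} {z : FractionRing (MvPolynomial (Fin (n + 1)) K)}
    (hz : ∀ σ : Fin 1 → Fin (n + 1), z ∈ cechSections I d σ) :
    ∃ h ∈ I, z = algebraMap _ _ h := by
  obtain ⟨N, e, g, hg, -, -, hz0⟩ := (mem_cechSections I).1 (hz fun _ => 0)
  obtain ⟨M, e', g', -, -, -, hz1⟩ := (mem_cechSections I).1 (hz fun _ => ⟨1, by omega⟩)
  simp only [Fin.prod_univ_one, varFrac, ← map_pow] at hz0 hz1
  have h : g * X ⟨1, by omega⟩ ^ M = g' * X 0 ^ N := by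
    apply IsFractionRing.injective (MvPolynomial (Fin (n + 1)) K)
      (FractionRing (MvPolynomial (Fin (n + 1)) K))
    rw [map_mul, map_mul, ← hz0, ← hz1]; ring
  have h1 : ¬ (X 0 : MvPolynomial (Fin (n + 1)) K) ∣ X ⟨1, by omega⟩ ^ M := by
    intro h
    have := (X_prime (R := K)).dvd_of_dvd_pow h
    simp [X_dvd_X, Fin.ext_iff] at this
  obtain ⟨f, hf⟩ := (X_prime (R := K)).pow_dvd_of_dvd_mul_right N h1 (Dvd.intro_left g' h.symm)
  have hfI : ∀ N : ℕ, ∀ f, X 0 ^ N * f ∈ I → f ∈ I := by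
    intro N
    induction N with
    | zero => simp
    | succ N ih =>
      intro f hf
      rw [pow_succ, mul_assoc] at hf
      exact hsat _ _ (ih _ hf)
  refine ⟨f, hfI N f (hf ▸ hg), ?_⟩
  have h0 : algebraMap (MvPolynomial (Fin (n + 1)) K)
      (FractionRing (MvPolynomial (Fin (n + 1)) K)) (X 0 ^ N) ≠ 0 := by
    rw [Ne, IsFractionRing.to_map_eq_zero_iff]
    exact pow_ne_zero _ (X_ne_zero _)
  apply mul_right_cancel₀ h0
  rw [hz0, hf, map_mul, mul_comm]

/-- Mumford's theorem: if the ideal sheaf of `I` is `q`-regular and the variables are nonzero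
divisors modulo `I`, then the generators of `I` have degree at most `q`. -/
theorem mem_span_X_mul_of_isCMRegular (hn : 1 ≤ n)
    (hsat : ∀ (j : Fin (n + 1)) (f : MvPolynomial (Fin (n + 1)) K), X j * f ∈ I → f ∈ I)
    {q : ℤ} (hq : IsCMRegular I q) {F : MvPolynomial (Fin (n + 1)) K} (hF : F ∈ I) {e : ℕ}
    (he : F.IsHomogeneous e) (hqe : q < e) :
    ∃ G : Fin (n + 1) → MvPolynomial (Fin (n + 1)) K, (∀ j, G j ∈ I) ∧ F = ∑ j, X j * G j := by
  have hq' : IsCMRegular I ((e : ℤ) - 1) := hq.mono (by omega)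
  obtain ⟨x, hx, hδ, hF'⟩ := exists_cocycles_of_isCMRegular hq' 0
    (fun _ => algebraMap _ _ F)
    (fun σ => (mem_cechSections I).2 ⟨0, e, F, hF, he, by simp, by simp⟩)
    (by funext σ; exact (cechDiff_one _ σ).trans (sub_self _))
  have hconst : ∀ j σ τ, x j σ = x j τ := by
    intro j σ τ
    have h := (cechDiff_one (x j) ![σ 0, τ 0]).symm.trans (congrFun (hδ j) _)
    have h1 : (fun _ : Fin 1 => τ 0) = τ := by
      funext l; rw [Subsingleton.elim l 0]
    have h2 : (fun _ : Fin 1 => σ 0) = σ := by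
      funext l; rw [Subsingleton.elim l 0]
    simp only [Matrix.cons_val_one, Matrix.cons_val_zero, Pi.zero_apply] at h
    rw [← h1, ← h2]
    exact (sub_eq_zero.1 h).symm
  choose G hG hGx using fun j => exists_mem_of_forall_mem_cechSections (I := I)
    (d := (e : ℤ) - 1 - (0 : ℕ)) hn hsat
    (z := x j (fun _ => 0)) (fun σ => by rw [hconst j _ σ]; exact hx j σ)
  refine ⟨G, hG, ?_⟩
  apply IsFractionRing.injective (MvPolynomial (Fin (n + 1)) K)
    (FractionRing (MvPolynomial (Fin (n + 1)) K))
  rw [hF' (fun _ => 0), map_sum]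
  refine Finset.sum_congr rfl fun j _ => ?_
  rw [map_mul, ← hGx, varFrac]

end Regularity

/-! ### Hilbert functions -/

section Hilbert

variable {K : Type*} [Field K] {n : ℕ}

instance homogeneousSubmodule_finite (σ : Type*) [Finite σ] (t : ℕ) :
    Module.Finite K (homogeneousSubmodule σ K t) :=
  Module.Finite.iff_fg.2 (homogeneousSubmodule_fg _ _ t)

/-- The elements of degree `t` of the ideal `I`. -/
noncomputable def degreePart (I : Ideal (MvPolynomial (Fin (n + 1)) K)) (t : ℕ) :
    Submodule K (MvPolynomial (Fin (n + 1)) K) :=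
  homogeneousSubmodule (Fin (n + 1)) K t ⊓ I.restrictScalars K

theorem mem_degreePart {I : Ideal (MvPolynomial (Fin (n + 1)) K)} {t : ℕ}
    {F : MvPolynomial (Fin (n + 1)) K} : F ∈ degreePart I t ↔ F.IsHomogeneous t ∧ F ∈ I := by
  rw [degreePart, Submodule.mem_inf, mem_homogeneousSubmodule, Submodule.restrictScalars_mem]

instance degreePart_finite (I : Ideal (MvPolynomial (Fin (n + 1)) K)) (t : ℕ) :
    Module.Finite K (degreePart I t) :=
  Submodule.finiteDimensional_inf_left _ _

theorem finrank_map_add_finrank_inf_ker {V W : Type*} [AddCommGroup V] [Module K V]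
    [AddCommGroup W] [Module K W] (f : V →ₗ[K] W) (A : Submodule K V) [Module.Finite K A] :
    Module.finrank K (A.map f) + Module.finrank K (A ⊓ LinearMap.ker f : Submodule K V) =
      Module.finrank K A := by
  have h := LinearMap.finrank_range_add_finrank_ker (f.domRestrict A)
  rw [LinearMap.range_domRestrict, LinearMap.ker_domRestrict] at h
  rw [← h, ← Submodule.map_comap_subtype, Submodule.finrank_map_subtype_eq]

theorem hilbertFun_add_finrank_degreePart (I : Ideal (MvPolynomial (Fin (n + 1)) K)) (t : ℕ) :
    hilbertFun I t + Module.finrank K (degreePart I t) =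
      Module.finrank K (homogeneousSubmodule (Fin (n + 1)) K t) := by
  have h : I.restrictScalars K = LinearMap.ker (Ideal.Quotient.mkₐ K I).toLinearMap := by
    ext F
    simp [Ideal.Quotient.eq_zero_iff_mem]
  rw [hilbertFun, degreePart, h]
  exact finrank_map_add_finrank_inf_ker _ _

/-- The Hilbert function of `S / I` may be computed by any linear map which has the same
kernel. -/
theorem hilbertFun_eq_finrank_map {W : Type*} [AddCommGroup W] [Module K W]
    (I : Ideal (MvPolynomial (Fin (n + 1)) K)) (f : MvPolynomial (Fin (n + 1)) K →ₗ[K] W) (t : ℕ)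
    (h : ∀ F : MvPolynomial (Fin (n + 1)) K, F.IsHomogeneous t → (F ∈ I ↔ f F = 0)) :
    hilbertFun I t = Module.finrank K ((homogeneousSubmodule (Fin (n + 1)) K t).map f) := by
  have h1 := hilbertFun_add_finrank_degreePart I t
  have h3 := finrank_map_add_finrank_inf_ker f (homogeneousSubmodule (Fin (n + 1)) K t)
  have h2 : degreePart I t = homogeneousSubmodule (Fin (n + 1)) K t ⊓ LinearMap.ker f := by
    ext F
    rw [mem_degreePart, Submodule.mem_inf, mem_homogeneousSubmodule, LinearMap.mem_ker]
    exact ⟨fun hF => ⟨hF.1, (h F hF.1).1 hF.2⟩, fun hF => ⟨hF.1, (h F hF.1).2 hF.2⟩⟩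
  rw [h2] at h1
  omega

theorem hilbertFun_anti {I J : Ideal (MvPolynomial (Fin (n + 1)) K)} {t : ℕ}
    (h : ∀ F : MvPolynomial (Fin (n + 1)) K, F.IsHomogeneous t → F ∈ I → F ∈ J) :
    hilbertFun J t ≤ hilbertFun I t := by
  have h1 := hilbertFun_add_finrank_degreePart I t
  have h2 := hilbertFun_add_finrank_degreePart J t
  have h3 : Module.finrank K (degreePart I t) ≤ Module.finrank K (degreePart J t) :=
    Submodule.finrank_mono fun F hF => by
      rw [mem_degreePart] at *
      exact ⟨hF.1, h F hF.1 hF.2⟩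
  omega

/-- An ideal is homogeneous if it contains the homogeneous components of its elements. -/
def IsHomogIdeal (I : Ideal (MvPolynomial (Fin (n + 1)) K)) : Prop :=
  ∀ F ∈ I, ∀ t, homogeneousComponent t F ∈ I

theorem homogeneousComponent_mul_of_isHomogeneous {f g : MvPolynomial (Fin (n + 1)) K} {e : ℕ}
    (hf : f.IsHomogeneous e) (t : ℕ) :
    homogeneousComponent (t + e) (g * f) = homogeneousComponent t g * f := by
  conv_lhs => rw [← sum_homogeneousComponent g, Finset.sum_mul, map_sum]
  have h : ∀ i, homogeneousComponent (t + e) (homogeneousComponent i g * f) =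
      if i = t then homogeneousComponent t g * f else 0 := by
    intro i
    have := homogeneousComponent_of_mem (m := t + e)
      ((homogeneousComponent_isHomogeneous i g).mul hf)
    rw [this]
    by_cases hi : i = t
    · subst hi; simp
    · simp [hi, Ne.symm hi]
  simp only [h, Finset.sum_ite_eq']
  split_ifs with hh
  · rfl
  · rw [homogeneousComponent_eq_zero, zero_mul]
    simpa using hh

theorem isHomogIdeal_span {T : Set (MvPolynomial (Fin (n + 1)) K)}
    (hT : ∀ F ∈ T, ∃ d : ℕ, F.IsHomogeneous d) : IsHomogIdeal (Ideal.span T) := by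
  intro F hF
  induction hF using Submodule.span_induction with
  | mem F hF =>
    intro t
    obtain ⟨d, hd⟩ := hT F hF
    rw [homogeneousComponent_of_mem hd]
    split_ifs
    · exact Ideal.subset_span hF
    · exact zero_mem _
  | zero => intro t; rw [map_zero]; exact zero_mem _
  | add F G _ _ hF hG => intro t; rw [map_add]; exact add_mem (hF t) (hG t)
  | smul a F _ hF =>
    intro t
    conv =>
      arg 2
      rw [← sum_homogeneousComponent F]
    rw [smul_eq_mul, Finset.mul_sum, map_sum]
    refine sum_mem fun i _ => ?_
    by_cases hi : i ≤ t
    · obtain ⟨s, rfl⟩ := Nat.exists_eq_add_of_le' hi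
      rw [homogeneousComponent_mul_of_isHomogeneous (homogeneousComponent_isHomogeneous i F)]
      exact Ideal.mul_mem_left _ _ (hF i)
    · conv =>
        arg 2
        rw [← sum_homogeneousComponent a]
      rw [Finset.sum_mul, map_sum]
      refine sum_mem fun j _ => ?_
      rw [homogeneousComponent_of_mem ((homogeneousComponent_isHomogeneous j a).mul
        (homogeneousComponent_isHomogeneous i F)), if_neg (by omega)]
      exact zero_mem _

theorem IsHomogIdeal.sup {I J : Ideal (MvPolynomial (Fin (n + 1)) K)} (hI : IsHomogIdeal I)
    (hJ : IsHomogIdeal J) : IsHomogIdeal (I ⊔ J) := by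
  intro F hF t
  obtain ⟨a, ha, b, hb, rfl⟩ := Submodule.mem_sup.1 hF
  rw [map_add]
  exact Submodule.add_mem_sup (hI a ha t) (hJ b hb t)

theorem isHomogIdeal_span_singleton {f : MvPolynomial (Fin (n + 1)) K} {e : ℕ}
    (hf : f.IsHomogeneous e) : IsHomogIdeal (Ideal.span {f}) :=
  isHomogIdeal_span fun F hF => ⟨e, by rw [Set.mem_singleton_iff.1 hF]; exact hf⟩

/-- The ideal quotient `(I : f)`. -/
def colonIdeal (I : Ideal (MvPolynomial (Fin (n + 1)) K)) (f : MvPolynomial (Fin (n + 1)) K) :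
    Ideal (MvPolynomial (Fin (n + 1)) K) where
  carrier := {g | g * f ∈ I}
  zero_mem' := by simp
  add_mem' {a b} ha hb := by
    change (a + b) * f ∈ I
    rw [add_mul]; exact I.add_mem ha hb
  smul_mem' c a ha := by
    change (c * a) * f ∈ I
    rw [mul_assoc]; exact I.mul_mem_left _ ha

theorem mem_colonIdeal {I : Ideal (MvPolynomial (Fin (n + 1)) K)}
    {f g : MvPolynomial (Fin (n + 1)) K} : g ∈ colonIdeal I f ↔ g * f ∈ I := Iff.rfl

theorem le_colonIdeal (I : Ideal (MvPolynomial (Fin (n + 1)) K))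
    (f : MvPolynomial (Fin (n + 1)) K) : I ≤ colonIdeal I f :=
  fun _ hg => I.mul_mem_right _ hg

theorem IsHomogIdeal.colon {I : Ideal (MvPolynomial (Fin (n + 1)) K)} (hI : IsHomogIdeal I)
    {f : MvPolynomial (Fin (n + 1)) K} {e : ℕ} (hf : f.IsHomogeneous e) :
    IsHomogIdeal (colonIdeal I f) := by
  intro F hF t
  rw [mem_colonIdeal, ← homogeneousComponent_mul_of_isHomogeneous hf]
  exact hI _ hF _

/-- The Hilbert function in the exact sequence `0 → S/(I : f)(-e) → S/I → S/(I + f) → 0`. -/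
theorem hilbertFun_add {I : Ideal (MvPolynomial (Fin (n + 1)) K)} (hI : IsHomogIdeal I)
    {f : MvPolynomial (Fin (n + 1)) K} {e : ℕ} (hf : f.IsHomogeneous e) (hf0 : f ≠ 0) (t : ℕ) :
    hilbertFun I (t + e) =
      hilbertFun (I ⊔ Ideal.span {f}) (t + e) + hilbertFun (colonIdeal I f) t := by
  have h1 := hilbertFun_add_finrank_degreePart I (t + e)
  have h2 := hilbertFun_add_finrank_degreePart (I ⊔ Ideal.span {f}) (t + e)
  have h3 := hilbertFun_add_finrank_degreePart (colonIdeal I f) t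
  let μ : MvPolynomial (Fin (n + 1)) K →ₗ[K] MvPolynomial (Fin (n + 1)) K :=
    LinearMap.mulRight K f
  have hμ : Function.Injective μ := fun a b hab => mul_right_cancel₀ hf0 hab
  have h4 : degreePart (I ⊔ Ideal.span {f}) (t + e) =
      degreePart I (t + e) ⊔ (homogeneousSubmodule (Fin (n + 1)) K t).map μ := by
    apply le_antisymm
    · intro F hF
      rw [mem_degreePart] at hF
      obtain ⟨a, ha, b, hb, rfl⟩ := Submodule.mem_sup.1 hF.2
      obtain ⟨c, rfl⟩ := Ideal.mem_span_singleton'.1 hb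
      have : a + c * f = homogeneousComponent (t + e) a + homogeneousComponent t c * f := by
        rw [← homogeneousComponent_mul_of_isHomogeneous hf, ← map_add,
          homogeneousComponent_eq_self hF.1]
      rw [this]
      refine Submodule.add_mem_sup ?_ (Submodule.mem_map_of_mem ?_)
      · exact mem_degreePart.2 ⟨homogeneousComponent_isHomogeneous _ _, hI _ ha _⟩
      · exact homogeneousComponent_isHomogeneous _ _
    · refine sup_le ?_ ?_
      · intro F hF
        rw [mem_degreePart] at *
        exact ⟨hF.1, Ideal.mem_sup_left hF.2⟩
      · rintro _ ⟨g, hg, rfl⟩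
        exact mem_degreePart.2 ⟨IsHomogeneous.mul hg hf,
          Ideal.mem_sup_right (Ideal.mul_mem_left _ _ (Ideal.mem_span_singleton_self f))⟩
  have h5 : degreePart I (t + e) ⊓ (homogeneousSubmodule (Fin (n + 1)) K t).map μ =
      (degreePart (colonIdeal I f) t).map μ := by
    ext F
    rw [Submodule.mem_inf, Submodule.mem_map, Submodule.mem_map, mem_degreePart]
    constructor
    · rintro ⟨⟨-, hF⟩, g, hg, rfl⟩
      exact ⟨g, mem_degreePart.2 ⟨hg, hF⟩, rfl⟩
    · rintro ⟨g, hg, rfl⟩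
      rw [mem_degreePart] at hg
      exact ⟨⟨hg.1.mul hf, hg.2⟩, g, hg.1, rfl⟩
  have h6 := Submodule.finrank_sup_add_finrank_inf_eq (degreePart I (t + e))
    ((homogeneousSubmodule (Fin (n + 1)) K t).map μ)
  rw [← h4, h5, (Submodule.equivMapOfInjective μ hμ _).symm.finrank_eq,
    (Submodule.equivMapOfInjective μ hμ _).symm.finrank_eq] at h6
  omega

end Hilbert

/-! ### Polynomials with eventually nonnegative values -/

section EventuallyNonneg

theorem leadingCoeff_nonneg_of_eventually {P : Polynomial ℚ}
    (h : ∀ᶠ t : ℕ in atTop, 0 ≤ P.eval (t : ℚ)) : 0 ≤ P.leadingCoeff := by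
  by_contra! hlt
  by_cases hd : 0 < P.degree
  · have h1 := (P.tendsto_atBot_of_leadingCoeff_nonpos hd hlt.le).comp
      (tendsto_natCast_atTop_atTop (R := ℚ))
    obtain ⟨t, h2, h3⟩ := (h.and (h1.eventually_lt_atBot 0)).exists
    exact absurd h3 (not_lt.2 h2)
  · rw [not_lt] at hd
    rw [Polynomial.eq_C_of_degree_le_zero hd] at h hlt
    obtain ⟨t, ht⟩ := h.exists
    rw [Polynomial.eval_C] at ht
    rw [Polynomial.leadingCoeff_C] at hlt
    exact absurd hlt (not_lt.2 ht)

theorem coeff_nonneg_of_eventually {P : Polynomial ℚ} {d : ℕ} (hd : P.natDegree ≤ d)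
    (h : ∀ᶠ t : ℕ in atTop, 0 ≤ P.eval (t : ℚ)) : 0 ≤ P.coeff d := by
  rcases hd.eq_or_lt with rfl | hlt
  · exact leadingCoeff_nonneg_of_eventually h
  · rw [Polynomial.coeff_eq_zero_of_natDegree_lt hlt]

theorem natDegree_le_of_eventually_le {P Q : Polynomial ℚ}
    (h0 : ∀ᶠ t : ℕ in atTop, 0 ≤ P.eval (t : ℚ))
    (h : ∀ᶠ t : ℕ in atTop, P.eval (t : ℚ) ≤ Q.eval (t : ℚ)) : P.natDegree ≤ Q.natDegree := by
  by_contra! hlt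
  have h1 : 0 ≤ (Q - P).leadingCoeff := leadingCoeff_nonneg_of_eventually <|
    h.mono fun t ht => by rw [Polynomial.eval_sub]; linarith
  rw [Polynomial.leadingCoeff_sub_of_degree_lt' (Polynomial.degree_lt_degree hlt)] at h1
  have h2 := leadingCoeff_nonneg_of_eventually h0
  have h3 : P.leadingCoeff = 0 := by linarith
  rw [Polynomial.leadingCoeff_eq_zero] at h3
  simp [h3] at hlt

theorem natDegree_shift_sub_lt {P : Polynomial ℚ} (hP : 0 < P.natDegree) (r : ℚ) :
    (Polynomial.taylor r P - P).natDegree < P.natDegree := by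
  have hP0 : P ≠ 0 := by rintro rfl; simp at hP
  have h := Polynomial.degree_sub_lt_left (p := Polynomial.taylor r P) (q := P)
    (Polynomial.degree_taylor _ _) (by rwa [Ne, Polynomial.taylor_eq_zero])
    (Polynomial.leadingCoeff_taylor _ _)
  rw [Polynomial.degree_taylor] at h
  by_cases h0 : Polynomial.taylor r P - P = 0
  · rw [h0]; simpa using hP
  · exact (Polynomial.natDegree_lt_natDegree_iff h0).2 h

/-- If a difference `P(t + e) - P(t)` eventually bounds the positive values `Q(t + e)` of a
polynomial `Q`, then `Q` has smaller degree than `P`. -/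
theorem natDegree_lt_of_eventually_le {P Q : Polynomial ℚ} {e : ℕ}
    (h0 : ∀ᶠ t : ℕ in atTop, 1 ≤ Q.eval (t : ℚ))
    (h : ∀ᶠ t : ℕ in atTop,
      Q.eval ((t + e : ℕ) : ℚ) ≤ P.eval ((t + e : ℕ) : ℚ) - P.eval (t : ℚ)) :
    Q.natDegree < P.natDegree := by
  have h1 : ∀ᶠ t : ℕ in atTop, (Polynomial.taylor (e : ℚ) Q).eval (t : ℚ) ≤
      (Polynomial.taylor (e : ℚ) P - P).eval (t : ℚ) := h.mono fun t ht => by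
    rw [Polynomial.eval_sub, Polynomial.taylor_eval, Polynomial.taylor_eval]
    exact_mod_cast ht
  have h2 : ∀ᶠ t : ℕ in atTop, 1 ≤ (Polynomial.taylor (e : ℚ) Q).eval (t : ℚ) := by
    have := (tendsto_add_atTop_nat e).eventually h0
    refine this.mono fun t ht => ?_
    rw [Polynomial.taylor_eval]
    exact_mod_cast ht
  have hP : 0 < P.natDegree := by
    by_contra! hle
    rw [Polynomial.eq_C_of_natDegree_le_zero hle, Polynomial.taylor_C, sub_self] at h1
    obtain ⟨t, h3, h4⟩ := (h1.and h2).exists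
    rw [Polynomial.eval_zero] at h3
    linarith
  have h3 := natDegree_le_of_eventually_le (h2.mono fun t ht => by linarith) h1
  rw [Polynomial.natDegree_taylor] at h3
  exact h3.trans_lt (natDegree_shift_sub_lt hP _)

end EventuallyNonneg

/-! ### Existence of the Hilbert polynomial -/

section HilbertPolynomial

/-- The function `f` agrees with a polynomial for large arguments. -/
def IsEventuallyPolynomial (f : ℕ → ℕ) : Prop :=
  ∃ P : Polynomial ℚ, ∀ᶠ t : ℕ in atTop, (f t : ℚ) = P.eval (t : ℚ)

theorem exists_sum_range_eval (P : Polynomial ℚ) :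
    ∃ Q : Polynomial ℚ, ∀ t : ℕ, ∑ s ∈ Finset.range t, P.eval (s : ℚ) = Q.eval (t : ℚ) := by
  induction P using Polynomial.induction_on' with
  | add p q hp hq =>
    obtain ⟨P, hP⟩ := hp
    obtain ⟨Q, hQ⟩ := hq
    exact ⟨P + Q, fun t => by simp [Finset.sum_add_distrib, hP, hQ]⟩
  | monomial p a =>
    refine ⟨Polynomial.C a * ∑ i ∈ Finset.range (p + 1),
      Polynomial.C (bernoulli i * ((p + 1).choose i) / (p + 1)) *
        Polynomial.X ^ (p + 1 - i), fun t => ?_⟩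
    simp only [Polynomial.eval_monomial, Polynomial.eval_mul, Polynomial.eval_C,
      Polynomial.eval_finsetSum, Polynomial.eval_pow, Polynomial.eval_X]
    rw [← Finset.mul_sum, sum_range_pow]
    congr 1
    exact Finset.sum_congr rfl fun i _ => by ring

theorem IsEventuallyPolynomial.of_difference {f g : ℕ → ℕ} (hg : IsEventuallyPolynomial g)
    (h : ∀ t, f (t + 1) = g (t + 1) + f t) : IsEventuallyPolynomial f := by
  obtain ⟨P, hP⟩ := hg
  obtain ⟨T, hT⟩ := eventually_atTop.1 hP
  obtain ⟨Q, hQ⟩ := exists_sum_range_eval (Polynomial.taylor 1 P)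
  refine ⟨Q + Polynomial.C (f T - Q.eval (T : ℚ)), eventually_atTop.2 ⟨T, fun t ht => ?_⟩⟩
  induction t, ht using Nat.le_induction with
  | base => simp
  | succ t ht ih =>
    rw [h, Nat.cast_add, ih, hT _ (by omega)]
    simp only [Polynomial.eval_add, Polynomial.eval_C]
    rw [← hQ (t + 1), Finset.sum_range_succ, hQ t, Polynomial.taylor_eval]
    push_cast; ring

variable {K : Type*} [Field K] {n : ℕ}

theorem isEventuallyPolynomial_hilbertFun_aux (k : ℕ) :
    ∀ I : Ideal (MvPolynomial (Fin (n + 1)) K), IsHomogIdeal I →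
      (∀ j : Fin (n + 1), k ≤ j → X j ∈ I) → IsEventuallyPolynomial (hilbertFun I) := by
  induction k with
  | zero =>
    intro I _ hX
    refine ⟨0, eventually_atTop.2 ⟨1, fun t ht => ?_⟩⟩
    have h := hilbertFun_add_finrank_degreePart I t
    have h2 : degreePart I t = homogeneousSubmodule (Fin (n + 1)) K t := by
      refine inf_eq_left.2 fun F hF => ?_
      have hle : Ideal.span (X '' Set.univ) ≤ I := by
        rw [Ideal.span_le]; rintro _ ⟨j, -, rfl⟩; exact hX j (Nat.zero_le _)
      refine hle (mem_ideal_span_X_image.2 fun d hd => ?_)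
      by_contra! hc
      have hd0 : d = 0 := Finsupp.ext fun j => hc j trivial
      have := (show F.IsHomogeneous t from hF).degree_eq_sum_deg_support hd
      simp [hd0] at this
      omega
    rw [h2] at h
    simp only [Polynomial.eval_zero, Nat.cast_eq_zero]
    omega
  | succ k ih =>
    intro I
    induction I using WellFoundedGT.induction with
    | ind I ihI =>
    intro hI hX
    by_cases hk : k < n + 1
    · let f : MvPolynomial (Fin (n + 1)) K := X ⟨k, hk⟩
      have hf : f.IsHomogeneous 1 := isHomogeneous_X _ _
      have hadd := hilbertFun_add hI hf (X_ne_zero _)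
      have h1 : IsEventuallyPolynomial (hilbertFun (I ⊔ Ideal.span {f})) := by
        refine ih _ (hI.sup (isHomogIdeal_span_singleton hf)) fun j hj => ?_
        rcases hj.eq_or_lt with h | h
        · have : X j = f := by congr 1; exact Fin.ext h.symm
          rw [this]
          exact Ideal.mem_sup_right (Ideal.mem_span_singleton_self f)
        · exact Ideal.mem_sup_left (hX j h)
      rcases (le_colonIdeal I f).eq_or_lt with h | h
      · exact h1.of_difference fun t => by rw [hadd t, ← h]
      · obtain ⟨P, hP⟩ := h1
        obtain ⟨Q, hQ⟩ := ihI _ h (hI.colon hf) fun j hj => h.le (hX j hj)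
        refine ⟨P + Polynomial.taylor (-1) Q, ?_⟩
        obtain ⟨T, hT⟩ := eventually_atTop.1 hP
        obtain ⟨U, hU⟩ := eventually_atTop.1 hQ
        refine eventually_atTop.2 ⟨T + U + 1, fun t ht => ?_⟩
        obtain ⟨s, rfl⟩ : ∃ s, t = s + 1 := ⟨t - 1, by omega⟩
        rw [hadd, Nat.cast_add, hT _ (by omega), hU s (by omega), Polynomial.eval_add,
          Polynomial.taylor_eval]
        push_cast; ring_nf
    · exact ih I hI fun j hj => absurd j.2 (by omega)

/-- Hilbert's theorem: the Hilbert function of a homogeneous ideal is eventually polynomial. For a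
variable `x` one compares `I` with `I + (x)` and `(I : x)`, by induction on the number of
variables not in `I` and by Noetherian induction on `I`. -/
theorem isEventuallyPolynomial_hilbertFun {I : Ideal (MvPolynomial (Fin (n + 1)) K)}
    (hI : IsHomogIdeal I) : IsEventuallyPolynomial (hilbertFun I) :=
  isEventuallyPolynomial_hilbertFun_aux (n + 1) I hI fun j hj => absurd j.2 (by omega)

end HilbertPolynomial

/-! ### Projective algebraic sets and their ideals -/

section ProjSets

variable {K : Type*} [Field K] {n : ℕ}

theorem coords_ne_zero (p : ProjSpace K n) : p.coords ≠ 0 := Projectivization.rep_nonzero p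

/-- The point with given homogeneous coordinates. -/
def ProjSpace.mk (v : Fin (n + 1) → K) (hv : v ≠ 0) : ProjSpace K n := Projectivization.mk K v hv

theorem exists_coords_mk (v : Fin (n + 1) → K) (hv : v ≠ 0) :
    ∃ c : K, c ≠ 0 ∧ (ProjSpace.mk v hv).coords = c • v := by
  obtain ⟨a, ha⟩ := Projectivization.exists_smul_eq_mk_rep K v hv
  exact ⟨a, a.ne_zero, ha.symm⟩

theorem mk_smul (v : Fin (n + 1) → K) (hv : v ≠ 0) (c : K) (hc : c • v ≠ 0) :
    ProjSpace.mk (c • v) hc = ProjSpace.mk v hv := by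
  refine (Projectivization.mk_eq_mk_iff' K _ _ _ _).2 ⟨c, rfl⟩

theorem eval_smul_of_isHomogeneous {σ : Type*} {F : MvPolynomial σ K} {d : ℕ}
    (hF : F.IsHomogeneous d) (c : K) (v : σ → K) : eval (c • v) F = c ^ d * eval v F := by
  rw [eval_eq, eval_eq, Finset.mul_sum]
  refine Finset.sum_congr rfl fun m hm => ?_
  have h : ∑ i ∈ m.support, m i = d := (hF.degree_eq_sum_deg_support hm).symm
  simp only [Pi.smul_apply, smul_eq_mul, mul_pow, Finset.prod_mul_distrib]
  rw [Finset.prod_pow_eq_pow_sum, h]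
  ring

theorem eval_coords_mk_eq_zero_iff {F : MvPolynomial (Fin (n + 1)) K} {d : ℕ}
    (hF : F.IsHomogeneous d) (v : Fin (n + 1) → K) (hv : v ≠ 0) :
    eval (ProjSpace.mk v hv).coords F = 0 ↔ eval v F = 0 := by
  obtain ⟨c, hc, h⟩ := exists_coords_mk v hv
  rw [h, eval_smul_of_isHomogeneous hF]
  simp [hc]

theorem isClosed_iff_isAlgebraicSet {Z : Set (ProjSpace K n)} : IsClosed Z ↔ IsAlgebraicSet Z := by
  rw [← isOpen_compl_iff]
  change IsAlgebraicSet Zᶜᶜ ↔ _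
  rw [compl_compl]

theorem isClosed_zeros {F : MvPolynomial (Fin (n + 1)) K} {d : ℕ} (hF : F.IsHomogeneous d) :
    IsClosed {p : ProjSpace K n | eval p.coords F = 0} := by
  rw [isClosed_iff_isAlgebraicSet]
  exact ⟨{F}, fun G hG => ⟨d, by rw [Set.mem_singleton_iff.1 hG]; exact hF⟩, by
    ext p; simp [projZeros]⟩

theorem eval_eq_zero_of_mem_homogIdeal {X : Set (ProjSpace K n)}
    {F : MvPolynomial (Fin (n + 1)) K} (hF : F ∈ homogIdeal X) {p : ProjSpace K n} (hp : p ∈ X) :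
    eval p.coords F = 0 := by
  have : homogIdeal X ≤ RingHom.ker (eval p.coords) :=
    Ideal.span_le.2 fun G hG => hG.2 p hp
  exact this hF

theorem mem_homogIdeal_iff {X : Set (ProjSpace K n)} {F : MvPolynomial (Fin (n + 1)) K} {d : ℕ}
    (hF : F.IsHomogeneous d) : F ∈ homogIdeal X ↔ ∀ p ∈ X, eval p.coords F = 0 :=
  ⟨fun h _ hp => eval_eq_zero_of_mem_homogIdeal h hp, fun h => Ideal.subset_span ⟨⟨d, hF⟩, h⟩⟩

theorem isHomogIdeal_homogIdeal (X : Set (ProjSpace K n)) : IsHomogIdeal (homogIdeal X) :=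
  isHomogIdeal_span fun _ hF => hF.1

theorem homogIdeal_anti {X Y : Set (ProjSpace K n)} (h : X ⊆ Y) : homogIdeal Y ≤ homogIdeal X :=
  Ideal.span_mono fun _ hF => ⟨hF.1, fun p hp => hF.2 p (h hp)⟩

theorem exists_hilbertPolynomial (X : Set (ProjSpace K n)) :
    ∃ P : Polynomial ℚ, IsHilbertPolynomial X P :=
  isEventuallyPolynomial_hilbertFun (isHomogIdeal_homogIdeal X)

theorem forall_mem_closure_eval_eq_zero {X : Set (ProjSpace K n)}
    {F : MvPolynomial (Fin (n + 1)) K} {d : ℕ} (hF : F.IsHomogeneous d)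
    (h : ∀ p ∈ X, eval p.coords F = 0) : ∀ p ∈ closure X, eval p.coords F = 0 := by
  have h1 : X ⊆ {p : ProjSpace K n | eval p.coords F = 0} := h
  have h2 := closure_minimal h1 (isClosed_zeros hF)
  exact fun p hp => h2 hp

/-- A point outside a closed set is separated from it by a form. -/
theorem exists_isHomogeneous_of_notMem {Z : Set (ProjSpace K n)} (hZ : IsClosed Z)
    {p : ProjSpace K n} (hp : p ∉ Z) :
    ∃ (d : ℕ) (F : MvPolynomial (Fin (n + 1)) K), F.IsHomogeneous d ∧
      (∀ q ∈ Z, eval q.coords F = 0) ∧ eval p.coords F ≠ 0 := by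
  obtain ⟨T, hT, hZT⟩ := isClosed_iff_isAlgebraicSet.1 hZ
  by_contra! hc
  refine hp (hZT ▸ fun F hF => ?_)
  obtain ⟨d, hd⟩ := hT F hF
  refine hc d F hd fun q hq => ?_
  rw [hZT] at hq
  exact hq F hF

theorem eval_eq_zero_or_of_isIrreducible {Z : Set (ProjSpace K n)} (hZ : IsIrreducible Z)
    {F G : MvPolynomial (Fin (n + 1)) K} {d e : ℕ} (hF : F.IsHomogeneous d)
    (hG : G.IsHomogeneous e) (h : ∀ p ∈ Z, eval p.coords (F * G) = 0) :
    (∀ p ∈ Z, eval p.coords F = 0) ∨ ∀ p ∈ Z, eval p.coords G = 0 :=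
  isPreirreducible_iff_isClosed_union_isClosed.1 hZ.2 _ _ (isClosed_zeros hF) (isClosed_zeros hG)
    fun p hp => mul_eq_zero.1 ((map_mul _ _ _).symm.trans (h p hp))

theorem one_le_hilbertFun {Z : Set (ProjSpace K n)} (hZ : Z.Nonempty) (t : ℕ) :
    1 ≤ hilbertFun (homogIdeal Z) t := by
  obtain ⟨p, hp⟩ := hZ
  obtain ⟨i, hi⟩ := Function.ne_iff.1 (coords_ne_zero p)
  by_contra! hlt
  have h := hilbertFun_add_finrank_degreePart (homogIdeal Z) t
  have h1 : degreePart (homogIdeal Z) t = homogeneousSubmodule (Fin (n + 1)) K t :=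
    Submodule.eq_of_le_of_finrank_eq inf_le_left (by omega)
  have h2 : X i ^ t ∈ degreePart (homogIdeal Z) t := by
    rw [h1]
    exact isHomogeneous_X_pow i t
  have h3 := eval_eq_zero_of_mem_homogIdeal (mem_degreePart.1 h2).2 hp
  rw [map_pow, eval_X] at h3
  exact hi (eq_zero_of_pow_eq_zero h3)

/-- The degree of the Hilbert polynomial drops when passing to a smaller irreducible closed
set: some form `f` vanishes on the smaller set and is a nonzero divisor for the larger one. -/
theorem natDegree_hilbertPolynomial_lt {Z Z' : Set (ProjSpace K n)} (hZ : IsClosed Z)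
    (hZn : Z.Nonempty) (hZ' : IsIrreducible Z') (hlt : Z ⊂ Z') {P Q : Polynomial ℚ}
    (hP : IsHilbertPolynomial Z' P) (hQ : IsHilbertPolynomial Z Q) :
    Q.natDegree < P.natDegree := by
  obtain ⟨p, hp', hp⟩ := Set.exists_of_ssubset hlt
  obtain ⟨e, f, hf, hfZ, hfp⟩ := exists_isHomogeneous_of_notMem hZ hp
  have hf0 : f ≠ 0 := by rintro rfl; simp at hfp
  have hcolon : ∀ t, hilbertFun (homogIdeal Z') t ≤ hilbertFun (colonIdeal (homogIdeal Z') f) t := by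
    intro t
    refine hilbertFun_anti fun G hG hGf => ?_
    rw [mem_homogIdeal_iff hG]
    rcases eval_eq_zero_or_of_isIrreducible hZ' hG hf
      (fun q hq => eval_eq_zero_of_mem_homogIdeal hGf hq) with h | h
    · exact h
    · exact absurd (h p hp') hfp
  have hle : ∀ t, hilbertFun (homogIdeal Z) (t + e) + hilbertFun (homogIdeal Z') t ≤
      hilbertFun (homogIdeal Z') (t + e) := by
    intro t
    rw [hilbertFun_add (isHomogIdeal_homogIdeal Z') hf hf0 t]
    refine add_le_add (hilbertFun_anti fun G hG hGI => ?_) (hcolon t)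
    have : homogIdeal Z' ⊔ Ideal.span {f} ≤ homogIdeal Z := by
      refine sup_le (homogIdeal_anti hlt.1) ?_
      rw [Ideal.span_singleton_le_iff_mem]
      exact (mem_homogIdeal_iff hf).2 hfZ
    exact this hGI
  refine natDegree_lt_of_eventually_le (e := e) (hQ.mono fun t ht => ?_) ?_
  · rw [← ht]
    exact_mod_cast one_le_hilbertFun hZn t
  · filter_upwards [hP, (tendsto_add_atTop_nat e).eventually hP,
      (tendsto_add_atTop_nat e).eventually hQ] with t h1 h2 h3
    rw [← h1, ← h2, ← h3, le_sub_iff_add_le]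
    exact_mod_cast hle t

/-- The dimension of a closed set is at most the degree of its Hilbert polynomial. -/
theorem topologicalKrullDim_le_natDegree {X : Set (ProjSpace K n)} (hX : IsClosed X)
    {P : Polynomial ℚ} (hP : IsHilbertPolynomial X P) : topologicalKrullDim X ≤ P.natDegree := by
  choose H hH using exists_hilbertPolynomial (K := K) (n := n)
  have hcl : ∀ Z : TopologicalSpace.IrreducibleCloseds X,
      IsClosed (Subtype.val '' (Z : Set X)) ∧ IsIrreducible (Subtype.val '' (Z : Set X)) :=
    fun Z => ⟨hX.isClosedEmbedding_subtypeVal.isClosedMap _ Z.isClosed,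
      Z.isIrreducible.image _ continuous_subtype_val.continuousOn⟩
  have hlt : ∀ Z Z' : TopologicalSpace.IrreducibleCloseds X, Z < Z' →
      (H (Subtype.val '' (Z : Set X))).natDegree < (H (Subtype.val '' (Z' : Set X))).natDegree := by
    intro Z Z' h
    refine natDegree_hilbertPolynomial_lt (hcl Z).1 (hcl Z).2.nonempty (hcl Z').2 ?_ (hH _) (hH _)
    exact (Subtype.val_injective.injOn.image_ssubset_image_iff (Set.subset_univ _)
      (Set.subset_univ _)).2 (SetLike.coe_ssubset_coe.2 h)
  have hle : ∀ Z : TopologicalSpace.IrreducibleCloseds X,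
      (H (Subtype.val '' (Z : Set X))).natDegree ≤ P.natDegree := by
    intro Z
    refine natDegree_le_of_eventually_le ((hH (Subtype.val '' (Z : Set X))).mono fun t ht => ?_) ?_
    · rw [← ht]; positivity
    · filter_upwards [hH (Subtype.val '' (Z : Set X)), hP] with t h1 h2
      rw [← h1, ← h2]
      exact_mod_cast hilbertFun_anti fun F _ hF =>
        homogIdeal_anti (Subtype.coe_image_subset X (Z : Set X)) hF
  refine iSup_le fun p => ?_
  have := (p.map (fun Z : TopologicalSpace.IrreducibleCloseds X =>
    (⟨(H (Subtype.val '' (Z : Set X))).natDegree, Nat.lt_succ_of_le (hle Z)⟩ :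
      Fin (P.natDegree + 1))) fun Z Z' h => hlt Z Z' h).length_lt_card
  rw [Fintype.card_fin, Nat.lt_succ_iff] at this
  exact_mod_cast this

theorem isIrreducible_preimage_val {Y : Type*} [TopologicalSpace Y] {X Z : Set Y}
    (hZX : Z ⊆ X) (hZ : IsIrreducible Z) : IsIrreducible ((↑) ⁻¹' Z : Set X) := by
  obtain ⟨p, hp⟩ := hZ.nonempty
  refine ⟨⟨⟨p, hZX hp⟩, hp⟩, ?_⟩
  · rw [isPreirreducible_iff_isClosed_union_isClosed]
    intro A B hA hB hAB
    obtain ⟨A, hA', rfl⟩ := isClosed_induced_iff.1 hA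
    obtain ⟨B, hB', rfl⟩ := isClosed_induced_iff.1 hB
    rcases isPreirreducible_iff_isClosed_union_isClosed.1 hZ.2 A B hA' hB'
      (fun p hp => @hAB ⟨p, hZX hp⟩ hp) with h | h
    · exact Or.inl fun p hp => h hp
    · exact Or.inr fun p hp => h hp

theorem two_le_topologicalKrullDim {Y : Type*} [TopologicalSpace Y] {X C P : Set Y}
    (hP : IsClosed P ∧ IsIrreducible P) (hC : IsClosed C ∧ IsIrreducible C)
    (hX : IsIrreducible X) (hPC : P ⊂ C) (hCX : C ⊂ X) : 2 ≤ topologicalKrullDim X := by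
  have h1 := isIrreducible_preimage_val (hPC.1.trans hCX.1) hP.2
  have h2 := isIrreducible_preimage_val hCX.1 hC.2
  have h3 := isIrreducible_preimage_val subset_rfl hX
  let a : TopologicalSpace.IrreducibleCloseds X :=
    ⟨_, h1, hP.1.preimage continuous_subtype_val⟩
  let b : TopologicalSpace.IrreducibleCloseds X :=
    ⟨_, h2, hC.1.preimage continuous_subtype_val⟩
  let c : TopologicalSpace.IrreducibleCloseds X :=
    ⟨_, h3, by simp⟩
  have hab : a < b := by
    rw [← SetLike.coe_ssubset_coe]
    obtain ⟨p, hp, hp'⟩ := Set.exists_of_ssubset hPC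
    exact ⟨fun q hq => hPC.1 hq, fun h => hp' (@h ⟨p, hCX.1 hp⟩ hp)⟩
  have hbc : b < c := by
    rw [← SetLike.coe_ssubset_coe]
    obtain ⟨p, hp, hp'⟩ := Set.exists_of_ssubset hCX
    exact ⟨fun q _ => q.2, fun h => hp' (@h ⟨p, hp⟩ hp)⟩
  exact Order.LTSeries.length_le_krullDim ⟨2, ![a, b, c], fun i => by
    fin_cases i
    · exact hab
    · exact hbc⟩

end ProjSets

/-! ### Images of rational maps -/

section RationalImage

variable {K : Type*} [Field K] {a b m : ℕ} {s : Fin (b + 1) → MvPolynomial (Fin (a + 1)) K}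

theorem mk_congr {n : ℕ} {v w : Fin (n + 1) → K} (h : v = w) (hv : v ≠ 0) (hw : w ≠ 0) :
    ProjSpace.mk v hv = ProjSpace.mk w hw := by
  subst h; rfl

theorem eval_aeval_forms (F : MvPolynomial (Fin (b + 1)) K) (v : Fin (a + 1) → K) :
    eval v (aeval s F) = eval (fun i => eval v (s i)) F := by
  rw [← coe_aeval_eq_eval, ← coe_aeval_eq_eval]
  change aeval v (aeval s F) = aeval _ F
  rw [← AlgHom.comp_apply, comp_aeval]
  rfl

theorem mk_mem_rationalImage (hs : ∀ i, (s i).IsHomogeneous m) (hm : 0 < m)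
    (v : Fin (a + 1) → K) (hv : (fun i => eval v (s i)) ≠ 0) :
    ProjSpace.mk _ hv ∈ rationalImage s := by
  have hv0 : v ≠ 0 := by
    rintro rfl
    apply hv
    funext i
    have := eval_smul_of_isHomogeneous (hs i) (0 : K) 0
    rw [zero_smul, zero_pow hm.ne', zero_mul] at this
    exact this
  obtain ⟨c, hc, h⟩ := exists_coords_mk v hv0
  have h1 : (fun i => eval (ProjSpace.mk v hv0).coords (s i)) =
      c ^ m • fun i => eval v (s i) := by
    funext i
    rw [h, eval_smul_of_isHomogeneous (hs i)]
    rfl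
  have h2 : c ^ m • (fun i => eval v (s i)) ≠ 0 := smul_ne_zero (pow_ne_zero _ hc) hv
  refine subset_closure ⟨ProjSpace.mk v hv0, h1 ▸ h2, ?_⟩
  rw [← mk_smul _ hv (c ^ m) h2]
  exact mk_congr h1.symm _ _

variable [Infinite K]

theorem exists_eval_ne_zero {G : MvPolynomial (Fin (a + 1)) K} (hG : G ≠ 0) :
    ∃ v, eval v G ≠ 0 := by
  by_contra! h
  exact hG (MvPolynomial.funext fun v => by rw [h v, map_zero])

/-- The forms vanishing on the image of a rational map form the kernel of the corresponding map of
polynomial rings. -/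
theorem mem_homogIdeal_rationalImage_iff (hs : ∀ i, (s i).IsHomogeneous m) (hm : 0 < m)
    (hs0 : ∃ i, s i ≠ 0) {F : MvPolynomial (Fin (b + 1)) K} {d : ℕ} (hF : F.IsHomogeneous d) :
    F ∈ homogIdeal (rationalImage s) ↔ aeval s F = 0 := by
  rw [mem_homogIdeal_iff hF]
  constructor
  · intro h
    obtain ⟨i, hi⟩ := hs0
    by_contra hne
    obtain ⟨v, hv⟩ := exists_eval_ne_zero (mul_ne_zero hi hne)
    rw [map_mul] at hv
    have hv' : (fun i => eval v (s i)) ≠ 0 := fun h0 =>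
      left_ne_zero_of_mul hv (congrFun h0 i)
    have := h _ (mk_mem_rationalImage hs hm v hv')
    rw [eval_coords_mk_eq_zero_iff hF, ← eval_aeval_forms] at this
    exact right_ne_zero_of_mul hv this
  · intro h
    refine forall_mem_closure_eval_eq_zero hF ?_
    rintro _ ⟨y, hy, rfl⟩
    refine (eval_coords_mk_eq_zero_iff hF _ hy).2 ?_
    rw [← eval_aeval_forms, h, map_zero]

theorem isIrreducible_rationalImage (hs : ∀ i, (s i).IsHomogeneous m) (hm : 0 < m)
    (hs0 : ∃ i, s i ≠ 0) : IsIrreducible (rationalImage s) := by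
  constructor
  · obtain ⟨i, hi⟩ := hs0
    obtain ⟨v, hv⟩ := exists_eval_ne_zero hi
    exact ⟨_, mk_mem_rationalImage hs hm v fun h0 => hv (congrFun h0 i)⟩
  · rw [isPreirreducible_iff_isClosed_union_isClosed]
    intro A B hA hB hAB
    by_contra! hc
    obtain ⟨⟨p, hp, hpA⟩, ⟨q, hq, hqB⟩⟩ := And.imp Set.not_subset.1 Set.not_subset.1 hc
    obtain ⟨d, F, hF, hFA, hFp⟩ := exists_isHomogeneous_of_notMem hA hpA
    obtain ⟨e, G, hG, hGB, hGq⟩ := exists_isHomogeneous_of_notMem hB hqB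
    have h : F * G ∈ homogIdeal (rationalImage s) := by
      refine (mem_homogIdeal_iff (hF.mul hG)).2 fun r hr => ?_
      rw [map_mul]
      rcases hAB hr with h | h
      · rw [hFA r h, zero_mul]
      · rw [hGB r h, mul_zero]
    rw [mem_homogIdeal_rationalImage_iff hs hm hs0 (hF.mul hG), map_mul, mul_eq_zero] at h
    rcases h with h | h
    · exact hFp (eval_eq_zero_of_mem_homogIdeal
        ((mem_homogIdeal_rationalImage_iff hs hm hs0 hF).2 h) hp)
    · exact hGq (eval_eq_zero_of_mem_homogIdeal
        ((mem_homogIdeal_rationalImage_iff hs hm hs0 hG).2 h) hq)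

end RationalImage

/-! ### The surfaces and their ideals -/

section Surface

variable {K : Type*} [Field K] {m : ℕ}

theorem forms_isHomogeneous (hm : 6 ≤ m) (i : Fin 5) : (forms K m i).IsHomogeneous m := by
  have h (j : Fin 3) (e : ℕ) : (X j ^ e : MvPolynomial (Fin 3) K).IsHomogeneous e :=
    isHomogeneous_X_pow j e
  have h1 (j : Fin 3) : (X j : MvPolynomial (Fin 3) K).IsHomogeneous 1 := isHomogeneous_X _ j
  fin_cases i
  · have := (h 1 (m - 1)).mul (h1 2)
    rwa [Nat.sub_add_cancel (by omega)] at this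
  · have := (h 0 (m - 1)).mul (h1 1)
    rwa [Nat.sub_add_cancel (by omega)] at this
  · have := (h 1 (m - 3)).mul (h 2 3)
    rw [Nat.sub_add_cancel (by omega)] at this
    exact (h 1 m).add this
  · exact h 0 m
  · have := (h 2 (m - 1)).mul (h1 0)
    rwa [Nat.sub_add_cancel (by omega)] at this

theorem forms_three_ne_zero : forms K m 3 ≠ 0 := pow_ne_zero _ (X_ne_zero _)

variable [Infinite K]

theorem mem_homogIdeal_surf_iff (hm : 6 ≤ m) {F : MvPolynomial (Fin 5) K} {d : ℕ}
    (hF : F.IsHomogeneous d) : F ∈ homogIdeal (surf K m) ↔ aeval (forms K m) F = 0 :=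
  mem_homogIdeal_rationalImage_iff (forms_isHomogeneous hm) (by omega) ⟨3, forms_three_ne_zero⟩ hF

/-- The ideal of the surface is the kernel of the map of polynomial rings given by the forms. -/
theorem homogIdeal_surf_eq_ker (hm : 6 ≤ m) :
    homogIdeal (surf K m) = RingHom.ker (aeval (R := K) (forms K m)) := by
  apply le_antisymm
  · refine Ideal.span_le.2 ?_
    rintro F ⟨⟨d, hd⟩, h⟩
    exact (mem_homogIdeal_surf_iff hm hd).1 (Ideal.subset_span ⟨⟨d, hd⟩, h⟩)
  · intro F hF
    rw [RingHom.mem_ker] at hF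
    rw [← sum_homogeneousComponent F]
    refine sum_mem fun t _ => ?_
    rw [mem_homogIdeal_surf_iff hm (homogeneousComponent_isHomogeneous t F)]
    -- `aeval` multiplies degrees by `m`, so it respects homogeneous components
    have h : ∀ i, (aeval (forms K m) (homogeneousComponent i F)).IsHomogeneous (m * i) :=
      fun i => (homogeneousComponent_isHomogeneous i F).aeval (forms K m) (forms_isHomogeneous hm)
    have h1 := congrArg (homogeneousComponent (m * t)) hF
    rw [← sum_homogeneousComponent F, map_sum, map_sum, map_zero] at h1
    by_cases ht : t ∈ Finset.range (F.totalDegree + 1)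
    · rw [Finset.sum_eq_single_of_mem t ht, homogeneousComponent_eq_self (h t)] at h1
      · exact h1
      · intro i _ hi
        rw [homogeneousComponent_of_mem (h i), if_neg]
        intro hmi
        exact hi (Nat.eq_of_mul_eq_mul_left (by omega) hmi.symm)
    · rw [homogeneousComponent_eq_zero, map_zero]
      simpa using ht

theorem isProjVariety_surf (hm : 6 ≤ m) : IsProjVariety (surf K m) :=
  ⟨isClosed_closure, isIrreducible_rationalImage (forms_isHomogeneous hm) (by omega)
    ⟨3, forms_three_ne_zero⟩⟩

theorem isNondegenerate_surf (hm : 6 ≤ m) : IsNondegenerate (surf K m) := by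
  intro F hF h
  have h1 := (mem_homogIdeal_surf_iff hm hF).1 ((mem_homogIdeal_iff hF).2 h)
  rw [← mem_homogeneousSubmodule, homogeneousSubmodule_one_eq_span_X,
    Submodule.mem_span_range_iff_exists_fun] at hF
  obtain ⟨c, rfl⟩ := hF
  have h2 : ∀ v : Fin 3 → K, c 0 * (v 1 ^ (m - 1) * v 2) + c 1 * (v 0 ^ (m - 1) * v 1) +
      c 2 * (v 1 ^ m + v 1 ^ (m - 3) * v 2 ^ 3) + c 3 * v 0 ^ m +
      c 4 * (v 2 ^ (m - 1) * v 0) = 0 := by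
    intro v
    have := congrArg (eval v) h1
    simpa [Fin.sum_univ_five, forms, smul_eval, mul_add] using this
  have e1 : m - 1 ≠ 0 := by omega
  have e2 : m ≠ 0 := by omega
  have e3 : m - 3 ≠ 0 := by omega
  have h3 : c 3 = 0 := by simpa [e1, e2, e3] using h2 ![1, 0, 0]
  have h4 : c 2 = 0 := by simpa [e1, e2, e3] using h2 ![0, 1, 0]
  have h5 : c 0 = 0 := by simpa [e1, e2, e3, h3, h4] using h2 ![0, 1, 1]
  have h6 : c 1 = 0 := by simpa [e1, e2, e3, h3, h4] using h2 ![1, 1, 0]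
  have h7 : c 4 = 0 := by simpa [e1, e2, e3, h3, h4] using h2 ![1, 0, 1]
  simp [Fin.sum_univ_five, h3, h4, h5, h6, h7]

end Surface

section Dimension

variable {K : Type*} [Field K] {m : ℕ}

/-- The forms on the projective line obtained by restriction to the line `y₂ = 0`. -/
noncomputable def lineForms (K : Type*) [Field K] (m : ℕ) : Fin 5 → MvPolynomial (Fin 2) K :=
  ![0, X 0 ^ (m - 1) * X 1, X 1 ^ m, X 0 ^ m, 0]

theorem lineForms_isHomogeneous (hm : 6 ≤ m) (i : Fin 5) : (lineForms K m i).IsHomogeneous m := by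
  fin_cases i
  · exact isHomogeneous_zero _ _ _
  · have := (isHomogeneous_X_pow (R := K) (0 : Fin 2) (m - 1)).mul (isHomogeneous_X K (1 : Fin 2))
    rwa [Nat.sub_add_cancel (by omega)] at this
  · exact isHomogeneous_X_pow _ _
  · exact isHomogeneous_X_pow _ _
  · exact isHomogeneous_zero _ _ _

theorem eval_lineForms (hm : 6 ≤ m) (y : Fin 2 → K) :
    (fun i => eval y (lineForms K m i)) = fun i => eval ![y 0, y 1, 0] (forms K m i) := by
  funext i
  have h1 : m - 1 ≠ 0 := by omega
  fin_cases i <;> simp [lineForms, forms, h1]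

variable [Infinite K]

/-- The surface has dimension at least two: it contains the image of the line `y₂ = 0`, and this
curve contains the point `[0 : 0 : 0 : 1 : 0]`. -/
theorem two_le_topologicalKrullDim_surf (hm : 6 ≤ m) : 2 ≤ topologicalKrullDim (surf K m) := by
  let C : Set (ProjSpace K 4) := rationalImage (a := 1) (b := 4) (lineForms K m)
  have hline0 : ∃ i, lineForms K m i ≠ 0 := ⟨3, pow_ne_zero _ (X_ne_zero _)⟩
  have hC : ∀ {F : MvPolynomial (Fin 5) K}, F.IsHomogeneous 1 →
      (F ∈ homogIdeal C ↔ aeval (lineForms K m) F = 0) := fun hF =>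
    mem_homogIdeal_rationalImage_iff (lineForms_isHomogeneous hm) (by omega) hline0 hF
  have hCX : C ⊆ surf K m := by
    refine closure_minimal ?_ (isProjVariety_surf hm).1
    rintro _ ⟨y, hy, rfl⟩
    have h : (fun i => eval ![y.coords 0, y.coords 1, 0] (forms K m i)) ≠ 0 := by
      rwa [← eval_lineForms hm]
    have := mk_mem_rationalImage (forms_isHomogeneous hm) (by omega) _ h
    rw [← mk_congr (eval_lineForms hm _) hy h] at this
    exact this
  have hp : (fun i => eval (![1, 0] : Fin 2 → K) (lineForms K m i)) ≠ 0 := fun h => by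
    have := congrFun h 3
    simp [lineForms] at this
  let p : ProjSpace K 4 := ProjSpace.mk _ hp
  have hpC : p ∈ C := mk_mem_rationalImage (lineForms_isHomogeneous hm) (by omega) _ hp
  refine two_le_topologicalKrullDim (P := closure {p}) (C := C)
    ⟨isClosed_closure, isIrreducible_singleton.closure⟩
    ⟨isClosed_closure, isIrreducible_rationalImage (lineForms_isHomogeneous hm) (by omega) hline0⟩
    (isProjVariety_surf hm).2
    ⟨closure_minimal (by simpa using hpC) isClosed_closure, fun h => ?_⟩ ⟨hCX, fun h => ?_⟩
  · have h1 : (X 1 : MvPolynomial (Fin 5) K) ∈ homogIdeal C := by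
      refine (mem_homogIdeal_iff (isHomogeneous_X _ _)).2 fun q hq =>
        forall_mem_closure_eval_eq_zero (isHomogeneous_X _ _) ?_ q (h hq)
      intro q hq
      rw [Set.mem_singleton_iff.1 hq, eval_coords_mk_eq_zero_iff (isHomogeneous_X _ _), eval_X]
      simp [lineForms]
    rw [hC (isHomogeneous_X _ _), aeval_X] at h1
    exact mul_ne_zero (pow_ne_zero _ (X_ne_zero _)) (X_ne_zero _) h1
  · have h1 : (X 0 : MvPolynomial (Fin 5) K) ∈ homogIdeal C := by
      rw [hC (isHomogeneous_X _ _), aeval_X]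
      rfl
    have h2 := homogIdeal_anti h h1
    rw [mem_homogIdeal_surf_iff hm (isHomogeneous_X _ _), aeval_X] at h2
    exact mul_ne_zero (pow_ne_zero _ (X_ne_zero _)) (X_ne_zero _) h2

end Dimension

/-! ### The degree of the surfaces -/

section Degree

variable {K : Type*} [Field K] {m : ℕ}

/-- The image in `K[y₀, y₁, y₂]` of the forms of degree `t` in five variables: the span of the
products of `t` of the given forms. -/
noncomputable def imagePart (K : Type*) [Field K] (m t : ℕ) : Submodule K (MvPolynomial (Fin 3) K) :=
  (homogeneousSubmodule (Fin 5) K t).map (aeval (forms K m)).toLinearMap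

instance imagePart_finite (t : ℕ) : Module.Finite K (imagePart K m t) :=
  Module.Finite.map _ _

theorem one_mem_imagePart : (1 : MvPolynomial (Fin 3) K) ∈ imagePart K m 0 :=
  ⟨1, isHomogeneous_one _ _, by simp⟩

theorem forms_pow_mul_mem_imagePart (i : Fin 5) (e : ℕ) {t : ℕ} {p : MvPolynomial (Fin 3) K}
    (hp : p ∈ imagePart K m t) : forms K m i ^ e * p ∈ imagePart K m (t + e) := by
  obtain ⟨F, hF, rfl⟩ := hp
  refine ⟨X i ^ e * F, ?_, by simp⟩
  have := (isHomogeneous_X_pow (R := K) i e).mul hF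
  rwa [add_comm] at this

theorem forms_mul_mem_imagePart (i : Fin 5) {t : ℕ} {p : MvPolynomial (Fin 3) K}
    (hp : p ∈ imagePart K m t) : forms K m i * p ∈ imagePart K m (t + 1) := by
  simpa using forms_pow_mul_mem_imagePart i 1 hp

theorem imagePart_congr {t t' : ℕ} {p p' : MvPolynomial (Fin 3) K} (h : p ∈ imagePart K m t)
    (hp : p' = p) (ht : t' = t) : p' ∈ imagePart K m t' := by
  rwa [hp, ht]

theorem edge_mem_imagePart_zero (l b q : ℕ) (hb : b + q = 2 * (l + 3)) (hq : q ≤ 2) :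
    X 0 ^ (2 * (l + 3) * (l + 2)) * X 1 ^ b * X 2 ^ q ∈ imagePart K (l + 3) (2 * (l + 3)) := by
  have h1 : ∀ e₀ e₁ e₃ : ℕ, forms K (l + 3) 0 ^ e₀ * (forms K (l + 3) 1 ^ e₁ *
      (forms K (l + 3) 3 ^ e₃ * 1)) ∈ imagePart K (l + 3) (0 + e₃ + e₁ + e₀) := fun e₀ e₁ e₃ =>
    forms_pow_mul_mem_imagePart _ _ (forms_pow_mul_mem_imagePart _ _
      (forms_pow_mul_mem_imagePart _ _ one_mem_imagePart))
  have s0 : forms K (l + 3) 0 = X 1 ^ (l + 2) * X 2 := rfl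
  have s1 : forms K (l + 3) 1 = X 0 ^ (l + 2) * X 1 := rfl
  have s3 : forms K (l + 3) 3 = X 0 ^ (l + 3) := rfl
  rw [s0, s1, s3] at h1
  obtain rfl | rfl | rfl : q = 0 ∨ q = 1 ∨ q = 2 := by omega
  · obtain rfl : b = 2 * (l + 3) := by omega
    exact imagePart_congr (h1 0 (2 * (l + 3)) 0) (by ring) (by ring)
  · obtain rfl : b = (l + 2) + (l + 3) := by omega
    exact imagePart_congr (h1 1 (l + 3) (l + 2)) (by ring) (by ring)
  · obtain rfl : b = 2 * (l + 2) := by omega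
    exact imagePart_congr (h1 2 0 (2 * (l + 2))) (by ring) (by ring)

theorem forms_zero_mul (l e b q : ℕ) : X 0 ^ e * X 1 ^ (b + (l + 2)) * X 2 ^ (q + 1) =
    forms K (l + 3) 0 * (X 0 ^ e * X 1 ^ b * X 2 ^ q) := by
  have s0 : forms K (l + 3) 0 = X 1 ^ (l + 2) * X 2 := rfl
  rw [s0]; ring

theorem forms_two_mul (l e b q : ℕ) : X 0 ^ e * X 1 ^ (b + (l + 3)) * X 2 ^ q +
    X 0 ^ e * X 1 ^ (b + l) * X 2 ^ (q + 3) =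
    forms K (l + 3) 2 * (X 0 ^ e * X 1 ^ b * X 2 ^ q) := by
  have s2 : forms K (l + 3) 2 = X 1 ^ (l + 3) + X 1 ^ l * X 2 ^ 3 := rfl
  rw [s2]; ring

/-- Multiplication by `x₁ ^ (2m)` takes all monomials `y₁ ^ (mM - q) y₂ ^ q` with `q ≤ 3M + 2` into
the image. Indeed `y₂ / y₁ = x₀ x₃ ^ (m - 1) / x₁ ^ m`, and multiplication by
`x₀ = y₁ ^ (m - 1) y₂` and `x₂ = y₁ ^ m + y₁ ^ (m - 3) y₂ ^ 3` allows induction on `M`. -/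
theorem edge_mem_imagePart (l M : ℕ) : ∀ b q : ℕ, b + q = 2 * (l + 3) + (l + 3) * M →
    q ≤ 3 * M + 2 → X 0 ^ (2 * (l + 3) * (l + 2)) * X 1 ^ b * X 2 ^ q ∈
      imagePart K (l + 3) (2 * (l + 3) + M) := by
  induction M with
  | zero => exact fun b q hb hq => edge_mem_imagePart_zero l b q hb hq
  | succ M ih =>
    have hlM : 3 * M ≤ (l + 3) * M := Nat.mul_le_mul_right _ (by omega)
    simp only [mul_add (l + 3) M 1]
    generalize 2 * (l + 3) * (l + 2) = e at *
    have hmid : ∀ b q : ℕ, b + q = 2 * (l + 3) + ((l + 3) * M + (l + 3) * 1) → 1 ≤ q →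
        q ≤ 3 * M + 3 → X 0 ^ e * X 1 ^ b * X 2 ^ q ∈
          imagePart K (l + 3) (2 * (l + 3) + (M + 1)) := by
      intro b q hb h1 hq
      obtain ⟨q, rfl⟩ : ∃ q', q = q' + 1 := ⟨q - 1, by omega⟩
      obtain ⟨b, rfl⟩ : ∃ b', b = b' + (l + 2) := ⟨b - (l + 2), by omega⟩
      rw [forms_zero_mul]
      exact forms_mul_mem_imagePart 0 (ih b q (by omega) (by omega))
    have hx2 : ∀ b q : ℕ, b + q = 2 * (l + 3) + (l + 3) * M → q ≤ 3 * M + 2 →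
        X 0 ^ e * X 1 ^ (b + (l + 3)) * X 2 ^ q + X 0 ^ e * X 1 ^ (b + l) * X 2 ^ (q + 3) ∈
          imagePart K (l + 3) (2 * (l + 3) + (M + 1)) := by
      intro b q hb hq
      rw [forms_two_mul]
      exact forms_mul_mem_imagePart 2 (ih b q hb hq)
    intro b q hb hq
    by_cases h0 : q = 0
    · subst h0
      obtain rfl : b = 2 * (l + 3) + (l + 3) * M + (l + 3) := by omega
      have h1 := hx2 (2 * (l + 3) + (l + 3) * M) 0 (by omega) (by omega)
      have h2 := hmid (2 * (l + 3) + (l + 3) * M + l) (0 + 3) (by omega) (by omega) (by omega)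
      have := sub_mem h1 h2
      rwa [add_sub_cancel_right] at this
    · by_cases h1 : q ≤ 3 * M + 3
      · exact hmid b q hb (by omega) h1
      · obtain ⟨q, rfl⟩ : ∃ q', q = q' + 3 := ⟨q - 3, by omega⟩
        obtain ⟨b, rfl⟩ : ∃ b', b = b' + l := ⟨b - l, by omega⟩
        have h2 := hx2 b q (by omega) (by omega)
        have h3 := hmid (b + (l + 3)) q (by omega) (by omega) (by omega)
        have := sub_mem h2 h3
        rwa [add_sub_cancel_left] at this

/-- The arithmetic behind `monomial_mem_imagePart`: the exponent `j` of `x₄` has to lie in a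
residue class modulo `m = l + 3` and in an interval, which is long enough because of the summands
`m ^ 3`. -/
theorem exists_exponents (l : ℕ) (hl : 3 ≤ l) {n a b c : ℕ} (hsum : a + b + c = (l + 3) * n)
    (hreg : l * n ≤ l * a + b) :
    ∃ j i q M : ℕ, a + (l + 3) ^ 3 = (l + 3) * i + j ∧ c + (l + 3) ^ 3 = q + (l + 2) * j ∧
      n + 3 * (l + 3) ^ 2 = i + j + M ∧ q ≤ 3 * M := by
  obtain ⟨A, hA⟩ : ∃ A : ℤ, A = a + (l + 3) ^ 3 := ⟨_, rfl⟩
  obtain ⟨C, hC⟩ : ∃ C : ℤ, C = c + (l + 3) ^ 3 := ⟨_, rfl⟩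
  obtain ⟨N, hN⟩ : ∃ N : ℤ, N = n + 3 * (l + 3) ^ 2 := ⟨_, rfl⟩
  have hsum' : (a : ℤ) + b + c = (l + 3) * n := by exact_mod_cast hsum
  have hreg' : (l : ℤ) * n ≤ l * a + b := by exact_mod_cast hreg
  have hl' : (3 : ℤ) ≤ l := by exact_mod_cast hl
  have ha0 : (0 : ℤ) ≤ a := by positivity
  have hb0 : (0 : ℤ) ≤ b := by positivity
  have hc0 : (0 : ℤ) ≤ c := by positivity
  obtain ⟨D, hD⟩ : ∃ D : ℤ, D = (l + 3) * C + 3 * A - 3 * (l + 3) * N := ⟨_, rfl⟩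
  obtain ⟨E, hE⟩ : ∃ E : ℤ, E = (l + 2) * l := ⟨_, rfl⟩
  have hE0 : 0 < E := by rw [hE]; positivity
  -- the length of the interval: `E a' - D`, `E a'`, `l c' - D` and `l c'` are at least `E m`
  have k1 : E * (l + 3) ≤ E * A - D := by
    have h1 : E * A - D = (l + 3) * ((l * a + b - l * n) + (l + 3) ^ 2 * (l ^ 2 + l + 3)) := by
      rw [hD, hE, hA, hC, hN]
      linear_combination (-(l + 3 : ℤ)) * hsum'
    have h2 : E ≤ (l * a + b - l * n) + ((l : ℤ) + 3) ^ 2 * (l ^ 2 + l + 3) := by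
      rw [hE]; nlinarith [pow_pos (show (0 : ℤ) < l by omega) 3, pow_pos (show (0 : ℤ) < l by omega) 4]
    rw [h1, mul_comm]
    exact mul_le_mul_of_nonneg_left h2 (by omega)
  have k2 : E * (l + 3) ≤ E * A := by
    refine mul_le_mul_of_nonneg_left ?_ hE0.le
    rw [hA]
    nlinarith [pow_pos (show (0 : ℤ) < l by omega) 3, pow_pos (show (0 : ℤ) < l by omega) 2]
  have k3 : E * (l + 3) ≤ l * C - D := by
    have h1 : l * C - D = 3 * (b + (l + 3) ^ 3) := by
      rw [hD, hA, hC, hN]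
      linear_combination (-3 : ℤ) * hsum'
    rw [h1, hE]
    nlinarith [pow_pos (show (0 : ℤ) < l by omega) 3, pow_pos (show (0 : ℤ) < l by omega) 2]
  have k4 : E * (l + 3) ≤ l * C := by
    have h1 : E * (l + 3) = l * ((l + 2) * (l + 3)) := by rw [hE]; ring
    rw [h1]
    refine mul_le_mul_of_nonneg_left ?_ (by omega)
    rw [hC]
    nlinarith [pow_pos (show (0 : ℤ) < l by omega) 3, pow_pos (show (0 : ℤ) < l by omega) 2]
  obtain ⟨L, hL0, hL1, hL2⟩ : ∃ L : ℤ, 0 ≤ L ∧ D ≤ E * L ∧ E * L ≤ max D 0 + E := by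
    refine ⟨max D 0 / E + 1, by positivity, ?_, ?_⟩
    · have := Int.lt_mul_ediv_self_add (x := max D 0) hE0
      rw [mul_add, mul_one]
      exact (le_max_left _ _).trans this.le
    · have := Int.mul_ediv_self_le (x := max D 0) hE0.ne'
      rw [mul_add, mul_one]
      omega
  have hm0 : (0 : ℤ) < l + 3 := by omega
  obtain ⟨j, hj⟩ : ∃ j : ℤ, j = L + (A - L) % (l + 3) := ⟨_, rfl⟩
  have hr0 := Int.emod_nonneg (A - L) hm0.ne'
  have hr1 := Int.emod_lt_of_pos (A - L) hm0
  have hdiv := Int.emod_add_mul_ediv (A - L) (l + 3)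
  obtain ⟨i, hi⟩ : ∃ i : ℤ, i = (A - L) / (l + 3) := ⟨_, rfl⟩
  rw [← hi] at hdiv
  have hij : A = (l + 3) * i + j := by rw [hj]; linear_combination -hdiv
  have hj0 : 0 ≤ j := by omega
  have hDj : D ≤ E * j := hL1.trans (mul_le_mul_of_nonneg_left (by omega) hE0.le)
  have hjE : E * j ≤ max D 0 + E * (l + 3) := by
    have : E * j ≤ E * (L + (l + 2)) := mul_le_mul_of_nonneg_left (by omega) hE0.le
    linarith
  have hjA : j ≤ A := by
    refine le_of_mul_le_mul_left (hjE.trans ?_) hE0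
    rcases max_choice D 0 with h | h <;> rw [h] <;> linarith
  have hjC : (l + 2) * j ≤ C := by
    refine le_of_mul_le_mul_left (a := (l : ℤ)) ?_ (by omega)
    have h1 : (l : ℤ) * ((l + 2) * j) = E * j := by rw [hE]; ring
    rw [h1]
    refine hjE.trans ?_
    rcases max_choice D 0 with h | h <;> rw [h] <;> linarith
  have hi0 : 0 ≤ i := by
    by_contra! h
    nlinarith
  have hqM : C - (l + 2) * j ≤ 3 * (N - i - j) := by
    refine le_of_mul_le_mul_left (a := ((l : ℤ) + 3)) ?_ hm0
    rw [hD, hE, hij] at hDj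
    linarith
  lift j to ℕ using hj0
  lift i to ℕ using hi0
  obtain ⟨q, hq⟩ := Int.eq_ofNat_of_zero_le (sub_nonneg.2 hjC)
  obtain ⟨M, hM⟩ := Int.eq_ofNat_of_zero_le (show 0 ≤ N - i - j by omega)
  refine ⟨j, i, q, M, ?_, ?_, ?_, ?_⟩
  · zify; rw [← hA, hij]
  · zify; rw [← hC]; linarith
  · zify; rw [← hN]; linarith
  · zify; omega

/-- Multiplication by `(y₀ y₁ y₂) ^ (m ^ 3)` and `x₁ ^ (2m)` takes every monomial of degree `m * n`
in the `n`-th power of the ideal `(y₀, y₁ ^ (m - 3))` into the image. -/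
theorem monomial_mem_imagePart (l : ℕ) (hl : 3 ≤ l) {n a b c : ℕ}
    (hsum : a + b + c = (l + 3) * n) (hreg : l * n ≤ l * a + b) :
    X 0 ^ (a + ((l + 3) ^ 3 + 2 * (l + 3) * (l + 2))) * X 1 ^ (b + ((l + 3) ^ 3 + 2 * (l + 3))) *
      X 2 ^ (c + (l + 3) ^ 3) ∈ imagePart K (l + 3) (n + (3 * (l + 3) ^ 2 + 2 * (l + 3))) := by
  obtain ⟨j, i, q, M, h1, h2, h3, h4⟩ := exists_exponents l hl hsum hreg
  have h5 := edge_mem_imagePart (K := K) l M (b + ((l + 3) ^ 3 + 2 * (l + 3))) q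
    (by
      zify at *
      linear_combination hsum + (l + 3 : ℤ) * h3 - h1 - h2) (by omega)
  have h6 := forms_pow_mul_mem_imagePart 3 i (forms_pow_mul_mem_imagePart 4 j h5)
  have s3 : forms K (l + 3) 3 = X 0 ^ (l + 3) := rfl
  have s4 : forms K (l + 3) 4 = X 2 ^ (l + 2) * X 0 := rfl
  rw [s3, s4] at h6
  have h7 : a + ((l + 3) ^ 3 + 2 * (l + 3) * (l + 2)) =
      (l + 3) * i + j + 2 * (l + 3) * (l + 2) := by omega
  rw [h7, h2]
  generalize b + ((l + 3) ^ 3 + 2 * (l + 3)) = b' at *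
  generalize 2 * (l + 3) * (l + 2) = e at *
  refine imagePart_congr h6 (by ring) (by omega)

end Degree

section Degree

variable {K : Type*} [Field K]

/-- The exponents of the monomials of degree `(l + 3) * n` in the `n`-th power of the ideal
`(y₀, y₁ ^ l)`, which defines the base locus of the rational map for `m = l + 3`. -/
def region (l n : ℕ) : Set (Fin 3 →₀ ℕ) :=
  {d | d 0 + d 1 + d 2 = (l + 3) * n ∧ l * n ≤ l * d 0 + d 1}

/-- The exponent of `y₀ ^ a y₁ ^ b y₂ ^ c`. -/
noncomputable def expo (a b c : ℕ) : Fin 3 →₀ ℕ :=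
  Finsupp.equivFunOnFinite.symm ![a, b, c]

@[simp] theorem expo_zero (a b c : ℕ) : expo a b c 0 = a := rfl
@[simp] theorem expo_one (a b c : ℕ) : expo a b c 1 = b := rfl
@[simp] theorem expo_two (a b c : ℕ) : expo a b c 2 = c := rfl

theorem expo_eta (d : Fin 3 →₀ ℕ) : expo (d 0) (d 1) (d 2) = d := by
  ext i; fin_cases i <;> rfl

theorem monomial_expo (a b c : ℕ) :
    (monomial (expo a b c) 1 : MvPolynomial (Fin 3) K) = X 0 ^ a * X 1 ^ b * X 2 ^ c := by
  rw [monomial_eq, Finsupp.prod_fintype _ _ (by simp), Fin.prod_univ_three]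
  simp

theorem monomial_mem_restrictSupport_region {l n a b c : ℕ} (h : a + b + c = (l + 3) * n)
    (h' : l * n ≤ l * a + b) :
    X 0 ^ a * X 1 ^ b * X 2 ^ c ∈ restrictSupport K (region l n) := by
  rw [← monomial_expo, monomial_mem_restrictSupport]
  exact Or.inl ⟨h, h'⟩

theorem forms_mem_restrictSupport (l : ℕ) (i : Fin 5) :
    forms K (l + 3) i ∈ restrictSupport K (region l 1) := by
  have h := @monomial_mem_restrictSupport_region K _ l 1
  fin_cases i
  · convert h (a := 0) (b := l + 2) (c := 1) (by omega) (by omega) using 1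
    simp [forms]
  · convert h (a := l + 2) (b := 1) (c := 0) (by omega) (by nlinarith) using 1
    simp [forms]
  · convert add_mem (h (a := 0) (b := l + 3) (c := 0) (by omega) (by omega))
      (h (a := 0) (b := l) (c := 3) (by omega) (by omega)) using 1
    simp [forms]
  · convert h (a := l + 3) (b := 0) (c := 0) (by omega) (by nlinarith) using 1
    simp [forms]
  · convert h (a := 1) (b := 0) (c := l + 2) (by omega) (by omega) using 1
    simp [forms, mul_comm]

theorem restrictSupport_region_pow_le (l n : ℕ) :
    restrictSupport K (region l 1) ^ n ≤ restrictSupport K (region l n) := by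
  induction n with
  | zero =>
    rw [pow_zero, ← restrictSupport_zero]
    refine restrictSupport_mono K ?_
    rintro d rfl
    simp [region]
  | succ n ih =>
    rw [pow_succ]
    refine (mul_le_mul_left ih _).trans ?_
    rw [← restrictSupport_add]
    refine restrictSupport_mono K ?_
    rintro _ ⟨d, ⟨hd1, hd2⟩, d', ⟨hd1', hd2'⟩, rfl⟩
    constructor
    · simp only [Finsupp.add_apply]
      rw [mul_add (l + 3), ← hd1, ← hd1']; ring
    · simp only [Finsupp.add_apply]
      rw [mul_add l, mul_add l]
      omega

theorem imagePart_le_restrictSupport (l n : ℕ) :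
    imagePart K (l + 3) n ≤ restrictSupport K (region l n) := by
  refine le_trans ?_ (restrictSupport_region_pow_le l n)
  rw [imagePart, ← homogeneousSubmodule_one_pow, Submodule.map_pow]
  refine pow_le_pow_left' ?_ n
  rw [homogeneousSubmodule_one_eq_span_X, Submodule.map_span_le]
  rintro _ ⟨i, rfl⟩
  simpa using forms_mem_restrictSupport l i

/-- The set `region l n` as a finite set. -/
noncomputable def regionFinset (l n : ℕ) : Finset (Fin 3 →₀ ℕ) :=
  ((Finset.range ((l + 3) * n + 1)).sigma fun a =>
    Finset.Icc (l * (n - a)) ((l + 3) * n - a)).image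
      fun p => expo p.1 p.2 ((l + 3) * n - p.1 - p.2)

theorem coe_regionFinset (l n : ℕ) : (regionFinset l n : Set (Fin 3 →₀ ℕ)) = region l n := by
  ext d
  simp only [regionFinset, Finset.coe_image, Set.mem_image, Finset.mem_coe, Finset.mem_sigma,
    Finset.mem_range, Finset.mem_Icc, region, Set.mem_ofPred_eq]
  have key : ∀ a b : ℕ, l * (n - a) ≤ b ↔ l * n ≤ l * a + b := by
    intro a b
    rw [Nat.mul_sub, Nat.sub_le_iff_le_add']
  constructor
  · rintro ⟨⟨a, b⟩, ⟨h1, h2, h3⟩, rfl⟩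
    simp only [expo_zero, expo_one, expo_two] at *
    exact ⟨by omega, (key _ _).1 h2⟩
  · rintro ⟨h1, h2⟩
    refine ⟨⟨d 0, d 1⟩, ⟨by dsimp only; omega, (key _ _).2 h2, by dsimp only; omega⟩, ?_⟩
    simp only
    rw [← h1]
    have : d 0 + d 1 + d 2 - d 0 - d 1 = d 2 := by omega
    rw [this, expo_eta]

theorem sum_range_tsub (n N : ℕ) (h : n ≤ N) :
    2 * ∑ a ∈ Finset.range (N + 1), (n - a) = n * (n + 1) := by
  obtain ⟨k, rfl⟩ := Nat.exists_eq_add_of_le h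
  rw [show n + k + 1 = (n + 1) + k by ring, Finset.sum_range_add,
    Finset.sum_eq_zero (s := Finset.range k) (fun a _ => by omega), add_zero]
  have h1 := Finset.sum_range_reflect (fun a => a) (n + 1)
  simp only [Nat.add_sub_cancel] at h1
  rw [h1, mul_comm, Finset.sum_range_id_mul_two]
  simp [mul_comm]

theorem card_regionFinset (l n : ℕ) :
    2 * (regionFinset l n).card + l * (n * (n + 1)) =
      ((l + 3) * n + 1) * ((l + 3) * n + 2) := by
  have hN : n ≤ (l + 3) * n := Nat.le_mul_of_pos_left _ (by omega)
  have h1 : (regionFinset l n).card =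
      ∑ a ∈ Finset.range ((l + 3) * n + 1), ((l + 3) * n - a + 1 - l * (n - a)) := by
    rw [regionFinset, Finset.card_image_of_injective]
    · rw [Finset.card_sigma]
      exact Finset.sum_congr rfl fun a _ => Nat.card_Icc _ _
    · rintro ⟨a, b⟩ ⟨a', b'⟩ h
      obtain rfl : a = a' := DFunLike.congr_fun h 0
      obtain rfl : b = b' := DFunLike.congr_fun h 1
      rfl
  have h2 : (regionFinset l n).card + ∑ a ∈ Finset.range ((l + 3) * n + 1), l * (n - a) =
      ∑ a ∈ Finset.range ((l + 3) * n + 1), ((l + 3) * n + 1 - a) := by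
    rw [h1, ← Finset.sum_add_distrib]
    refine Finset.sum_congr rfl fun a ha => ?_
    rw [Finset.mem_range] at ha
    have : l * (n - a) ≤ (l + 3) * n - a := by
      by_cases han : a ≤ n
      · obtain ⟨k, rfl⟩ := Nat.exists_eq_add_of_le han
        rw [Nat.add_sub_cancel_left]
        apply Nat.le_sub_of_add_le
        nlinarith
      · rw [Nat.sub_eq_zero_of_le (by omega)]
        simp
    omega
  have h3 := sum_range_tsub n ((l + 3) * n) hN
  have h4 := sum_range_tsub ((l + 3) * n + 1) ((l + 3) * n + 1) le_rfl
  rw [Finset.sum_range_succ, Nat.sub_self, add_zero] at h4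
  rw [← Finset.mul_sum] at h2
  rw [← h4, ← h3, ← h2]
  ring

theorem finrank_restrictSupport_region (l n : ℕ) :
    Module.finrank K (restrictSupport K (region l n)) = (regionFinset l n).card := by
  rw [← coe_regionFinset, Module.finrank_eq_card_basis (basisRestrictSupport K _)]
  simp

instance restrictSupport_region_finite (l n : ℕ) :
    Module.Finite K (restrictSupport K (region l n)) := by
  rw [← coe_regionFinset]
  exact Module.Finite.of_basis (basisRestrictSupport K _)

theorem finrank_imagePart_le (l n : ℕ) :
    Module.finrank K (imagePart K (l + 3) n) ≤ (regionFinset l n).card := by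
  rw [← finrank_restrictSupport_region (K := K)]
  exact Submodule.finrank_mono (imagePart_le_restrictSupport l n)

theorem card_regionFinset_le (l : ℕ) (hl : 3 ≤ l) (n : ℕ) : (regionFinset l n).card ≤
    Module.finrank K (imagePart K (l + 3) (n + (3 * (l + 3) ^ 2 + 2 * (l + 3)))) := by
  let y : MvPolynomial (Fin 3) K := X 0 ^ ((l + 3) ^ 3 + 2 * (l + 3) * (l + 2)) *
    X 1 ^ ((l + 3) ^ 3 + 2 * (l + 3)) * X 2 ^ ((l + 3) ^ 3)
  have hy : y ≠ 0 := by
    simp only [y, ne_eq, mul_eq_zero, not_or]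
    exact ⟨⟨pow_ne_zero _ (X_ne_zero _), pow_ne_zero _ (X_ne_zero _)⟩, pow_ne_zero _ (X_ne_zero _)⟩
  have hinj : Function.Injective (LinearMap.mulRight K y) :=
    fun a b hab => mul_right_cancel₀ hy hab
  rw [← finrank_restrictSupport_region (K := K),
    (Submodule.equivMapOfInjective (LinearMap.mulRight K y) hinj _).finrank_eq]
  refine Submodule.finrank_mono ?_
  rw [restrictSupport_eq_span, Submodule.map_span_le]
  rintro _ ⟨d, ⟨hd1, hd2⟩, rfl⟩
  refine imagePart_congr (monomial_mem_imagePart l hl hd1 hd2) ?_ rfl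
  rw [← expo_eta d]
  simp only [monomial_expo, LinearMap.mulRight_apply, y, expo_zero, expo_one, expo_two, pow_add]
  ring

theorem coeff_taylor_of_natDegree_le {P : Polynomial ℚ} {d : ℕ} (h : P.natDegree ≤ d) (r : ℚ) :
    (Polynomial.taylor r P).coeff d = P.coeff d := by
  rcases h.eq_or_lt with rfl | h
  · exact Polynomial.coeff_taylor_natDegree _ _
  · rw [Polynomial.coeff_eq_zero_of_natDegree_lt h, Polynomial.coeff_eq_zero_of_natDegree_lt]
    rwa [Polynomial.natDegree_taylor]

/-- A polynomial squeezed between a quadratic polynomial and one of its translates has the same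
leading term. -/
theorem natDegree_eq_two_of_squeeze {P Q : Polynomial ℚ} {c : ℕ} {f g : ℕ → ℕ}
    (hP : ∀ᶠ t : ℕ in atTop, (f t : ℚ) = P.eval (t : ℚ)) (hQ : ∀ t : ℕ, (g t : ℚ) = Q.eval (t : ℚ))
    (h1 : ∀ t, f t ≤ g t) (h2 : ∀ t, g t ≤ f (t + c)) (hQd : Q.natDegree ≤ 2)
    (hQ2 : Q.coeff 2 ≠ 0) : P.natDegree = 2 ∧ P.leadingCoeff = Q.coeff 2 := by
  have hPd : P.natDegree ≤ 2 := by
    refine le_trans (natDegree_le_of_eventually_le (hP.mono fun t ht => ?_)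
      (hP.mono fun t ht => ?_)) hQd
    · rw [← ht]; positivity
    · rw [← ht, ← hQ]
      exact_mod_cast h1 t
  have h3 : 0 ≤ (Q - P).coeff 2 := by
    refine coeff_nonneg_of_eventually ((Polynomial.natDegree_sub_le _ _).trans (max_le hQd hPd))
      (hP.mono fun t ht => ?_)
    rw [Polynomial.eval_sub, ← ht, ← hQ, sub_nonneg]
    exact_mod_cast h1 t
  have h4 : 0 ≤ (Polynomial.taylor (c : ℚ) P - Q).coeff 2 := by
    refine coeff_nonneg_of_eventually ((Polynomial.natDegree_sub_le _ _).trans (max_le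
      (by rwa [Polynomial.natDegree_taylor]) hQd))
      (((tendsto_add_atTop_nat c).eventually hP).mono fun t ht => ?_)
    rw [Polynomial.eval_sub, Polynomial.taylor_eval, ← hQ, sub_nonneg]
    push_cast at ht
    rw [← ht]
    exact_mod_cast h2 t
  rw [Polynomial.coeff_sub] at h3 h4
  rw [coeff_taylor_of_natDegree_le hPd] at h4
  have h5 : P.coeff 2 = Q.coeff 2 := by linarith
  have h6 : P.natDegree = 2 := le_antisymm hPd (Polynomial.le_natDegree_of_ne_zero (h5 ▸ hQ2))
  exact ⟨h6, by rw [Polynomial.leadingCoeff, h6, h5]⟩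

theorem hilbertFun_surf [Infinite K] {m : ℕ} (hm : 6 ≤ m) (t : ℕ) :
    hilbertFun (homogIdeal (surf K m)) t = Module.finrank K (imagePart K m t) :=
  hilbertFun_eq_finrank_map _ _ _ fun _ hF => mem_homogIdeal_surf_iff hm hF

/-- The leading term of the Hilbert polynomial of the surface. -/
theorem hilbertPolynomial_surf [Infinite K] {m : ℕ} (hm : 6 ≤ m) {P : Polynomial ℚ}
    (hP : IsHilbertPolynomial (surf K m) P) :
    P.natDegree = 2 ∧ P.leadingCoeff = ((m : ℚ) ^ 2 - m + 3) / 2 := by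
  obtain ⟨l, rfl⟩ : ∃ l, m = l + 3 := ⟨m - 3, by omega⟩
  let Q : Polynomial ℚ := Polynomial.C ((((l : ℚ) + 3) ^ 2 - l) / 2) * Polynomial.X ^ 2 +
    Polynomial.C ((3 * ((l : ℚ) + 3) - l) / 2) * Polynomial.X + Polynomial.C 1
  have hQ2 : Q.coeff 2 = (((l : ℚ) + 3) ^ 2 - l) / 2 := by
    simp [Q, Polynomial.coeff_one]
  obtain ⟨h1, h2⟩ := natDegree_eq_two_of_squeeze hP (Q := Q) (g := fun n => (regionFinset l n).card)
    (fun t => by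
      have h := congrArg (Nat.cast (R := ℚ)) (card_regionFinset l t)
      push_cast at h
      simp only [Q, Polynomial.eval_add, Polynomial.eval_mul, Polynomial.eval_C,
        Polynomial.eval_pow, Polynomial.eval_X]
      linarith)
    (fun t => by rw [hilbertFun_surf hm]; exact finrank_imagePart_le l t)
    (fun t => by rw [hilbertFun_surf hm]; exact card_regionFinset_le l (by omega) t)
    (Polynomial.natDegree_quadratic_le)
    (by
      rw [hQ2]
      have : (0 : ℚ) ≤ l := by positivity
      have h : (0 : ℚ) < (((l : ℚ) + 3) ^ 2 - l) / 2 := by nlinarith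
      exact h.ne')
  refine ⟨h1, ?_⟩
  rw [h2, hQ2]
  push_cast
  ring

theorem topologicalKrullDim_surf [Infinite K] {m : ℕ} (hm : 6 ≤ m) :
    topologicalKrullDim (surf K m) = 2 := by
  obtain ⟨P, hP⟩ := exists_hilbertPolynomial (surf K m)
  have h := topologicalKrullDim_le_natDegree (isProjVariety_surf hm).1 hP
  rw [(hilbertPolynomial_surf hm hP).1] at h
  exact le_antisymm (by exact_mod_cast h) (two_le_topologicalKrullDim_surf hm)

theorem hasDegree_surf [Infinite K] {m : ℕ} (hm : 6 ≤ m) :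
    HasDegree (surf K m) (m ^ 2 - m + 3) := by
  obtain ⟨P, hP⟩ := exists_hilbertPolynomial (surf K m)
  refine ⟨2, P, topologicalKrullDim_surf hm, hP, ?_⟩
  rw [(hilbertPolynomial_surf hm hP).2]
  have h : m ≤ m ^ 2 := Nat.le_self_pow (by norm_num) m
  push_cast [Nat.cast_sub h]
  norm_num
  ring

end Degree

/-! ### The binomial matrices and linear relations between their rows -/

section Matrices

/-- The shift `ε` of the four families of binomial rows. -/
def blockEps : Fin 4 → ℕ := ![0, 2, 0, 0]

/-- The column of the leading entry of row `0` in the four families of binomial rows. -/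
def blockCol (k : ℕ) : Fin 4 → ℕ :=
  ![6 * k ^ 2 - k - 1, 18 * k ^ 2 - 9 * k, 18 * k ^ 2 - 7 * k, 30 * k ^ 2 - 13 * k + 1]

/-- The index of the last row of each of the four blocks of `matN`. -/
def blockLast (k : ℕ) : Fin 4 → ℕ := ![bOne k, bTwo k, bThree k, bFour k]

/-- The entries of the four blocks of `matN`. -/
def blockEntry (k : ℕ) (i : Fin 4) (u v : ℕ) : ℕ :=
  binomEntry (blockEps i) (blockCol k i) u v

theorem binomEntry_eq_zero {ε c u v : ℕ} (h : v + u < c ∨ c + 2 * u + ε < v) :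
    binomEntry ε c u v = 0 := by
  rw [binomEntry]
  split_ifs
  · exact Nat.choose_eq_zero_of_lt (by omega)
  · rfl

theorem binomEntry_first {ε c u v : ℕ} (h : v + u = c) : binomEntry ε c u v = 1 := by
  rw [binomEntry, if_pos h.ge, h, Nat.sub_self, Nat.choose_zero_right]

theorem binomEntry_last {ε c u v : ℕ} (h : c + 2 * u + ε = v) : binomEntry ε c u v = 1 := by
  rw [binomEntry, if_pos (by omega), show v + u - c = 3 * u + ε by omega, Nat.choose_self]

theorem binomEntry_add (ε c u v r : ℕ) :
    binomEntry ε (c + r) u (v + r) = binomEntry ε c u v := by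
  rw [binomEntry, binomEntry, show v + r + u - (c + r) = v + u - c by omega]
  exact if_congr (by omega) rfl rfl

/-- The block, and the row inside this block, of row `p` of a matrix that is stacked from four
blocks, of which the first three have `r₁`, `r₂`, `r₃` rows. -/
def stackIndex (r₁ r₂ r₃ p : ℕ) : Fin 4 × ℕ :=
  if p < r₁ then (0, p)
  else if p < r₁ + r₂ then (1, p - r₁)
  else if p < r₁ + r₂ + r₃ then (2, p - (r₁ + r₂))
  else (3, p - (r₁ + r₂ + r₃))

theorem stackEntry_eq (r₁ r₂ r₃ : ℕ) (f : Fin 4 → ℕ → ℕ → ℕ) (p v : ℕ) :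
    stackEntry r₁ r₂ r₃ (f 0) (f 1) (f 2) (f 3) p v =
      f (stackIndex r₁ r₂ r₃ p).1 (stackIndex r₁ r₂ r₃ p).2 v := by
  unfold stackEntry stackIndex
  split_ifs <;> rfl

theorem stackIndex_injective (r₁ r₂ r₃ : ℕ) : Function.Injective (stackIndex r₁ r₂ r₃) := by
  intro p q h
  unfold stackIndex at h
  split_ifs at h <;> simp only [Prod.mk.injEq] at h <;> omega

theorem stackIndex_lt (r : Fin 4 → ℕ) {p : ℕ} (hp : p < r 0 + r 1 + r 2 + r 3) :
    (stackIndex (r 0) (r 1) (r 2) p).2 < r (stackIndex (r 0) (r 1) (r 2) p).1 := by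
  unfold stackIndex
  split_ifs <;> dsimp only <;> omega

theorem exists_stackIndex (r : Fin 4 → ℕ) {i : Fin 4} {u : ℕ} (hu : u < r i) :
    ∃ p < r 0 + r 1 + r 2 + r 3, stackIndex (r 0) (r 1) (r 2) p = (i, u) := by
  fin_cases i <;> simp only [Fin.zero_eta, Fin.mk_one, Fin.reduceFinMk] at hu ⊢
  · refine ⟨u, by omega, ?_⟩
    rw [stackIndex, if_pos hu]
  · refine ⟨r 0 + u, by omega, ?_⟩
    rw [stackIndex, if_neg (by omega), if_pos (by omega), Nat.add_sub_cancel_left]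
  · refine ⟨r 0 + r 1 + u, by omega, ?_⟩
    rw [stackIndex, if_neg (by omega), if_neg (by omega), if_pos (by omega),
      Nat.add_sub_cancel_left]
  · refine ⟨r 0 + r 1 + r 2 + u, by omega, ?_⟩
    rw [stackIndex, if_neg (by omega), if_neg (by omega), if_neg (by omega),
      Nat.add_sub_cancel_left]

theorem sum_stackIndex {A : Type*} [AddCommMonoid A] (r : Fin 4 → ℕ) (H : Fin 4 → ℕ → A) :
    ∑ p ∈ Finset.range (r 0 + r 1 + r 2 + r 3), H (stackIndex (r 0) (r 1) (r 2) p).1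
      (stackIndex (r 0) (r 1) (r 2) p).2 = ∑ i, ∑ u ∈ Finset.range (r i), H i u := by
  rw [Finset.sum_sigma']
  refine Finset.sum_nbij (fun p => ⟨(stackIndex (r 0) (r 1) (r 2) p).1,
    (stackIndex (r 0) (r 1) (r 2) p).2⟩) (fun p hp => ?_) (fun p _ q _ h => ?_) ?_ fun p _ => rfl
  · simpa using stackIndex_lt r (Finset.mem_range.1 hp)
  · simp only [Sigma.mk.injEq, heq_eq_eq] at h
    exact stackIndex_injective _ _ _ (Prod.ext h.1 h.2)
  · rintro ⟨i, u⟩ hu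
    obtain ⟨p, hp, hpi⟩ := exists_stackIndex r (i := i) (u := u) (by simpa using hu)
    exact ⟨p, by simpa using hp, by simp only [hpi]⟩

variable {K : Type*} [Field K]

theorem matN_apply (k : ℕ) (p : Fin (54 * k ^ 2 - 27 * k + 4)) (v : Fin (54 * k ^ 2 - 27 * k + 3)) :
    matN K k p v = (blockEntry k
      (stackIndex (blockLast k 0 + 1) (blockLast k 1 + 1) (blockLast k 2 + 1) p).1
      (stackIndex (blockLast k 0 + 1) (blockLast k 1 + 1) (blockLast k 2 + 1) p).2 v : K) :=
  congrArg Nat.cast (stackEntry_eq _ _ _ (blockEntry k) _ _)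

theorem matW_apply (k : ℕ) (p v : Fin (54 * k ^ 2 - 27 * k)) :
    matW K k p v = (blockEntry k
      (stackIndex (blockLast k 0) (blockLast k 1) (blockLast k 2) p).1
      (stackIndex (blockLast k 0) (blockLast k 1) (blockLast k 2) p).2 (v + 1) : K) :=
  congrArg Nat.cast (stackEntry_eq _ _ _ (blockEntry k) _ _)

/-- In a column where all other rows have a zero entry or a zero coefficient, a row with entry `1`
has coefficient zero. -/
theorem eq_zero_of_sum_eq_zero {b : Fin 4 → ℕ} {g e : Fin 4 → ℕ → K}
    (h : ∑ i, ∑ u ∈ Finset.range (b i), g i u * e i u = 0) (i₀ : Fin 4) (u₀ : ℕ) (hu : u₀ < b i₀)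
    (he : e i₀ u₀ = 1)
    (h0 : ∀ i u, u < b i → (i = i₀ → u ≠ u₀) → g i u = 0 ∨ e i u = 0) : g i₀ u₀ = 0 := by
  rw [Finset.sum_eq_single i₀, Finset.sum_eq_single u₀, he, mul_one] at h
  · exact h
  · intro u hu hne
    exact mul_eq_zero.2 (h0 i₀ u (Finset.mem_range.1 hu) fun _ => hne)
  · exact fun h => absurd (Finset.mem_range.2 hu) h
  · intro i _ hne
    exact Finset.sum_eq_zero fun u hu =>
      mul_eq_zero.2 (h0 i u (Finset.mem_range.1 hu) fun h => absurd h hne)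
  · exact fun h => absurd (Finset.mem_univ _) h

theorem self_le_sq (k : ℕ) : k ≤ k ^ 2 := Nat.le_self_pow (by norm_num) k

theorem sum_blockLast {k : ℕ} (hk : 1 ≤ k) :
    blockLast k 0 + blockLast k 1 + blockLast k 2 + blockLast k 3 = 54 * k ^ 2 - 27 * k := by
  have := self_le_sq k
  simp only [blockLast, bOne, bTwo, bThree, bFour, Matrix.cons_val]
  omega

theorem vecMul_matN {k : ℕ} (hk : 1 ≤ k) (g : Fin 4 → ℕ → K) (v : Fin (54 * k ^ 2 - 27 * k + 3)) :
    Matrix.vecMul (fun p : Fin (54 * k ^ 2 - 27 * k + 4) => g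
      (stackIndex (blockLast k 0 + 1) (blockLast k 1 + 1) (blockLast k 2 + 1) p).1
      (stackIndex (blockLast k 0 + 1) (blockLast k 1 + 1) (blockLast k 2 + 1) p).2) (matN K k) v =
    ∑ i, ∑ u ∈ Finset.range (blockLast k i + 1), g i u * (blockEntry k i u v : K) := by
  have h := sum_blockLast hk
  rw [← sum_stackIndex (fun i => blockLast k i + 1) fun i u => g i u * (blockEntry k i u v : K),
    show blockLast k 0 + 1 + (blockLast k 1 + 1) + (blockLast k 2 + 1) + (blockLast k 3 + 1) =
      54 * k ^ 2 - 27 * k + 4 by omega, ← Fin.sum_univ_eq_sum_range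
      (fun p => g (stackIndex (blockLast k 0 + 1) (blockLast k 1 + 1) (blockLast k 2 + 1) p).1
      (stackIndex (blockLast k 0 + 1) (blockLast k 1 + 1) (blockLast k 2 + 1) p).2 *
      (blockEntry k (stackIndex (blockLast k 0 + 1) (blockLast k 1 + 1) (blockLast k 2 + 1) p).1
      (stackIndex (blockLast k 0 + 1) (blockLast k 1 + 1) (blockLast k 2 + 1) p).2 v : K))]
  simp only [Matrix.vecMul, dotProduct, matN_apply]

/-- If `matL` is invertible, then a linear relation between the rows of `matN` that does not
involve the first row is trivial. -/
theorem eq_zero_of_isUnit_matL {k : ℕ} (hk : 1 ≤ k) (hL : IsUnit (matL K k)) {g : Fin 4 → ℕ → K}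
    (hg : ∀ v < 54 * k ^ 2 - 27 * k + 3,
      ∑ i, ∑ u ∈ Finset.range (blockLast k i + 1), g i u * (blockEntry k i u v : K) = 0)
    (h0 : g 0 0 = 0) {i : Fin 4} {u : ℕ} (hu : u < blockLast k i + 1) : g i u = 0 := by
  let w : Fin (54 * k ^ 2 - 27 * k + 4) → K := fun p => g
      (stackIndex (blockLast k 0 + 1) (blockLast k 1 + 1) (blockLast k 2 + 1) p).1
      (stackIndex (blockLast k 0 + 1) (blockLast k 1 + 1) (blockLast k 2 + 1) p).2
  have hw : Matrix.vecMul w (matN K k) = 0 := funext fun v => by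
    rw [vecMul_matN hk]
    exact hg v v.2
  have hw0 : w 0 = 0 := h0
  have hL' : Matrix.vecMul (fun p : Fin (54 * k ^ 2 - 27 * k + 3) => w p.succ) (matL K k) = 0 := by
    funext v
    have := congrFun hw v
    rw [Matrix.vecMul, dotProduct, Fin.sum_univ_succ, hw0, zero_mul, zero_add] at this
    exact this
  have hws : (fun p : Fin (54 * k ^ 2 - 27 * k + 3) => w p.succ) = 0 :=
    Matrix.vecMul_injective_iff_isUnit.2 hL (hL'.trans (Matrix.zero_vecMul _).symm)
  have hw1 : ∀ p, w p = 0 := by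
    intro p
    refine Fin.cases hw0 (fun q => congrFun hws q) p
  obtain ⟨p, hp, hpi⟩ := exists_stackIndex (fun i => blockLast k i + 1) hu
  have h := sum_blockLast hk
  have := hw1 ⟨p, by omega⟩
  simpa only [w, hpi] using this

/-- If `matW` is invertible, then a linear relation between the rows of `matN` that does not
involve the last row of the second block is trivial. -/
theorem eq_zero_of_isUnit_matW {k : ℕ} (hk : 1 ≤ k) (hW : IsUnit (matW K k)) {g : Fin 4 → ℕ → K}
    (hg : ∀ v < 54 * k ^ 2 - 27 * k + 3,
      ∑ i, ∑ u ∈ Finset.range (blockLast k i + 1), g i u * (blockEntry k i u v : K) = 0)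
    (h1 : g 1 (bTwo k) = 0) {i : Fin 4} {u : ℕ} (hu : u < blockLast k i + 1) : g i u = 0 := by
  have hq := self_le_sq k
  have hsum := sum_blockLast hk
  -- The first column meets the last rows of the first two blocks only, and the last two columns
  -- meet the last rows of the blocks 2 and 3, respectively of the blocks 3 and 4, only.
  have hb0 : g 0 (bOne k) = 0 := by
    refine eq_zero_of_sum_eq_zero (hg 0 (by omega)) 0 (bOne k) (Nat.lt_succ_self _) ?_ ?_
    · rw [blockEntry, binomEntry_first, Nat.cast_one]
      simp [blockCol, bOne]
    · intro i u hu hne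
      rw [← Nat.cast_zero, blockEntry]
      fin_cases i
      · exact Or.inr (congrArg _ (binomEntry_eq_zero (Or.inl (by
          simp [blockCol, blockLast, bOne] at hu hne ⊢; omega))))
      · by_cases h : u = bTwo k
        · exact Or.inl (by rw [Nat.cast_zero, h]; exact h1)
        · exact Or.inr (congrArg _ (binomEntry_eq_zero (Or.inl (by
            simp [blockCol, blockLast, bTwo] at hu h ⊢; omega))))
      · exact Or.inr (congrArg _ (binomEntry_eq_zero (Or.inl (by
          simp [blockCol, blockLast, bThree] at hu ⊢; omega))))
      · exact Or.inr (congrArg _ (binomEntry_eq_zero (Or.inl (by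
          simp [blockCol, blockLast, bFour] at hu ⊢; omega))))
  have hb2 : g 2 (bThree k) = 0 := by
    refine eq_zero_of_sum_eq_zero (hg (54 * k ^ 2 - 27 * k + 2) (by omega)) 2 (bThree k)
      (Nat.lt_succ_self _) ?_ ?_
    · rw [blockEntry, binomEntry_last, Nat.cast_one]
      simp [blockCol, bThree, blockEps]
      omega
    · intro i u hu hne
      rw [← Nat.cast_zero, blockEntry]
      fin_cases i
      · exact Or.inr (congrArg _ (binomEntry_eq_zero (Or.inr (by
          simp [blockEps, blockCol, blockLast, bOne] at hu ⊢; omega))))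
      · by_cases h : u = bTwo k
        · exact Or.inl (by rw [Nat.cast_zero, h]; exact h1)
        · exact Or.inr (congrArg _ (binomEntry_eq_zero (Or.inr (by
            simp [blockEps, blockCol, blockLast, bTwo] at hu h ⊢; omega))))
      · exact Or.inr (congrArg _ (binomEntry_eq_zero (Or.inr (by
          simp [blockEps, blockCol, blockLast, bThree] at hu hne ⊢; omega))))
      · exact Or.inr (congrArg _ (binomEntry_eq_zero (Or.inr (by
          simp [blockEps, blockCol, blockLast, bFour] at hu ⊢; omega))))
  have hb3 : g 3 (bFour k) = 0 := by
    refine eq_zero_of_sum_eq_zero (hg (54 * k ^ 2 - 27 * k + 1) (by omega)) 3 (bFour k)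
      (Nat.lt_succ_self _) ?_ ?_
    · rw [blockEntry, binomEntry_last, Nat.cast_one]
      simp [blockCol, bFour, blockEps]
      omega
    · intro i u hu hne
      rw [← Nat.cast_zero, blockEntry]
      fin_cases i
      · exact Or.inr (congrArg _ (binomEntry_eq_zero (Or.inr (by
          simp [blockEps, blockCol, blockLast, bOne] at hu ⊢; omega))))
      · by_cases h : u = bTwo k
        · exact Or.inl (by rw [Nat.cast_zero, h]; exact h1)
        · exact Or.inr (congrArg _ (binomEntry_eq_zero (Or.inr (by
            simp [blockEps, blockCol, blockLast, bTwo] at hu h ⊢; omega))))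
      · by_cases h : u = bThree k
        · exact Or.inl (by rw [Nat.cast_zero, h]; exact hb2)
        · exact Or.inr (congrArg _ (binomEntry_eq_zero (Or.inr (by
            simp [blockEps, blockCol, blockLast, bThree] at hu h ⊢; omega))))
      · exact Or.inr (congrArg _ (binomEntry_eq_zero (Or.inr (by
          simp [blockEps, blockCol, blockLast, bFour] at hu hne ⊢; omega))))
  have hlast : ∀ i, g i (blockLast k i) = 0 := by
    intro i
    fin_cases i
    exacts [hb0, h1, hb2, hb3]
  let w : Fin (54 * k ^ 2 - 27 * k) → K := fun p => g
      (stackIndex (blockLast k 0) (blockLast k 1) (blockLast k 2) p).1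
      (stackIndex (blockLast k 0) (blockLast k 1) (blockLast k 2) p).2
  have hw : Matrix.vecMul w (matW K k) = 0 := funext fun v => by
    have h := hg (v + 1) (by omega)
    simp only [Finset.sum_range_succ, hlast, zero_mul, add_zero] at h
    rw [← sum_stackIndex (blockLast k) fun i u => g i u * (blockEntry k i u (v + 1) : K),
      hsum, ← Fin.sum_univ_eq_sum_range
      (fun p => g (stackIndex (blockLast k 0) (blockLast k 1) (blockLast k 2) p).1
      (stackIndex (blockLast k 0) (blockLast k 1) (blockLast k 2) p).2 *
      (blockEntry k (stackIndex (blockLast k 0) (blockLast k 1) (blockLast k 2) p).1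
      (stackIndex (blockLast k 0) (blockLast k 1) (blockLast k 2) p).2 (v + 1) : K))] at h
    simp only [Matrix.vecMul, dotProduct, matW_apply]
    exact h
  have hw0 : w = 0 :=
    Matrix.vecMul_injective_iff_isUnit.2 hW (hw.trans (Matrix.zero_vecMul _).symm)
  rcases (Nat.lt_succ_iff.1 hu).eq_or_lt with rfl | hu'
  · exact hlast i
  · obtain ⟨p, hp, hpi⟩ := exists_stackIndex (blockLast k) hu'
    have : w ⟨p, by omega⟩ = 0 := congrFun hw0 _
    simpa only [w, hpi] using this

end Matrices

/-! ### The full linear system in a multidegree -/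

section Elimination

variable {K : Type*} [Field K]

/-- The largest row indices in the four blocks of exponents of a given multidegree, see
`blockExp`. -/
def blockMax (k : ℕ) : Fin 4 → ℕ :=
  ![18 * k ^ 2 - 7 * k - 1, 18 * k ^ 2 - 9 * k, 18 * k ^ 2 - 9 * k, 18 * k ^ 2 - 11 * k + 1]

/-- The number by which the columns of `matN` are shifted in the linear system that describes the
equations of a given multidegree. -/
def colShift (k : ℕ) : ℕ := 12 * k ^ 2 - 6 * k

/-- The coefficients of the full linear system: the entries of `matN` with columns shifted by
`colShift k`, with more rows in each block and with further columns on both sides. -/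
def fullEntry (k : ℕ) (i : Fin 4) (u n : ℕ) : ℕ :=
  binomEntry (blockEps i) (blockCol k i + colShift k) u n

theorem fullEntry_add (k : ℕ) (i : Fin 4) (u v : ℕ) :
    fullEntry k i u (v + colShift k) = blockEntry k i u v :=
  binomEntry_add _ _ _ _ _

theorem blockLast_le_blockMax {k : ℕ} (hk : 1 ≤ k) (i : Fin 4) : blockLast k i ≤ blockMax k i := by
  have := self_le_sq k
  fin_cases i <;> simp [blockLast, blockMax, bOne, bTwo, bThree, bFour] <;> omega

/-- The coefficients `g i u` satisfy the full linear system. The bound on `n` covers all columns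
that are met: the last row of the last block ends in column `78 k² - 41 k + 3`. -/
def IsRelation (k : ℕ) (g : Fin 4 → ℕ → K) : Prop :=
  ∀ n < 78 * k ^ 2 - 41 * k + 4,
    ∑ i, ∑ u ∈ Finset.range (blockMax k i + 1), g i u * (fullEntry k i u n : K) = 0

/-- The columns below `colShift k` meet only the rows of the first block. -/
theorem IsRelation.first_eq_zero {k : ℕ} (hk : 1 ≤ k) {g : Fin 4 → ℕ → K} (hg : IsRelation k g)
    {u : ℕ} (hu : bOne k < u) (hu' : u ≤ blockMax k 0) : g 0 u = 0 := by
  have hq := self_le_sq k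
  obtain ⟨t, ht⟩ : ∃ t, u + t = blockMax k 0 := ⟨_, Nat.add_sub_cancel' hu'⟩
  induction t using Nat.strong_induction_on generalizing u with
  | _ t ih =>
    simp only [blockMax, bOne, Matrix.cons_val] at hu hu' ht
    refine eq_zero_of_sum_eq_zero (hg t (by omega)) 0 u (by simp [blockMax]; omega) ?_ ?_
    · rw [fullEntry, binomEntry_first, Nat.cast_one]
      simp [blockCol, colShift]
      omega
    · intro i u' hu'' hne
      rw [← Nat.cast_zero, fullEntry]
      fin_cases i
      · simp only [Fin.zero_eta, forall_const] at hne
        rcases hne.lt_or_gt with h | h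
        · exact Or.inr (congrArg _ (binomEntry_eq_zero (Or.inl (by
            simp [blockCol, colShift] at h ⊢; omega))))
        · simp [blockMax] at hu''
          refine Or.inl ((ih (blockMax k 0 - u') ?_ ?_ ?_ ?_).trans Nat.cast_zero.symm) <;>
          simp [blockMax, bOne] <;> omega
      all_goals exact Or.inr (congrArg _ (binomEntry_eq_zero (Or.inl (by
            simp [blockCol, colShift, blockMax] at hu'' ⊢; omega))))

/-- The relations involve only rows of `matN`. Once the additional rows of the first block are
eliminated, the rows that reach beyond the last column of `matN` belong to the third and the fourth
block. They end in columns of different parity for the two blocks, so in pairwise different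
columns, and are eliminated from right to left. -/
theorem IsRelation.eq_zero_of_lt {k : ℕ} (hk : 1 ≤ k) {g : Fin 4 → ℕ → K} (hg : IsRelation k g)
    {i : Fin 4} {u : ℕ} (hu : blockLast k i < u) (hu' : u ≤ blockMax k i) : g i u = 0 := by
  have hq := self_le_sq k
  have main : ∀ t n, n + t = 78 * k ^ 2 - 41 * k + 3 → 54 * k ^ 2 - 27 * k + 2 + colShift k < n →
      (∀ u, u ≤ blockMax k 2 → blockCol k 2 + colShift k + 2 * u = n → g 2 u = 0) ∧
      (∀ u, u ≤ blockMax k 3 → blockCol k 3 + colShift k + 2 * u = n → g 3 u = 0) := by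
    intro t
    induction t using Nat.strong_induction_on with
    | _ t ih =>
      intro n hnt hn
      have hvan : ∀ i u', u' < blockMax k i + 1 → blockCol k i + colShift k + 2 * u' ≠ n →
          g i u' = 0 ∨ (fullEntry k i u' n : K) = 0 := by
        intro i u' hu' hne
        rw [← Nat.cast_zero, fullEntry]
        rcases lt_or_ge (blockCol k i + colShift k + 2 * u' + blockEps i) n with h | h
        · exact Or.inr (congrArg _ (binomEntry_eq_zero (Or.inr h)))
        rw [Nat.cast_zero]
        fin_cases i
        · simp [blockCol, blockEps, colShift, blockMax] at h hn hu' hne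
          exact Or.inl (hg.first_eq_zero hk (by simp [bOne]; omega) (by simp [blockMax]; omega))
        · simp [blockCol, blockEps, colShift, blockMax] at h hn hu' hne
          omega
        · simp [blockCol, blockEps, colShift, blockMax] at h hn hu' hne
          refine Or.inl ((ih (78 * k ^ 2 - 41 * k + 3 - (blockCol k 2 + colShift k + 2 * u')) ?_ _ ?_ ?_).1 u' ?_
            rfl) <;> simp [blockCol, colShift, blockMax] <;> omega
        · simp [blockCol, blockEps, colShift, blockMax] at h hn hu' hne
          refine Or.inl ((ih (78 * k ^ 2 - 41 * k + 3 - (blockCol k 3 + colShift k + 2 * u')) ?_ _ ?_ ?_).2 u' ?_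
            rfl) <;> simp [blockCol, colShift, blockMax] <;> omega
      constructor
      · intro u hu hun
        refine eq_zero_of_sum_eq_zero (hg n ?_) 2 u (Nat.lt_succ_of_le hu) ?_ ?_
        · simp [blockCol, colShift, blockMax] at hu hun; omega
        · rw [fullEntry, binomEntry_last, Nat.cast_one]
          exact hun
        · intro i u' hu' hne
          by_cases h : blockCol k i + colShift k + 2 * u' = n
          · fin_cases i
            · simp [blockCol, colShift, blockMax] at h hn hu'
              exact Or.inl (hg.first_eq_zero hk (by simp [bOne]; omega) (by simp [blockMax]; omega))
            · simp [blockCol, colShift, blockMax] at h hn hu hun hu' hne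
              omega
            · simp [blockCol, colShift, blockMax] at h hn hu hun hu' hne
              omega
            · simp [blockCol, colShift, blockMax] at h hn hu hun hu' hne
              omega
          · exact hvan i u' hu' h
      · intro u hu hun
        refine eq_zero_of_sum_eq_zero (hg n ?_) 3 u (Nat.lt_succ_of_le hu) ?_ ?_
        · simp [blockCol, colShift, blockMax] at hu hun; omega
        · rw [fullEntry, binomEntry_last, Nat.cast_one]
          exact hun
        · intro i u' hu' hne
          by_cases h : blockCol k i + colShift k + 2 * u' = n
          · fin_cases i
            · simp [blockCol, colShift, blockMax] at h hn hu'
              exact Or.inl (hg.first_eq_zero hk (by simp [bOne]; omega) (by simp [blockMax]; omega))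
            · simp [blockCol, colShift, blockMax] at h hn hu hun hu' hne
              omega
            · simp [blockCol, colShift, blockMax] at h hn hu hun hu' hne
              omega
            · simp [blockCol, colShift, blockMax] at h hn hu hun hu' hne
              omega
          · exact hvan i u' hu' h
  fin_cases i
  · exact hg.first_eq_zero hk hu hu'
  · simp [blockLast, blockMax, bTwo] at hu hu'
    omega
  · refine (main (78 * k ^ 2 - 41 * k + 3 - (blockCol k 2 + colShift k + 2 * u)) _ ?_ ?_).1 u hu' rfl
    all_goals simp [blockLast, blockMax, bThree, blockCol, colShift] at hu hu' ⊢; omega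
  · refine (main (78 * k ^ 2 - 41 * k + 3 - (blockCol k 3 + colShift k + 2 * u)) _ ?_ ?_).2 u hu' rfl
    all_goals simp [blockLast, blockMax, bFour, blockCol, colShift] at hu hu' ⊢; omega

/-- A relation satisfies the linear system with matrix `matN`. -/
theorem IsRelation.sum_blockEntry {k : ℕ} (hk : 1 ≤ k) {g : Fin 4 → ℕ → K} (hg : IsRelation k g)
    {v : ℕ} (hv : v < 54 * k ^ 2 - 27 * k + 3) :
    ∑ i, ∑ u ∈ Finset.range (blockLast k i + 1), g i u * (blockEntry k i u v : K) = 0 := by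
  have hq := self_le_sq k
  rw [← hg (v + colShift k) (by simp only [colShift]; omega)]
  refine Finset.sum_congr rfl fun i _ => ?_
  simp only [fullEntry_add]
  refine Finset.sum_subset (Finset.range_subset_range.2
    (Nat.succ_le_succ (blockLast_le_blockMax hk i))) fun u hu hu' => ?_
  rw [Finset.mem_range] at hu hu'
  rw [hg.eq_zero_of_lt hk (by omega) (by omega), zero_mul]

theorem IsRelation.eq_zero_of_isUnit_matL {k : ℕ} (hk : 1 ≤ k) (hL : IsUnit (matL K k))
    {g : Fin 4 → ℕ → K} (hg : IsRelation k g) (h0 : g 0 0 = 0) {i : Fin 4} {u : ℕ}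
    (hu : u ≤ blockLast k i) : g i u = 0 :=
  EG.eq_zero_of_isUnit_matL hk hL (fun _ hv => hg.sum_blockEntry hk hv) h0 (Nat.lt_succ_of_le hu)

theorem IsRelation.eq_zero_of_isUnit_matW {k : ℕ} (hk : 1 ≤ k) (hW : IsUnit (matW K k))
    {g : Fin 4 → ℕ → K} (hg : IsRelation k g) (h1 : g 1 (bTwo k) = 0) {i : Fin 4} {u : ℕ}
    (hu : u ≤ blockLast k i) : g i u = 0 :=
  EG.eq_zero_of_isUnit_matW hk hW (fun _ hv => hg.sum_blockEntry hk hv) h1 (Nat.lt_succ_of_le hu)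

end Elimination

/-! ### An equation of the surface that is not generated in lower degree -/

section Multidegree

variable {K : Type*} [Field K]

/-- The exponent of `x₀ ^ a₀ ⋯ x₄ ^ a₄`. -/
noncomputable def expo5 (a₀ a₁ a₂ a₃ a₄ : ℕ) : Fin 5 →₀ ℕ :=
  Finsupp.equivFunOnFinite.symm ![a₀, a₁, a₂, a₃, a₄]

@[simp] theorem expo5_zero (a₀ a₁ a₂ a₃ a₄ : ℕ) : expo5 a₀ a₁ a₂ a₃ a₄ 0 = a₀ := rfl
@[simp] theorem expo5_one (a₀ a₁ a₂ a₃ a₄ : ℕ) : expo5 a₀ a₁ a₂ a₃ a₄ 1 = a₁ := rfl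
@[simp] theorem expo5_two (a₀ a₁ a₂ a₃ a₄ : ℕ) : expo5 a₀ a₁ a₂ a₃ a₄ 2 = a₂ := rfl
@[simp] theorem expo5_three (a₀ a₁ a₂ a₃ a₄ : ℕ) : expo5 a₀ a₁ a₂ a₃ a₄ 3 = a₃ := rfl
@[simp] theorem expo5_four (a₀ a₁ a₂ a₃ a₄ : ℕ) : expo5 a₀ a₁ a₂ a₃ a₄ 4 = a₄ := rfl

theorem expo5_eta (s : Fin 5 →₀ ℕ) : expo5 (s 0) (s 1) (s 2) (s 3) (s 4) = s := by
  ext i; fin_cases i <;> rfl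

/-- The degree in `y₀` of the image of the monomial with exponent `s`. -/
def firstDeg (m : ℕ) (s : Fin 5 →₀ ℕ) : ℕ := (m - 1) * s 1 + m * s 3 + s 4

/-- The smallest degree in `y₂` of a term of the image of the monomial with exponent `s`. -/
def lastDeg (m : ℕ) (s : Fin 5 →₀ ℕ) : ℕ := s 0 + (m - 1) * s 4

/-- The smallest degree in `y₁` of a term of the image of the monomial with exponent `s`. -/
def midDeg (m : ℕ) (s : Fin 5 →₀ ℕ) : ℕ := (m - 1) * s 0 + s 1 + (m - 3) * s 2

theorem firstDeg_add {m : ℕ} (hm : 6 ≤ m) (s : Fin 5 →₀ ℕ) :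
    firstDeg m s + midDeg m s + 3 * s 2 + lastDeg m s = m * (s 0 + s 1 + s 2 + s 3 + s 4) := by
  obtain ⟨l, rfl⟩ : ∃ l, m = l + 3 := ⟨m - 3, by omega⟩
  simp only [firstDeg, midDeg, lastDeg, Nat.add_sub_cancel, show l + 3 - 1 = l + 2 by omega]
  ring

theorem aeval_forms_monomial {m : ℕ} (hm : 6 ≤ m) (s : Fin 5 →₀ ℕ) :
    aeval (forms K m) (monomial s (1 : K)) = ∑ j ∈ Finset.range (s 2 + 1),
      monomial (expo (firstDeg m s) (midDeg m s + 3 * (s 2 - j)) (lastDeg m s + 3 * j))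
        ((s 2).choose j : K) := by
  rw [aeval_monomial, map_one, one_mul, Finsupp.prod_fintype _ _ (by simp), Fin.prod_univ_five]
  have h2 : forms K m 2 = X 1 ^ (m - 3) * (X 2 ^ 3 + X 1 ^ 3) := by
    change X 1 ^ m + X 1 ^ (m - 3) * X 2 ^ 3 = _
    rw [mul_add, ← pow_add, Nat.sub_add_cancel (by omega), add_comm]
  rw [h2]
  simp only [forms, Matrix.cons_val]
  rw [mul_pow _ (_ + _), add_pow, Finset.mul_sum, Finset.mul_sum, Finset.sum_mul, Finset.sum_mul]
  refine Finset.sum_congr rfl fun j _ => ?_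
  rw [← mul_one ((s 2).choose j : K), ← C_mul_monomial, monomial_expo, firstDeg, midDeg, lastDeg,
    map_natCast]
  simp only [pow_add, pow_mul, mul_pow]
  ring

theorem coeff_aeval_forms {m : ℕ} (hm : 6 ≤ m) (s : Fin 5 →₀ ℕ) {j : ℕ} (hj : j ≤ s 2) :
    coeff (expo (firstDeg m s) (midDeg m s + 3 * (s 2 - j)) (lastDeg m s + 3 * j))
      (aeval (forms K m) (monomial s (1 : K))) = ((s 2).choose j : K) := by
  rw [aeval_forms_monomial hm, coeff_sum, Finset.sum_eq_single j]
  · rw [coeff_monomial, if_pos rfl]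
  · intro i _ hij
    rw [coeff_monomial, if_neg]
    intro h
    have := DFunLike.congr_fun h 2
    simp only [expo_two] at this
    omega
  · intro h
    exact absurd (Finset.mem_range.2 (by omega)) h

theorem exists_of_coeff_aeval_forms_ne_zero {m : ℕ} (hm : 6 ≤ m) {s : Fin 5 →₀ ℕ}
    {d : Fin 3 →₀ ℕ} (h : coeff d (aeval (forms K m) (monomial s (1 : K))) ≠ 0) :
    ∃ j ≤ s 2, d = expo (firstDeg m s) (midDeg m s + 3 * (s 2 - j)) (lastDeg m s + 3 * j) := by
  rw [aeval_forms_monomial hm, coeff_sum] at h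
  obtain ⟨j, hj, hne⟩ := Finset.exists_ne_zero_of_sum_ne_zero h
  refine ⟨j, Nat.lt_succ_iff.1 (Finset.mem_range.1 hj), ?_⟩
  by_contra hd
  rw [coeff_monomial, if_neg (Ne.symm hd)] at hne
  exact hne rfl

/-- The degree of the equation `exists_equation_not_mem`; it equals `3/2 m² - 7/2 m + 1` for
`m = 6 k`. -/
def genDeg (k : ℕ) : ℕ := 54 * k ^ 2 - 21 * k + 1

/-- The exponents, in four blocks, of the monomials of degree `genDeg k` in `x₀, …, x₄` whose image
has degree `12 k - 2` in `y₀` and degree `2` modulo `3` in `y₂`, for `m = 6 k`. -/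
noncomputable def blockExp (k : ℕ) (i : Fin 4) (u : ℕ) : Fin 5 →₀ ℕ :=
  expo5 (![54 * k ^ 2 - 21 * k - 1, 54 * k ^ 2 - 27 * k, 54 * k ^ 2 - 27 * k + 1,
      54 * k ^ 2 - 33 * k + 3] i - 3 * u)
    (![2, 0, 1, 0] i) (3 * u + blockEps i) (![0, 1, 0, 0] i)
    (![0, 6 * k - 2, 6 * k - 1, 12 * k - 2] i)

theorem blockExp_injective {k : ℕ} {i i' : Fin 4} {u u' : ℕ}
    (h : blockExp k i u = blockExp k i' u') : i = i' ∧ u = u' := by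
  have h1 := DFunLike.congr_fun h 1
  have h2 := DFunLike.congr_fun h 2
  have h3 := DFunLike.congr_fun h 3
  have h4 := DFunLike.congr_fun h 4
  simp only [blockExp, expo5_one, expo5_two, expo5_three, expo5_four, blockEps] at h1 h2 h3 h4
  fin_cases i <;> fin_cases i' <;> simp at h1 h2 h3 h4 ⊢ <;> omega

theorem degree_blockExp {k : ℕ} (hk : 1 ≤ k) {i : Fin 4} {u : ℕ} (hu : u ≤ blockMax k i) :
    blockExp k i u 0 + blockExp k i u 1 + blockExp k i u 2 + blockExp k i u 3 + blockExp k i u 4 =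
      genDeg k := by
  have := self_le_sq k
  simp only [blockExp, expo5_zero, expo5_one, expo5_two, expo5_three, expo5_four, blockEps, genDeg]
  fin_cases i <;> simp [blockMax] at hu ⊢ <;> omega

theorem firstDeg_blockExp {k : ℕ} (hk : 1 ≤ k) (i : Fin 4) (u : ℕ) :
    firstDeg (6 * k) (blockExp k i u) = 12 * k - 2 := by
  simp only [blockExp, firstDeg, expo5_one, expo5_three, expo5_four]
  fin_cases i <;> simp <;> omega

theorem lastDeg_blockExp {k : ℕ} (hk : 1 ≤ k) {i : Fin 4} {u : ℕ} (hu : u ≤ blockMax k i) :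
    lastDeg (6 * k) (blockExp k i u) + 3 * u = 3 * (blockCol k i + colShift k) + 2 := by
  have hq := self_le_sq k
  have h1 : (6 * k - 1) * (6 * k - 2) = 36 * k ^ 2 - 18 * k + 2 := by
    obtain ⟨j, rfl⟩ := Nat.exists_eq_add_of_le hk
    zify [show 1 ≤ 6 * (1 + j) by omega, show 2 ≤ 6 * (1 + j) by omega,
      show 18 * (1 + j) ≤ 36 * (1 + j) ^ 2 by omega]
    ring
  have h2 : (6 * k - 1) * (6 * k - 1) = 36 * k ^ 2 - 12 * k + 1 := by
    obtain ⟨j, rfl⟩ := Nat.exists_eq_add_of_le hk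
    zify [show 1 ≤ 6 * (1 + j) by omega,
      show 12 * (1 + j) ≤ 36 * (1 + j) ^ 2 by omega]
    ring
  have h3 : (6 * k - 1) * (12 * k - 2) = 72 * k ^ 2 - 24 * k + 2 := by
    obtain ⟨j, rfl⟩ := Nat.exists_eq_add_of_le hk
    zify [show 1 ≤ 6 * (1 + j) by omega, show 2 ≤ 12 * (1 + j) by omega,
      show 24 * (1 + j) ≤ 72 * (1 + j) ^ 2 by omega]
    ring
  simp only [blockExp, lastDeg, expo5_zero, expo5_four, blockCol, colShift]
  fin_cases i <;> simp [blockMax, h1, h2, h3] at hu ⊢ <;> omega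

/-- The exponents of the monomials in `y₀, y₁, y₂` that occur in the images of the monomials
`blockExp k i u`. -/
noncomputable def targetExp (k n : ℕ) : Fin 3 →₀ ℕ :=
  expo (12 * k - 2) (6 * k * genDeg k - (12 * k - 2) - (3 * n + 2)) (3 * n + 2)

theorem le_of_lt_colBound {k n : ℕ} (hk : 1 ≤ k) (hn : n < 78 * k ^ 2 - 41 * k + 4) :
    12 * k - 2 + (3 * n + 2) ≤ 6 * k * genDeg k := by
  have hq := self_le_sq k
  have : 6 * genDeg k ≤ 6 * k * genDeg k := Nat.mul_le_mul_right _ (by omega)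
  simp only [genDeg] at this ⊢
  omega

theorem expo_eq_targetExp {k n : ℕ} {s : Fin 5 →₀ ℕ} (hk : 1 ≤ k)
    (hs : s 0 + s 1 + s 2 + s 3 + s 4 = genDeg k) (h0 : firstDeg (6 * k) s = 12 * k - 2) {j : ℕ}
    (hj : j ≤ s 2) (h2 : lastDeg (6 * k) s + 3 * j = 3 * n + 2) :
    expo (firstDeg (6 * k) s) (midDeg (6 * k) s + 3 * (s 2 - j)) (lastDeg (6 * k) s + 3 * j) =
      targetExp k n := by
  have h := firstDeg_add (m := 6 * k) (by omega) s
  rw [hs] at h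
  rw [targetExp, ← h, ← h0, ← h2]
  congr 1
  omega

/-- Setting `y₀ = y₁ = 1` turns the image of the monomial `blockExp k i u` into a power of `y₂` times
`(1 + y₂ ^ 3) ^ (3 * u + blockEps i)`; its coefficients are the entries of a binomial row. -/
theorem coeff_targetExp_blockExp {k n : ℕ} (hk : 1 ≤ k) {i : Fin 4} {u : ℕ}
    (hu : u ≤ blockMax k i) :
    coeff (targetExp k n) (aeval (forms K (6 * k)) (monomial (blockExp k i u) (1 : K))) =
      (fullEntry k i u n : K) := by
  have hl := lastDeg_blockExp hk hu
  have hs2 : blockExp k i u 2 = 3 * u + blockEps i := rfl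
  by_cases h : blockCol k i + colShift k ≤ n + u ∧
      n + u - (blockCol k i + colShift k) ≤ 3 * u + blockEps i
  · rw [← expo_eq_targetExp hk (degree_blockExp hk hu) (firstDeg_blockExp hk i u)
      (j := n + u - (blockCol k i + colShift k)) (by omega) (by omega),
      coeff_aeval_forms (by omega) _ (by omega), fullEntry, binomEntry, if_pos h.1, hs2]
  · rw [fullEntry, binomEntry_eq_zero (by omega), Nat.cast_zero]
    by_contra hne
    obtain ⟨j, hj, hd⟩ := exists_of_coeff_aeval_forms_ne_zero (by omega) hne
    have h2 := DFunLike.congr_fun hd 2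
    simp only [targetExp, expo_two] at h2
    omega

/-- Only the monomials in the four blocks contribute to the coefficients at `targetExp k n`. -/
theorem exists_blockExp_of_coeff_ne_zero {k n : ℕ} (hk : 1 ≤ k)
    (hn : n < 78 * k ^ 2 - 41 * k + 4) {s : Fin 5 →₀ ℕ}
    (h : coeff (targetExp k n) (aeval (forms K (6 * k)) (monomial s (1 : K))) ≠ 0) :
    ∃ i u, u ≤ blockMax k i ∧ s = blockExp k i u := by
  obtain ⟨j, hj, hd⟩ := exists_of_coeff_aeval_forms_ne_zero (by omega) h
  have hq := self_le_sq k
  have hle := le_of_lt_colBound hk hn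
  have h0 : firstDeg (6 * k) s = 12 * k - 2 := (DFunLike.congr_fun hd 0).symm
  have h1 := DFunLike.congr_fun hd 1
  have h2 := DFunLike.congr_fun hd 2
  simp only [targetExp, expo_one, expo_two] at h1 h2
  have hs : s 0 + s 1 + s 2 + s 3 + s 4 = genDeg k := by
    refine Nat.eq_of_mul_eq_mul_left (show 0 < 6 * k by omega) ?_
    rw [← firstDeg_add (by omega)]
    omega
  -- the degree in `y₂` modulo `3`, as `6 k - 1` is `2` modulo `3`
  have hmod : (s 0 + 2 * s 4) % 3 = 2 := by
    obtain ⟨k, rfl⟩ := Nat.exists_eq_add_of_le hk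
    rw [lastDeg, show 6 * (1 + k) - 1 = 3 * (2 * k + 1) + 2 by omega, add_mul, mul_assoc] at h2
    omega
  rw [← expo5_eta s]
  simp only [firstDeg, genDeg] at h0 hs
  have hcases : (s 1 = 2 ∧ s 3 = 0 ∧ s 4 = 0) ∨ (s 1 = 0 ∧ s 3 = 1 ∧ s 4 = 6 * k - 2) ∨
      (s 1 = 1 ∧ s 3 = 0 ∧ s 4 = 6 * k - 1) ∨ (s 1 = 0 ∧ s 3 = 0 ∧ s 4 = 12 * k - 2) := by
    have hs1 : s 1 ≤ 2 := by
      by_contra hlt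
      have := Nat.mul_le_mul_left (6 * k - 1) (show 3 ≤ s 1 by omega)
      omega
    have hs3 : s 3 ≤ 1 := by
      by_contra hlt
      have := Nat.mul_le_mul_left (6 * k) (show 2 ≤ s 3 by omega)
      omega
    interval_cases s 1 <;> interval_cases s 3 <;> omega
  rcases hcases with ⟨e1, e3, e4⟩ | ⟨e1, e3, e4⟩ | ⟨e1, e3, e4⟩ | ⟨e1, e3, e4⟩ <;>
    rw [e1, e3, e4] at hs <;> rw [e1, e3, e4] <;> rw [e4] at hmod
  · refine ⟨0, s 2 / 3, ?_, ?_⟩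
    · simp [blockMax]; omega
    · simp only [blockExp, blockEps, Matrix.cons_val]
      congr 1 <;> omega
  · refine ⟨1, (s 2 - 2) / 3, ?_, ?_⟩
    · simp [blockMax]; omega
    · simp only [blockExp, blockEps, Matrix.cons_val]
      congr 1 <;> omega
  · refine ⟨2, s 2 / 3, ?_, ?_⟩
    · simp [blockMax]; omega
    · simp only [blockExp, blockEps, Matrix.cons_val]
      congr 1 <;> omega
  · refine ⟨3, s 2 / 3, ?_, ?_⟩
    · simp [blockMax]; omega
    · simp only [blockExp, blockEps, Matrix.cons_val]
      congr 1 <;> omega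

/-- The coefficients of an equation of the surface at the monomials of the four blocks satisfy
the linear system. -/
theorem isRelation_coeff {k : ℕ} (hk : 1 ≤ k) {G : MvPolynomial (Fin 5) K}
    (hG : aeval (forms K (6 * k)) G = 0) :
    IsRelation k fun i u => coeff (blockExp k i u) G := by
  classical
  intro n hn
  let c : (Fin 5 →₀ ℕ) → K := fun s => coeff s G *
    coeff (targetExp k n) (aeval (forms K (6 * k)) (monomial s (1 : K)))
  have h1 : ∑ s ∈ G.support, c s = 0 := by
    have h := congrArg (coeff (targetExp k n)) hG
    rw [G.as_sum, map_sum, coeff_sum, coeff_zero] at h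
    rw [← h]
    refine Finset.sum_congr rfl fun s _ => ?_
    rw [← mul_one (coeff s G), ← smul_eq_mul (a := coeff s G), ← smul_monomial, map_smul, coeff_smul]
    simp [c]
  let T : Finset (Σ _ : Fin 4, ℕ) := Finset.univ.sigma fun i => Finset.range (blockMax k i + 1)
  have h2 : ∑ s ∈ T.image (fun p => blockExp k p.1 p.2), c s = 0 := by
    rw [← h1]
    rw [Finset.sum_subset (s₁ := G.support)
      (s₂ := G.support ∪ T.image fun p => blockExp k p.1 p.2) Finset.subset_union_left]
    · refine Finset.sum_subset Finset.subset_union_right fun s _ hs => ?_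
      by_contra hne
      obtain ⟨i, u, hu, rfl⟩ := exists_blockExp_of_coeff_ne_zero hk hn (right_ne_zero_of_mul hne)
      exact hs (Finset.mem_image.2 ⟨⟨i, u⟩, by simp [T]; omega, rfl⟩)
    · intro s _ hs
      rw [notMem_support_iff] at hs
      simp [c, hs]
  rw [Finset.sum_image] at h2
  · rw [Finset.sum_sigma', ← h2]
    refine Finset.sum_congr rfl fun p hp => ?_
    have hp' : p.2 ≤ blockMax k p.1 :=
      Nat.lt_succ_iff.1 (Finset.mem_range.1 (Finset.mem_sigma.1 hp).2)
    simp only [c, coeff_targetExp_blockExp hk hp']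
  · rintro ⟨i, u⟩ _ ⟨i', u'⟩ _ h
    obtain ⟨rfl, rfl⟩ := blockExp_injective h
    rfl

/-- `matN` has more rows than columns, so its rows satisfy a linear relation. -/
theorem exists_vecMul_matN_eq_zero (k : ℕ) :
    ∃ w : Fin (54 * k ^ 2 - 27 * k + 4) → K, w ≠ 0 ∧ Matrix.vecMul w (matN K k) = 0 := by
  have h := LinearMap.ker_ne_bot_of_finrank_lt (f := (matN K k).vecMulLinear) (by simp)
  obtain ⟨w, hw, hne⟩ := Submodule.exists_mem_ne_zero_of_ne_bot h
  exact ⟨w, hne, hw⟩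

/-- A nonzero equation of degree `genDeg k` that is a combination of the monomials in the four
blocks of `matN`. -/
theorem exists_relation_equation {k : ℕ} (hk : 1 ≤ k) :
    ∃ F : MvPolynomial (Fin 5) K, aeval (forms K (6 * k)) F = 0 ∧ F.IsHomogeneous (genDeg k) ∧
      ∃ i u, u ≤ blockLast k i ∧ coeff (blockExp k i u) F ≠ 0 := by
  have hq := self_le_sq k
  have hsum := sum_blockLast hk
  obtain ⟨w, hw, hwN⟩ := exists_vecMul_matN_eq_zero (K := K) k
  let σ : ℕ → Fin 4 × ℕ :=
    stackIndex (blockLast k 0 + 1) (blockLast k 1 + 1) (blockLast k 2 + 1)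
  have hσ : ∀ p : Fin (54 * k ^ 2 - 27 * k + 4), (σ p).2 ≤ blockLast k (σ p).1 := fun p =>
    Nat.lt_succ_iff.1 (stackIndex_lt (fun i => blockLast k i + 1) (by have := p.2; omega))
  have hσ' : ∀ p : Fin (54 * k ^ 2 - 27 * k + 4), (σ p).2 ≤ blockMax k (σ p).1 := fun p =>
    (hσ p).trans (blockLast_le_blockMax hk _)
  let F : MvPolynomial (Fin 5) K := ∑ p, w p • monomial (blockExp k (σ p).1 (σ p).2) 1
  have hcoeff : ∀ p : Fin (54 * k ^ 2 - 27 * k + 4), coeff (blockExp k (σ p).1 (σ p).2) F = w p := by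
    intro p
    rw [coeff_sum, Finset.sum_eq_single p]
    · simp
    · intro p' _ hne
      rw [coeff_smul, coeff_monomial, if_neg, smul_zero]
      intro h
      have h' := blockExp_injective h
      exact hne (Fin.ext (stackIndex_injective _ _ _ (Prod.ext h'.1 h'.2)))
    · exact fun h => absurd (Finset.mem_univ _) h
  refine ⟨F, ?_, ?_, ?_⟩
  · ext d
    rw [coeff_zero, map_sum, coeff_sum]
    simp only [map_smul, coeff_smul, smul_eq_mul]
    by_cases hd : ∃ n, d = targetExp k n
    · obtain ⟨n, rfl⟩ := hd
      simp only [coeff_targetExp_blockExp hk (hσ' _)]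
      -- columns to the left or to the right of `matN` do not meet the rows of `matN`
      by_cases hn : colShift k ≤ n ∧ n < 54 * k ^ 2 - 27 * k + 3 + colShift k
      · obtain ⟨v, rfl⟩ := Nat.exists_eq_add_of_le' hn.1
        have := congrFun hwN ⟨v, by omega⟩
        simp only [Matrix.vecMul, dotProduct, matN_apply] at this
        simp only [fullEntry_add]
        exact this
      · refine Finset.sum_eq_zero fun p _ => ?_
        rw [fullEntry, binomEntry_eq_zero, Nat.cast_zero, mul_zero]
        have h := hσ p
        generalize (σ p).1 = i at h ⊢
        generalize (σ p).2 = u at h ⊢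
        fin_cases i <;>
          simp [blockLast, blockCol, blockEps, bOne, bTwo, bThree, bFour] at h ⊢ <;> omega
    · refine Finset.sum_eq_zero fun p _ => ?_
      by_contra hne
      obtain ⟨j, hj, rfl⟩ :=
        exists_of_coeff_aeval_forms_ne_zero (by omega) (right_ne_zero_of_mul hne)
      have hl := lastDeg_blockExp hk (hσ' p)
      have hu : (σ p).2 ≤ blockCol k (σ p).1 + colShift k := by
        have h := hσ' p
        generalize (σ p).1 = i at h ⊢
        generalize (σ p).2 = u at h ⊢
        fin_cases i <;> simp [blockMax, blockCol, colShift] at h ⊢ <;> omega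
      exact hd ⟨blockCol k (σ p).1 + colShift k - (σ p).2 + j,
        expo_eq_targetExp hk (degree_blockExp hk (hσ' p)) (firstDeg_blockExp hk _ _) hj (by omega)⟩
  · refine IsHomogeneous.sum _ _ _ fun p _ => ?_
    rw [smul_monomial]
    refine isHomogeneous_monomial _ ?_
    rw [← degree_blockExp hk (hσ' p), Finsupp.degree_eq_sum, Fin.sum_univ_five]
  · obtain ⟨p, hp⟩ := Function.ne_iff.1 hw
    exact ⟨(σ p).1, (σ p).2, hσ p, by rw [hcoeff]; exact hp⟩

/-- An equation of degree `genDeg k` that does not lie in the product of the ideal of the surface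
with the irrelevant ideal. In a combination `∑ Xⱼ Gⱼ` of equations `Gⱼ`, each term `Xⱼ Gⱼ` lacks
the first monomial of the first block (if `2 ≤ j`) or the last monomial of the second block
(if `j ≤ 1`), so that its coefficients in the four blocks vanish. -/
theorem exists_equation_not_mem {k : ℕ} (hk : 1 ≤ k) (hL : IsUnit (matL K k))
    (hW : IsUnit (matW K k)) :
    ∃ F : MvPolynomial (Fin 5) K, aeval (forms K (6 * k)) F = 0 ∧ F.IsHomogeneous (genDeg k) ∧
      ∀ G : Fin 5 → MvPolynomial (Fin 5) K, (∀ j, aeval (forms K (6 * k)) (G j) = 0) →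
        F ≠ ∑ j, X j * G j := by
  have hq := self_le_sq k
  obtain ⟨F, hF, hFd, i, u, hu, hne⟩ := exists_relation_equation (K := K) hk
  refine ⟨F, hF, hFd, fun G hG hsum => hne ?_⟩
  rw [hsum, coeff_sum]
  refine Finset.sum_eq_zero fun j _ => ?_
  have hrel := isRelation_coeff hk (G := X j * G j) (by rw [map_mul, hG, mul_zero])
  have hzero : ∀ s : Fin 5 →₀ ℕ, s j = 0 → coeff s (X j * G j) = 0 := by
    intro s hs
    rw [coeff_X_mul', if_neg (by simpa using hs)]
  by_cases hj : j = 0 ∨ j = 1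
  · refine hrel.eq_zero_of_isUnit_matW hk hW (hzero _ ?_) hu
    rcases hj with rfl | rfl
    · simp [blockExp, bTwo]
      omega
    · simp [blockExp]
  · refine hrel.eq_zero_of_isUnit_matL hk hL (hzero _ ?_) hu
    fin_cases j <;> simp [blockExp, blockEps] at hj ⊢

end Multidegree

/-! ### Generators of large degree and regularity -/

section Generators

variable {K : Type*} [Field K] {n : ℕ}

/-- Among the finite sets of homogeneous generators, one of smallest cardinality is minimal. -/
theorem exists_isMinimalGenSet {T : Set (MvPolynomial (Fin (n + 1)) K)}
    (hT : ∀ F ∈ T, ∃ d : ℕ, F.IsHomogeneous d) : ∃ G, IsMinimalGenSet (Ideal.span T) G := by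
  classical
  have hex : ∃ r : ℕ, ∃ G : Finset (MvPolynomial (Fin (n + 1)) K), G.card = r ∧
      (∀ g ∈ G, ∃ d : ℕ, g.IsHomogeneous d) ∧ Ideal.span (G : Set _) = Ideal.span T := by
    obtain ⟨G, hGT, hG⟩ := (Submodule.fg_span_iff_fg_span_finset_subset T).1
      (IsNoetherian.noetherian (Ideal.span T))
    exact ⟨_, G, rfl, fun g hg => hT g (hGT hg), hG.symm⟩
  obtain ⟨G, hcard, hhom, hspan⟩ := Nat.find_spec hex
  refine ⟨G, hhom, hspan, fun g hg hmem => ?_⟩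
  refine Nat.find_min hex (m := (G.erase g).card) ?_ ⟨G.erase g, rfl,
    fun f hf => hhom f (Finset.mem_of_mem_erase hf), ?_⟩
  · rw [← hcard]
    exact Finset.card_erase_lt_of_mem hg
  · rw [Finset.coe_erase, ← hspan]
    refine le_antisymm (Ideal.span_mono Set.sdiff_subset) (Ideal.span_le.2 fun f hf => ?_)
    by_cases hfg : f = g
    · rw [hfg]
      exact hmem
    · exact Ideal.subset_span ⟨hf, hfg⟩

theorem mem_span_X_of_isHomogeneous {f : MvPolynomial (Fin (n + 1)) K} {e : ℕ}
    (hf : f.IsHomogeneous e) (he : e ≠ 0) :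
    f ∈ Ideal.span (Set.range (X : Fin (n + 1) → MvPolynomial (Fin (n + 1)) K)) := by
  rw [← Set.image_univ, mem_ideal_span_X_image]
  intro s hs
  by_contra! h
  refine he ?_
  have hs0 : s = 0 := Finsupp.ext fun i => h i (Set.mem_univ i)
  rw [← hf (mem_support_iff.1 hs), hs0, map_zero]

/-- An element of degree `d` of an ideal with homogeneous generators of degree less than `d` lies
in the product with the irrelevant ideal. -/
theorem exists_eq_sum_X_mul {G : Set (MvPolynomial (Fin (n + 1)) K)} {d : ℕ}
    (hG : ∀ g ∈ G, ∃ e < d, g.IsHomogeneous e) {F : MvPolynomial (Fin (n + 1)) K}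
    (hF : F ∈ Ideal.span G) (hFd : F.IsHomogeneous d) :
    ∃ H : Fin (n + 1) → MvPolynomial (Fin (n + 1)) K, (∀ j, H j ∈ Ideal.span G) ∧
      F = ∑ j, X j * H j := by
  obtain ⟨c, hc, hsum⟩ := Submodule.mem_span_set.1 hF
  have hmem : F ∈ Ideal.span G • Submodule.span (MvPolynomial (Fin (n + 1)) K)
      (Set.range (X : Fin (n + 1) → MvPolynomial (Fin (n + 1)) K)) := by
    have h : homogeneousComponent d F = F := by
      rw [homogeneousComponent_of_mem hFd, if_pos rfl]
    rw [← h, ← hsum, Finsupp.sum, map_sum]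
    refine Submodule.sum_mem _ fun g hg => ?_
    obtain ⟨e, he, hge⟩ := hG g (hc hg)
    obtain ⟨t, rfl⟩ := Nat.exists_eq_add_of_lt he
    rw [show e + t + 1 = (t + 1) + e by ring, show c g • g = c g * g from rfl,
      homogeneousComponent_mul_of_isHomogeneous hge, mul_comm]
    exact Submodule.smul_mem_smul (Ideal.subset_span (hc hg))
      (mem_span_X_of_isHomogeneous (homogeneousComponent_isHomogeneous _ _) (Nat.succ_ne_zero t))
  obtain ⟨a, ha, hsum'⟩ := (Submodule.mem_ideal_smul_span_iff_exists_sum _ _ _).1 hmem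
  refine ⟨a, ha, ?_⟩
  rw [← hsum', Finsupp.sum_fintype _ _ (by simp)]
  exact Finset.sum_congr rfl fun j _ => by rw [smul_eq_mul, mul_comm]

/-- A form of degree `d` outside the product with the irrelevant ideal forces a minimal generator
of degree at least `d`. -/
theorem le_maxdeg {T : Set (MvPolynomial (Fin (n + 1)) K)}
    (hT : ∀ F ∈ T, ∃ d : ℕ, F.IsHomogeneous d) {F : MvPolynomial (Fin (n + 1)) K} {d : ℕ}
    (hF : F ∈ Ideal.span T) (hFd : F.IsHomogeneous d)
    (h : ∀ H : Fin (n + 1) → MvPolynomial (Fin (n + 1)) K, (∀ j, H j ∈ Ideal.span T) →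
      F ≠ ∑ j, X j * H j) : ((d : ℝ) : EReal) ≤ maxdeg (Ideal.span T) := by
  obtain ⟨G, hG⟩ := exists_isMinimalGenSet hT
  obtain ⟨g, hg, hgd⟩ : ∃ g ∈ G, d ≤ g.totalDegree := by
    by_contra! hlt
    have hspan := hG.2.1
    rw [← hspan] at hF h
    obtain ⟨H, hH, hsum⟩ := exists_eq_sum_X_mul (fun g hg => by
      obtain ⟨e, he⟩ := hG.1 g hg
      have hg0 : g ≠ 0 := by
        rintro rfl
        exact hG.2.2 0 hg (zero_mem _)
      exact ⟨e, by rw [← he.totalDegree hg0]; exact hlt g hg, he⟩) hF hFd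
    exact h H hH hsum
  refine le_trans ?_ (le_sSup ⟨G, hG, g, hg, rfl⟩)
  exact_mod_cast hgd

/-- A form of degree `d` outside the product with the irrelevant ideal forces the regularity to be
at least `d`, by Mumford's theorem. -/
theorem le_regularity {X' : Set (ProjSpace K n)} (hn : 1 ≤ n)
    (hsat : ∀ (j : Fin (n + 1)) (f : MvPolynomial (Fin (n + 1)) K),
      X j * f ∈ homogIdeal X' → f ∈ homogIdeal X')
    {F : MvPolynomial (Fin (n + 1)) K} {d : ℕ} (hF : F ∈ homogIdeal X') (hFd : F.IsHomogeneous d)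
    (h : ∀ H : Fin (n + 1) → MvPolynomial (Fin (n + 1)) K, (∀ j, H j ∈ homogIdeal X') →
      F ≠ ∑ j, X j * H j) : ((d : ℝ) : EReal) ≤ regularity X' := by
  refine le_sInf ?_
  rintro _ ⟨q, hq, rfl⟩
  have hdq : (d : ℤ) ≤ q := by
    by_contra! hlt
    obtain ⟨H, hH, hsum⟩ := mem_span_X_mul_of_isCMRegular hn hsat hq hF hFd hlt
    exact h H hH hsum
  exact_mod_cast hdq

theorem forms_ne_zero {m : ℕ} (j : Fin 5) : forms K m j ≠ 0 := by
  have hX (i : Fin 3) : (X i : MvPolynomial (Fin 3) K) ≠ 0 := X_ne_zero i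
  fin_cases j
  · exact mul_ne_zero (pow_ne_zero _ (hX 1)) (hX 2)
  · exact mul_ne_zero (pow_ne_zero _ (hX 0)) (hX 1)
  · intro h
    have := congrArg (eval ![0, 1, 0]) h
    simp [forms] at this
  · exact pow_ne_zero _ (hX 0)
  · exact mul_ne_zero (pow_ne_zero _ (hX 2)) (hX 0)

theorem mem_homogIdeal_surf_of_X_mul_mem [Infinite K] {m : ℕ} (hm : 6 ≤ m) (j : Fin 5)
    (f : MvPolynomial (Fin 5) K) (h : X j * f ∈ homogIdeal (surf K m)) :
    f ∈ homogIdeal (surf K m) := by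
  rw [homogIdeal_surf_eq_ker hm, RingHom.mem_ker, map_mul, aeval_X] at h
  rw [homogIdeal_surf_eq_ker hm, RingHom.mem_ker]
  exact (mul_eq_zero.1 h).resolve_left (forms_ne_zero j)

theorem le_maxdeg_surf_and_le_regularity_surf [Infinite K] {k : ℕ} (hk : 1 ≤ k)
    (hL : IsUnit (matL K k)) (hW : IsUnit (matW K k)) :
    ((genDeg k : ℝ) : EReal) ≤ maxdeg (homogIdeal (surf K (6 * k))) ∧
      ((genDeg k : ℝ) : EReal) ≤ regularity (surf K (6 * k)) := by
  obtain ⟨F, hF, hFd, hFG⟩ := exists_equation_not_mem hk hL hW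
  have hm : 6 ≤ 6 * k := by omega
  have hmem (G : MvPolynomial (Fin 5) K) :
      G ∈ homogIdeal (surf K (6 * k)) ↔ aeval (forms K (6 * k)) G = 0 := by
    rw [homogIdeal_surf_eq_ker hm, RingHom.mem_ker]
  have hFG' : ∀ H : Fin 5 → MvPolynomial (Fin 5) K,
      (∀ j, H j ∈ homogIdeal (surf K (6 * k))) → F ≠ ∑ j, X j * H j :=
    fun H hH => hFG H fun j => (hmem _).1 (hH j)
  exact ⟨le_maxdeg (fun _ h => h.1) ((hmem F).2 hF) hFd hFG',
    le_regularity (by norm_num) (mem_homogIdeal_surf_of_X_mul_mem hm) ((hmem F).2 hF) hFd hFG'⟩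

end Generators

end EG

theorem theoremA (K : Type*) [Field K] [IsAlgClosed K] [CharZero K] (m : ℕ) (hm : 6 ≤ m) :
    EG.IsProjSurface (EG.surf K m) ∧
    EG.HasDegree (EG.surf K m) (m ^ 2 - m + 3) ∧
    ∀ k : ℕ, m = 6 * k → IsUnit (EG.matL K k) → IsUnit (EG.matW K k) →
      ((3 / 2 * (m : ℝ) ^ 2 - 7 / 2 * (m : ℝ) + 1 : ℝ) : EReal)
          ≤ EG.maxdeg (EG.homogIdeal (EG.surf K m)) ∧
      EG.IsEisenbudGotoCounterexample (EG.surf K m) := by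
  refine ⟨⟨EG.isProjVariety_surf hm, EG.topologicalKrullDim_surf hm⟩, EG.hasDegree_surf hm, ?_⟩
  rintro k rfl hL hW
  have hk : 1 ≤ k := by omega
  obtain ⟨h1, h2⟩ := EG.le_maxdeg_surf_and_le_regularity_surf hk hL hW
  have hk' : (1 : ℝ) ≤ k := by exact_mod_cast hk
  have hd : (EG.genDeg k : ℝ) = 54 * (k : ℝ) ^ 2 - 21 * k + 1 := by
    have := EG.self_le_sq k
    rw [EG.genDeg]
    push_cast [Nat.cast_sub (show 21 * k ≤ 54 * k ^ 2 by omega)]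
    ring
  constructor
  · refine le_trans (EReal.coe_le_coe_iff.2 ?_) h1
    rw [hd]
    push_cast
    nlinarith
  · refine ⟨EG.isProjVariety_surf hm, EG.isNondegenerate_surf hm, 2, _,
      EG.topologicalKrullDim_surf hm, EG.hasDegree_surf hm,
      lt_of_lt_of_le (EReal.coe_lt_coe_iff.2 ?_) h2⟩
    rw [hd]
    have : 6 * k ≤ (6 * k) ^ 2 := EG.self_le_sq _
    push_cast [Nat.cast_sub this]
    nlinarith
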